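/- Let $\mathbf k$ be a field, $H=(H,\Delta,\epsilon)$ any $\mathbf k$-bialgebra (written $\Delta(h)=h_{(1)}\otimes h_{(2)}$), and $F=F^1\otimes F^2\in H\otimes H$ a Drinfeld twist, i.e. an invertible element, with inverse $F^{-1}=\bar F^1\otimes\bar F^2$, such that $F^1\otimes F'^1F^2_{(1)}\otimes F'^2F^2_{(2)}=F'^1F^1_{(1)}\otimes F'^2F^1_{(2)}\otimes F^2$ and $(\epsilon\otimes\mathrm{id})(F)=(\mathrm{id}\otimes\epsilon)(F)=1$. Let $A$ be a braided commutative left-right Yetter–Drinfeld $H$-module algebra: a left $H$-module algebra with a right $H$-coaction $\rho(a)=a_{[0]}\otimes a_{[1]}$ such that $(h_{(1)}\triangleright a_{[0]})\otimes h_{(2)}a_{[1]}=(h_{(2)}\triangleright a)_{[0]}\otimes(h_{(2)}\triangleright a)_{[1]}h_{(1)}$, $\rho(ab)=a_{[0]}b_{[0]}\otimes b_{[1]}a_{[1]}$, $\rho(1)=1\otimes1$ and $b_{[0]}(b_{[1]}\triangleright a)=ab$ for all $h\in H$, $a,b\in A$. (The coaction is arbitrary, and $H$ need not be quasitriangular.)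 Let $H^F$ be the algebra $H$ with coproduct $h\mapsto F\Delta(h)F^{-1}$ and counit $\epsilon$, and let $A_F$ be the $H$-module $A$ with product $a\cdot_F b=(\bar F^1\triangleright a)(\bar F^2\triangleright b)$ and coaction $\rho^F(a)=F^1\triangleright(\bar F^2\triangleright a)_{[0]}\otimes F^2(\bar F^2\triangleright a)_{[1]}\bar F^1$. Then $A_F$ is a braided commutative Yetter–Drinfeld $H^F$-module algebra. The scalar extension $A$-bialgebroid $\mathcal H=A\sharp H$ is the smash product algebra, $(a\sharp h)(b\sharp k)=a(h_{(1)}\triangleright b)\sharp h_{(2)}k$, with source $s(a)=a\sharp1$, target $t(a)=a_{[0]}\sharp a_{[1]}$, comultiplication $\Delta^{\mathcal H}(a\sharp h)=(a\sharp h_{(1)})\otimes_A(1\sharp h_{(2)})$ and counit $\epsilon^{\mathcal H}(a\sharp h)=a\,\epsilon(h)$; it is a left bialgebroid over $A$, and likewise $A_F\sharp H^F$ is a left bialgebroid over $A_F$. The element $\mathcal G=(1\sharp\bar F^1)\otimes_A(1\sharp\bar F^2)\in\mathcal H\otimes_A\mathcal H$ is an invertible (Drinfeld–Xu) bialgebroid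 2-cocycle, with inverse $\mathcal G^{-1}=(1\sharp F^1)\otimes_{A^{\mathcal G}}(1\sharp F^2)$. Write $x\blacktriangleright a=\epsilon^{\mathcal H}(x\,s(a))$. The twist $\mathcal H^{\mathcal G}=(A\sharp H)^{\mathcal G}$ has the algebra $A\sharp H$ as total algebra, the vector space $A$ with product $a*b=(\mathcal G^1\blacktriangleright a)(\mathcal G^2\blacktriangleright b)$ as base algebra $A^{\mathcal G}$, source $s^{\mathcal G}(a)=s(\mathcal G^1\blacktriangleright a)\mathcal G^2$, target $t^{\mathcal G}(a)=t(\mathcal G^2\blacktriangleright a)\mathcal G^1$, comultiplication $x\mapsto\mathcal G^{-1}\Delta^{\mathcal H}(x)\mathcal G\in\mathcal H\otimes_{A^{\mathcal G}}\mathcal H$ and counit $\epsilon^{\mathcal H}$; it is a left bialgebroid over $A^{\mathcal G}$. Then the map $$\zeta_{A,H}\colon A_F\sharp H^F\to A\sharp H,\qquad a\sharp h\mapsto(\bar F^1\triangleright a)\sharp\bar F^2h,$$ is an isomorphism of algebras, the algebras $A_F$ and $A^{\mathcal G}$ coincide, and $\zeta_{A,H}$, together with the identity map $A_F\to A^{\mathcal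 G}$ of the base algebras, is an isomorphism of left bialgebroids from the scalar extension $A_F$-bialgebroid $A_F\sharp H^F$ to the twist $(A\sharp H)^{\mathcal G}$: it commutes with the source maps, the target maps, the comultiplications and the counits. -/

import Mathlib

open scoped TensorProduct

namespace ScalarExt

noncomputable section

/-! ## Drinfeld twists and twisted bialgebras -/

section Twist

variable (k H : Type*) [Field k] [Ring H] [Bialgebra k H]

/-- `Δ ⊗ id : H ⊗ H → H ⊗ (H ⊗ H)`. -/
def comulFst : H ⊗[k] H →ₐ[k] H ⊗[k] (H ⊗[k] H) :=
  (Algebra.TensorProduct.assoc k k k H H H).toAlgHom.comp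
    (Algebra.TensorProduct.map (Bialgebra.comulAlgHom k H) (AlgHom.id k H))

/-- `id ⊗ Δ : H ⊗ H → H ⊗ (H ⊗ H)`. -/
def comulSnd : H ⊗[k] H →ₐ[k] H ⊗[k] (H ⊗[k] H) :=
  Algebra.TensorProduct.map (AlgHom.id k H) (Bialgebra.comulAlgHom k H)

/-- `z ↦ z ⊗ 1 ∈ H ⊗ (H ⊗ H)`. -/
def leg12 : H ⊗[k] H →ₐ[k] H ⊗[k] (H ⊗[k] H) :=
  (Algebra.TensorProduct.assoc k k k H H H).toAlgHom.comp
    (Algebra.TensorProduct.includeLeft : H ⊗[k] H →ₐ[k] (H ⊗[k] H) ⊗[k] H)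

/-- `z ↦ 1 ⊗ z ∈ H ⊗ (H ⊗ H)`. -/
def leg23 : H ⊗[k] H →ₐ[k] H ⊗[k] (H ⊗[k] H) :=
  (Algebra.TensorProduct.includeRight : H ⊗[k] H →ₐ[k] H ⊗[k] (H ⊗[k] H))

/-- A (counital) Drinfeld twist for the bialgebra `H`: an invertible `F ∈ H ⊗ H` such that
`F¹ ⊗ F'¹F²₍₁₎ ⊗ F'²F²₍₂₎ = F'¹F¹₍₁₎ ⊗ F'²F¹₍₂₎ ⊗ F²` and `(ε ⊗ id)F = (id ⊗ ε)F = 1`. -/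
structure DrinfeldTwist where
  /-- the invertible element `F`, with inverse `F⁻¹` -/
  val : (H ⊗[k] H)ˣ
  cocycle : leg23 k H val * comulSnd k H val = leg12 k H val * comulFst k H val
  counit_fst : TensorProduct.lid k H
    (TensorProduct.map (Coalgebra.counit (R := k) (A := H)) LinearMap.id (val : H ⊗[k] H)) = 1
  counit_snd : TensorProduct.rid k H
    (TensorProduct.map LinearMap.id (Coalgebra.counit (R := k) (A := H)) (val : H ⊗[k] H)) = 1

end Twist

namespace DrinfeldTwist

variable {k H : Type*} [Field k] [Ring H] [Bialgebra k H] (F : DrinfeldTwist k H)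

/-- `F` as an element of `H ⊗ H`. -/
abbrev elt : H ⊗[k] H := (F.val : H ⊗[k] H)

/-- `F⁻¹ = F̄¹ ⊗ F̄²` as an element of `H ⊗ H`. -/
abbrev inv : H ⊗[k] H := ((F.val⁻¹ : (H ⊗[k] H)ˣ) : H ⊗[k] H)

theorem cocycle_inv :
    comulSnd k H F.inv * leg23 k H F.inv = comulFst k H F.inv * leg12 k H F.inv := by
  have h := congrArg Units.val (congrArg (fun u => u⁻¹) (Units.ext F.cocycle :
    Units.map (leg23 k H).toMonoidHom F.val * Units.map (comulSnd k H).toMonoidHom F.val =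
    Units.map (leg12 k H).toMonoidHom F.val * Units.map (comulFst k H).toMonoidHom F.val))
  simpa [mul_inv_rev] using h

theorem counit_fst_inv : TensorProduct.lid k H
    (TensorProduct.map (Coalgebra.counit (R := k) (A := H)) LinearMap.id F.inv) = 1 := by
  let φ : H ⊗[k] H →ₐ[k] H := (Algebra.TensorProduct.lid k H).toAlgHom.comp
    (Algebra.TensorProduct.map (Bialgebra.counitAlgHom k H) (AlgHom.id k H))
  have h1 : φ F.elt = 1 := F.counit_fst
  have h2 : φ F.inv * φ F.elt = 1 := by rw [← map_mul, Units.inv_mul, map_one]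
  rw [h1, mul_one] at h2
  exact h2

theorem counit_snd_inv : TensorProduct.rid k H
    (TensorProduct.map LinearMap.id (Coalgebra.counit (R := k) (A := H)) F.inv) = 1 := by
  let φ : H ⊗[k] H →ₐ[k] H := (Algebra.TensorProduct.rid k k H).toAlgHom.comp
    (Algebra.TensorProduct.map (AlgHom.id k H) (Bialgebra.counitAlgHom k H))
  have h1 : φ F.elt = 1 := F.counit_snd
  have h2 : φ F.inv * φ F.elt = 1 := by rw [← map_mul, Units.inv_mul, map_one]
  rw [h1, mul_one] at h2
  exact h2

/-- The twisted coproduct `h ↦ F Δ(h) F⁻¹`. -/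
def comulTw : H →ₐ[k] H ⊗[k] H :=
  AlgHom.ofLinearMap
    (LinearMap.mulLeft k F.elt ∘ₗ LinearMap.mulRight k F.inv ∘ₗ Coalgebra.comul)
    (by simp)
    (by
      intro x y
      simp only [LinearMap.comp_apply, LinearMap.mulLeft_apply, LinearMap.mulRight_apply,
        Bialgebra.comul_mul]
      have h : F.inv * F.elt = 1 := Units.inv_mul _
      calc F.elt * (Coalgebra.comul x * Coalgebra.comul y * F.inv)
          = F.elt * Coalgebra.comul x * 1 * Coalgebra.comul y * F.inv := by noncomm_ring
        _ = _ := by rw [← h]; noncomm_ring)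

theorem comulTw_apply (h : H) :
    F.comulTw h = F.elt * (Coalgebra.comul (R := k) h * F.inv) := rfl

theorem comulTw_fst (z : H ⊗[k] H) :
    Algebra.TensorProduct.assoc k k k H H H
      (Algebra.TensorProduct.map F.comulTw (AlgHom.id k H) z) =
      leg12 k H F.elt * (comulFst k H z * leg12 k H F.inv) := by
  induction z with
  | zero => simp
  | add x y hx hy => simp only [map_add, hx, hy, add_mul, mul_add]
  | tmul x y =>
    simp only [Algebra.TensorProduct.map_tmul, comulTw_apply, AlgHom.id_apply, leg12, comulFst,
      AlgHom.comp_apply,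
      Algebra.TensorProduct.includeLeft_apply, Bialgebra.comulAlgHom_apply, ← map_mul,
      Algebra.TensorProduct.tmul_mul_tmul, one_mul, mul_one]
    rfl

theorem comulTw_snd (z : H ⊗[k] H) :
    Algebra.TensorProduct.map (AlgHom.id k H) F.comulTw z =
      leg23 k H F.elt * (comulSnd k H z * leg23 k H F.inv) := by
  induction z with
  | zero => simp
  | add x y hx hy => simp only [map_add, hx, hy, add_mul, mul_add]
  | tmul x y =>
    simp [comulTw_apply, leg23, comulSnd]

theorem comulFst_comul (h : H) :
    comulFst k H (Coalgebra.comul h) = comulSnd k H (Coalgebra.comul h) :=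
  Coalgebra.coassoc_apply h

/-- The twisted bialgebra structure on the algebra `H`: coproduct `h ↦ F Δ(h) F⁻¹`, counit `ε`. -/
@[reducible] def bialgebraTw : Bialgebra k H :=
  Bialgebra.ofAlgHom F.comulTw (Bialgebra.counitAlgHom k H)
    (by
      ext h
      change Algebra.TensorProduct.assoc k k k H H H
        (Algebra.TensorProduct.map F.comulTw (AlgHom.id k H) (F.comulTw h)) =
        Algebra.TensorProduct.map (AlgHom.id k H) F.comulTw (F.comulTw h)
      rw [comulTw_fst, comulTw_snd, comulTw_apply]
      simp only [map_mul, mul_assoc]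
      rw [← F.cocycle_inv, ← mul_assoc, ← F.cocycle, mul_assoc, comulFst_comul])
    (by
      ext h
      let φ : H ⊗[k] H →ₐ[k] k ⊗[k] H :=
        Algebra.TensorProduct.map (Bialgebra.counitAlgHom k H) (AlgHom.id k H)
      have h1 : φ F.elt = 1 := (Algebra.TensorProduct.lid k H).injective
        (F.counit_fst.trans (map_one _).symm)
      have h2 : φ F.inv = 1 := (Algebra.TensorProduct.lid k H).injective
        (F.counit_fst_inv.trans (map_one _).symm)
      have h3 : φ (Coalgebra.comul h) = 1 ⊗ₜ h := Coalgebra.rTensor_counit_comul (R := k) h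
      change φ (F.comulTw h) = 1 ⊗ₜ h
      rw [comulTw_apply, map_mul, map_mul, h1, h2, h3, one_mul, mul_one])
    (by
      ext h
      let φ : H ⊗[k] H →ₐ[k] H ⊗[k] k :=
        Algebra.TensorProduct.map (AlgHom.id k H) (Bialgebra.counitAlgHom k H)
      have h1 : φ F.elt = 1 := (Algebra.TensorProduct.rid k k H).injective
        (F.counit_snd.trans (map_one _).symm)
      have h2 : φ F.inv = 1 := (Algebra.TensorProduct.rid k k H).injective
        (F.counit_snd_inv.trans (map_one _).symm)
      have h3 : φ (Coalgebra.comul h) = h ⊗ₜ 1 := Coalgebra.lTensor_counit_comul (R := k) h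
      change φ (F.comulTw h) = h ⊗ₜ 1
      rw [comulTw_apply, map_mul, map_mul, h1, h2, h3, one_mul, mul_one])

/-- The twisted bialgebra `H^F`: the algebra `H` with the coproduct `h ↦ F Δ(h) F⁻¹`. -/
def TwBialg (_F : DrinfeldTwist k H) : Type _ := H

instance : Ring F.TwBialg := inferInstanceAs (Ring H)

instance : Bialgebra k F.TwBialg := F.bialgebraTw

/-- The identity map `H → H^F`, an isomorphism of algebras. -/
def toTwBialg : H ≃ₐ[k] F.TwBialg := { RingEquiv.refl H with commutes' := fun _ => rfl }

end DrinfeldTwist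

/-! ## Module algebras, smash products and their twists -/

section ModuleAlgebra

variable (k H A : Type*) [Field k] [Ring H] [Algebra k H] [Ring A] [Algebra k A]
  [Module H A] [IsScalarTower k H A]

/-- The action `h ▹ a` as a bilinear map. -/
def act : H →ₗ[k] A →ₗ[k] A := (Algebra.lsmul k k A : H →ₐ[k] Module.End k A).toLinearMap

/-- `(x ⊗ y) ↦ a ↦ b ↦ (x ▹ a) * (y ▹ b)`. -/
def mulAct : H ⊗[k] H →ₗ[k] A →ₗ[k] A →ₗ[k] A :=
  TensorProduct.lift (LinearMap.mk₂ k
    (fun x y => (LinearMap.mul k A).compl₁₂ (act k H A x) (act k H A y))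
    (fun x x' y => by ext; simp) (fun c x y => by ext; simp)
    (fun x y y' => by ext; simp [mul_add]) (fun c x y => by ext; simp))

/-- `(x ⊗ y) ↦ (a ⊗ h ↦ (x ▹ a) ⊗ y * h)`. -/
def actMul : H ⊗[k] H →ₗ[k] A ⊗[k] H →ₗ[k] A ⊗[k] H :=
  TensorProduct.map₂ (act k H A) (LinearMap.mul k H)

end ModuleAlgebra

section ModuleAlgebraClass

variable (k H A : Type*) [Field k] [Ring H] [Bialgebra k H] [Ring A] [Algebra k A]
  [Module H A] [IsScalarTower k H A]

/-- `A` is a left `H`-module algebra: `h ▹ (ab) = (h₍₁₎ ▹ a)(h₍₂₎ ▹ b)` and `h ▹ 1 = ε(h)1`. -/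
class IsModuleAlgebra : Prop where
  smul_mul : ∀ (h : H) (a b : A),
    h • (a * b) = mulAct k H A (Coalgebra.comul (R := k) h) a b
  smul_one : ∀ h : H, h • (1 : A) = algebraMap k A (Coalgebra.counit (R := k) h)

variable {k H A}

@[simp] theorem act_apply (h : H) (a : A) : act k H A h a = h • a := rfl

@[simp] theorem mulAct_tmul (x y : H) (a b : A) :
    mulAct k H A (x ⊗ₜ y) a b = (x • a) * (y • b) := rfl

@[simp] theorem actMul_tmul (x y h : H) (a : A) :
    actMul k H A (x ⊗ₜ y) (a ⊗ₜ h) = (x • a) ⊗ₜ (y * h) := rfl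

theorem smul_algebraMap [IsModuleAlgebra k H A] (h : H) (c : k) :
    h • algebraMap k A c = algebraMap k A (c * Coalgebra.counit (R := k) h) := by
  rw [Algebra.algebraMap_eq_smul_one, smul_comm, IsModuleAlgebra.smul_one (k := k), map_mul,
    Algebra.smul_def]

/-- `(x ⊗ y ⊗ z) ↦ (x ▹ a)(y ▹ b)(z ▹ c)`. -/
def mulAct₃ (a b c : A) : H ⊗[k] (H ⊗[k] H) →ₗ[k] A :=
  LinearMap.mul' k A ∘ₗ TensorProduct.map ((act k H A).flip a)
    (LinearMap.mul' k A ∘ₗ TensorProduct.map ((act k H A).flip b) ((act k H A).flip c))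

@[simp] theorem mulAct₃_tmul (a b c : A) (x y z : H) :
    mulAct₃ (k := k) a b c (x ⊗ₜ (y ⊗ₜ z)) = (x • a) * ((y • b) * (z • c)) := rfl

theorem mulAct₃_tmul' (a b c : A) (x : H) (w : H ⊗[k] H) :
    mulAct₃ (k := k) a b c (x ⊗ₜ w) = (x • a) * mulAct k H A w b c := by
  induction w with
  | zero => simp
  | add u v hu hv => simp [TensorProduct.tmul_add, hu, hv, mul_add]
  | tmul y z => rfl

theorem mulAct₃_assoc_tmul (a b c : A) (z : H) (w : H ⊗[k] H) :
    mulAct₃ (k := k) a b c (TensorProduct.assoc k H H H (w ⊗ₜ z)) =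
      mulAct k H A w a b * (z • c) := by
  induction w with
  | zero => simp
  | add u v hu hv => simp [TensorProduct.add_tmul, hu, hv, add_mul]
  | tmul x y => simp [mul_assoc]

theorem mulAct_mul [IsModuleAlgebra k H A] (y : H) (w : H ⊗[k] H) (b c : A) :
    mulAct k H A (Coalgebra.comul y * w) b c = y • mulAct k H A w b c := by
  induction w with
  | zero => simp
  | add u v hu hv => simp [mul_add, hu, hv]
  | tmul p q =>
    rw [mulAct_tmul, IsModuleAlgebra.smul_mul (k := k)]
    generalize Coalgebra.comul (R := k) y = d
    induction d with
    | zero => simp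
    | add u v hu hv => simp [add_mul, hu, hv]
    | tmul p' q' => simp [mul_smul]

theorem mulAct_mulAct_right [IsModuleAlgebra k H A] (w z : H ⊗[k] H) (a b c : A) :
    mulAct k H A z a (mulAct k H A w b c) =
      mulAct₃ a b c (comulSnd k H z * leg23 k H w) := by
  induction z with
  | zero => simp
  | add u v hu hv => simp [add_mul, hu, hv]
  | tmul x y =>
    have : comulSnd k H (x ⊗ₜ y) * leg23 k H w = x ⊗ₜ (Coalgebra.comul y * w) := by
      simp [comulSnd, leg23]
    rw [this, mulAct₃_tmul', mulAct_mul, mulAct_tmul]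

theorem mulAct_mulAct_left [IsModuleAlgebra k H A] (w z : H ⊗[k] H) (a b c : A) :
    mulAct k H A z (mulAct k H A w a b) c =
      mulAct₃ a b c (comulFst k H z * leg12 k H w) := by
  induction z with
  | zero => simp
  | add u v hu hv => simp [add_mul, hu, hv]
  | tmul x y =>
    have : comulFst k H (x ⊗ₜ y) * leg12 k H w =
        TensorProduct.assoc k H H H ((Coalgebra.comul x * w) ⊗ₜ y) := by
      change Algebra.TensorProduct.assoc k k k H H H (Coalgebra.comul x ⊗ₜ y) *
        Algebra.TensorProduct.assoc k k k H H H (w ⊗ₜ 1) = _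
      rw [← map_mul, Algebra.TensorProduct.tmul_mul_tmul, mul_one]
      rfl
    rw [this, mulAct₃_assoc_tmul, mulAct_mul, mulAct_tmul]

theorem mulAct_one_left [IsModuleAlgebra k H A] (z : H ⊗[k] H) (a : A) :
    mulAct k H A z 1 a = TensorProduct.lid k H
      (TensorProduct.map Coalgebra.counit LinearMap.id z) • a := by
  induction z with
  | zero => simp
  | add u v hu hv => simp [add_smul, hu, hv]
  | tmul x y =>
    simp [IsModuleAlgebra.smul_one (k := k), ← Algebra.smul_def]

theorem mulAct_one_right [IsModuleAlgebra k H A] (z : H ⊗[k] H) (a : A) :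
    mulAct k H A z a 1 = TensorProduct.rid k H
      (TensorProduct.map LinearMap.id Coalgebra.counit z) • a := by
  induction z with
  | zero => simp
  | add u v hu hv => simp [add_smul, hu, hv]
  | tmul x y =>
    simp [IsModuleAlgebra.smul_one (k := k), ← Algebra.smul_def, ← Algebra.commutes]

end ModuleAlgebraClass

/-! ### The twisted module algebra `A_F` -/

namespace DrinfeldTwist

variable {k H : Type*} [Field k] [Ring H] [Bialgebra k H] (F : DrinfeldTwist k H)

/-- The twisted module algebra `A_F`: the vector space `A` with the product
`a ·_F b = (F̄¹ ▹ a)(F̄² ▹ b)` and the same action. -/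
def TwAlg (_F : DrinfeldTwist k H) (A : Type*) : Type _ := A

variable (A : Type*) [Ring A] [Algebra k A] [Module H A] [IsScalarTower k H A]

instance : AddCommGroup (F.TwAlg A) := inferInstanceAs (AddCommGroup A)

instance : Module k (F.TwAlg A) := inferInstanceAs (Module k A)

/-- The identity map `A → A_F`. -/
def toTwAlg : A ≃ₗ[k] F.TwAlg A := LinearEquiv.refl k A

variable [IsModuleAlgebra k H A]

variable {A} in
theorem twMul_assoc (a b c : A) : mulAct k H A F.inv (mulAct k H A F.inv a b) c =
    mulAct k H A F.inv a (mulAct k H A F.inv b c) := by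
  rw [mulAct_mulAct_left, mulAct_mulAct_right, F.cocycle_inv]

variable {A} in
theorem twMul_one_left (a : A) : mulAct k H A F.inv 1 a = a := by
  rw [mulAct_one_left, F.counit_fst_inv, one_smul]

variable {A} in
theorem twMul_one_right (a : A) : mulAct k H A F.inv a 1 = a := by
  rw [mulAct_one_right, F.counit_snd_inv, one_smul]

instance : Ring (F.TwAlg A) :=
  { (inferInstance : AddCommGroup (F.TwAlg A)) with
    mul := fun a b => F.toTwAlg A
      (mulAct k H A F.inv ((F.toTwAlg A).symm a) ((F.toTwAlg A).symm b))
    one := F.toTwAlg A 1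
    left_distrib := fun a b c => map_add (mulAct k H A F.inv a) b c
    right_distrib := fun a b c => LinearMap.map_add₂ (mulAct k H A F.inv) a b c
    zero_mul := fun a => LinearMap.map_zero₂ (mulAct k H A F.inv) a
    mul_zero := fun a => map_zero (mulAct k H A F.inv a)
    mul_assoc := F.twMul_assoc (A := A)
    one_mul := F.twMul_one_left (A := A)
    mul_one := F.twMul_one_right (A := A) }

instance : Algebra k (F.TwAlg A) :=
  Algebra.ofModule (fun c a b => LinearMap.map_smul₂ (mulAct k H A F.inv) c a b)
    (fun c a b => map_smul (mulAct k H A F.inv a) c b)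

instance : Module F.TwBialg (F.TwAlg A) := inferInstanceAs (Module H A)

instance : IsScalarTower k F.TwBialg (F.TwAlg A) := inferInstanceAs (IsScalarTower k H A)

variable {A}

theorem toTwAlg_mul (a b : A) :
    F.toTwAlg A a * F.toTwAlg A b = F.toTwAlg A (mulAct k H A F.inv a b) := rfl

theorem toTwAlg_one : F.toTwAlg A 1 = 1 := rfl

theorem toTwAlg_smul (h : H) (a : A) : F.toTwBialg h • F.toTwAlg A a = F.toTwAlg A (h • a) := rfl

theorem comul_toTwBialg (h : H) : Coalgebra.comul (R := k) (F.toTwBialg h) =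
    TensorProduct.map F.toTwBialg.toLinearMap F.toTwBialg.toLinearMap (F.comulTw h) :=
  (congrFun (congrArg DFunLike.coe
    (TensorProduct.map_id : TensorProduct.map (LinearMap.id : H →ₗ[k] H) LinearMap.id = _))
    (F.comulTw h)).symm

theorem counit_toTwBialg (h : H) :
    Coalgebra.counit (R := k) (F.toTwBialg h) = Coalgebra.counit (R := k) h := rfl

theorem toTwAlg_mulAct (z : H ⊗[k] H) (a b : A) :
    mulAct k F.TwBialg (F.TwAlg A)
      (TensorProduct.map F.toTwBialg.toLinearMap F.toTwBialg.toLinearMap z)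
      (F.toTwAlg A a) (F.toTwAlg A b) =
      F.toTwAlg A (mulAct k H A (F.inv * z) a b) := by
  induction z with
  | zero => simp
  | add u v hu hv => simp only [mul_add, map_add, LinearMap.add_apply, hu, hv]
  | tmul x y =>
    rw [TensorProduct.map_tmul, mulAct_tmul]
    simp only [AlgEquiv.toLinearMap_apply, toTwAlg_smul, toTwAlg_mul]
    congr 1
    generalize F.inv = w
    induction w with
    | zero => simp
    | add u v hu hv => simp [add_mul, hu, hv]
    | tmul p q => simp [mul_smul]

variable (A)

instance : IsModuleAlgebra k F.TwBialg (F.TwAlg A) where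
  smul_mul := fun h a b => by
    obtain ⟨h, rfl⟩ := F.toTwBialg.surjective h
    obtain ⟨a, rfl⟩ := (F.toTwAlg A).surjective a
    obtain ⟨b, rfl⟩ := (F.toTwAlg A).surjective b
    have h2 : F.inv * F.comulTw h = Coalgebra.comul h * F.inv := by
      rw [comulTw_apply, ← mul_assoc, Units.inv_mul, one_mul]
    rw [comul_toTwBialg, toTwAlg_mulAct, h2, mulAct_mul, toTwAlg_mul, toTwAlg_smul]
  smul_one := fun h => by
    obtain ⟨h, rfl⟩ := F.toTwBialg.surjective h
    rw [← toTwAlg_one, toTwAlg_smul, IsModuleAlgebra.smul_one (k := k),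
      Algebra.algebraMap_eq_smul_one, Algebra.algebraMap_eq_smul_one, map_smul]
    rfl

end DrinfeldTwist

/-! ### The smash product algebra -/

section Smash

variable (k A H : Type*) [Field k] [Ring H] [Bialgebra k H] [Ring A] [Algebra k A]

/-- The vector space `A ⊗ H` underlying the smash product algebra `A ♯ H`. -/
def Smash : Type _ := A ⊗[k] H

instance : AddCommGroup (Smash k A H) := inferInstanceAs (AddCommGroup (A ⊗[k] H))

instance : Module k (Smash k A H) := inferInstanceAs (Module k (A ⊗[k] H))

/-- The identification of the vector spaces `A ⊗ H` and `A ♯ H`. -/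
def toSmash : A ⊗[k] H ≃ₗ[k] Smash k A H := LinearEquiv.refl k _

variable [Module H A] [IsScalarTower k H A]

/-- Multiplication in the smash product, on the vector space `A ⊗ H`:
`(a ⊗ h)(b ⊗ l) = a(h₍₁₎ ▹ b) ⊗ h₍₂₎l`. -/
def smashMul : A ⊗[k] H →ₗ[k] A ⊗[k] H →ₗ[k] A ⊗[k] H :=
  TensorProduct.lift (LinearMap.mk₂ k
    (fun a h => (LinearMap.mulLeft k a).rTensor H ∘ₗ actMul k H A (Coalgebra.comul h))
    (fun a a' h => by rw [← LinearMap.add_comp, ← LinearMap.rTensor_add]; congr 2; ext; simp [add_mul])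
    (fun c a h => by rw [← LinearMap.smul_comp, ← LinearMap.rTensor_smul]; congr 2; ext; simp)
    (fun a h h' => by rw [map_add, map_add, LinearMap.comp_add])
    (fun c a h => by rw [map_smul, map_smul, LinearMap.comp_smul]))

variable {k A H}

theorem smashMul_tmul (a : A) (h : H) (y : A ⊗[k] H) : smashMul k A H (a ⊗ₜ h) y =
    (LinearMap.mulLeft k a).rTensor H (actMul k H A (Coalgebra.comul h) y) := rfl

theorem actMul_mul (w z : H ⊗[k] H) (y : A ⊗[k] H) :
    actMul k H A (w * z) y = actMul k H A w (actMul k H A z y) := by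
  induction w with
  | zero => simp
  | add u v hu hv => simp [add_mul, hu, hv]
  | tmul p q =>
    induction z with
    | zero => simp
    | add u v hu hv => simp [mul_add, hu, hv]
    | tmul p' q' =>
      induction y with
      | zero => simp
      | add u v hu hv => simp only [map_add, hu, hv]
      | tmul a h => simp [mul_smul, mul_assoc]

theorem actMul_one (y : A ⊗[k] H) : actMul k H A 1 y = y := by
  induction y with
  | zero => simp
  | add u v hu hv => simp only [map_add, hu, hv]
  | tmul a h => simp [Algebra.TensorProduct.one_def]

/-- `(x ⊗ y ⊗ z) ↦ (x ▹ a)(y ▹ b) ⊗ z l`. -/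
def actMul₃ (a b : A) (l : H) : H ⊗[k] (H ⊗[k] H) →ₗ[k] A ⊗[k] H :=
  TensorProduct.map (LinearMap.mul' k A ∘ₗ
      TensorProduct.map ((act k H A).flip a) ((act k H A).flip b)) (LinearMap.mulRight k l) ∘ₗ
    (TensorProduct.assoc k H H H).symm.toLinearMap

theorem actMul₃_assoc_tmul (a b : A) (l z : H) (w : H ⊗[k] H) :
    actMul₃ (k := k) a b l (TensorProduct.assoc k H H H (w ⊗ₜ z)) =
      mulAct k H A w a b ⊗ₜ (z * l) := by
  simp only [actMul₃, LinearMap.comp_apply, LinearEquiv.coe_coe, LinearEquiv.symm_apply_apply,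
    TensorProduct.map_tmul, LinearMap.mulRight_apply]
  congr 1
  induction w with
  | zero => simp
  | add u v hu hv => simp [hu, hv]
  | tmul x y => rfl

theorem actMul₃_tmul (a b : A) (l x : H) (w : H ⊗[k] H) :
    actMul₃ (k := k) a b l (x ⊗ₜ w) =
      (LinearMap.mulLeft k (x • a)).rTensor H (actMul k H A w (b ⊗ₜ l)) := by
  induction w with
  | zero => simp
  | add u v hu hv => simp only [TensorProduct.tmul_add, map_add, hu, hv, LinearMap.add_apply]
  | tmul y z => simp [actMul₃]

theorem smashMul_mulLeft (a : A) (x y : A ⊗[k] H) :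
    smashMul k A H ((LinearMap.mulLeft k a).rTensor H x) y =
      (LinearMap.mulLeft k a).rTensor H (smashMul k A H x y) := by
  induction x with
  | zero => simp
  | add u v hu hv => simp only [map_add, LinearMap.add_apply, hu, hv]
  | tmul b h =>
    simp only [LinearMap.rTensor_tmul, LinearMap.mulLeft_apply, smashMul_tmul,
      LinearMap.mulLeft_mul, LinearMap.rTensor_comp, LinearMap.comp_apply]

theorem smashMul_one_left (y : A ⊗[k] H) : smashMul k A H (1 ⊗ₜ 1) y = y := by
  rw [smashMul_tmul, Bialgebra.comul_one, actMul_one]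
  simp

variable [IsModuleAlgebra k H A]

theorem actMul_comul_mul (h l : H) (b c : A) :
    actMul k H A (Coalgebra.comul h) ((b * c) ⊗ₜ l) =
      smashMul k A H (actMul k H A (Coalgebra.comul h) (b ⊗ₜ 1)) (c ⊗ₜ l) := by
  have h1 : ∀ z : H ⊗[k] H, actMul k H A z ((b * c) ⊗ₜ l) =
      actMul₃ b c l (comulFst k H z) := by
    intro z
    induction z with
    | zero => simp
    | add u v hu hv => simp only [map_add, LinearMap.add_apply, hu, hv]
    | tmul x y =>
      have : comulFst k H (x ⊗ₜ y) = TensorProduct.assoc k H H H (Coalgebra.comul x ⊗ₜ y) := rfl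
      rw [this, actMul₃_assoc_tmul, actMul_tmul, IsModuleAlgebra.smul_mul (k := k)]
  have h2 : ∀ z : H ⊗[k] H, smashMul k A H (actMul k H A z (b ⊗ₜ 1)) (c ⊗ₜ l) =
      actMul₃ b c l (comulSnd k H z) := by
    intro z
    induction z with
    | zero => simp
    | add u v hu hv => simp only [map_add, LinearMap.add_apply, hu, hv]
    | tmul x y =>
      have : comulSnd k H (x ⊗ₜ y) = x ⊗ₜ Coalgebra.comul y := rfl
      rw [this, actMul₃_tmul, actMul_tmul, mul_one, smashMul_tmul]
  rw [h1, h2, DrinfeldTwist.comulFst_comul]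

theorem smashMul_actMul (h : H) (x y : A ⊗[k] H) :
    smashMul k A H (actMul k H A (Coalgebra.comul h) x) y =
      actMul k H A (Coalgebra.comul h) (smashMul k A H x y) := by
  induction x with
  | zero => simp
  | add u v hu hv => simp only [map_add, LinearMap.add_apply, hu, hv]
  | tmul b l =>
    have h1 : ∀ z : H ⊗[k] H, smashMul k A H (actMul k H A z (b ⊗ₜ l)) y =
        smashMul k A H (actMul k H A z (b ⊗ₜ 1)) (actMul k H A (Coalgebra.comul l) y) := by
      intro z
      induction z with
      | zero => simp
      | add u v hu hv => simp only [map_add, LinearMap.add_apply, hu, hv]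
      | tmul p q =>
        simp only [actMul_tmul, smashMul_tmul, mul_one, Bialgebra.comul_mul, actMul_mul]
    rw [h1, smashMul_tmul]
    generalize actMul k H A (Coalgebra.comul l) y = w
    induction w with
    | zero => simp
    | add u v hu hv => simp only [map_add, hu, hv]
    | tmul c m => rw [← actMul_comul_mul]; simp

theorem smashMul_assoc (x y z : A ⊗[k] H) :
    smashMul k A H (smashMul k A H x y) z = smashMul k A H x (smashMul k A H y z) := by
  induction x with
  | zero => simp
  | add u v hu hv => simp only [map_add, LinearMap.add_apply, hu, hv]
  | tmul a h => rw [smashMul_tmul, smashMul_mulLeft, smashMul_actMul, smashMul_tmul]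

theorem smashMul_one_right (y : A ⊗[k] H) : smashMul k A H y (1 ⊗ₜ 1) = y := by
  induction y with
  | zero => simp
  | add u v hu hv => simp only [map_add, LinearMap.add_apply, hu, hv]
  | tmul a h =>
    have h1 : ∀ z : H ⊗[k] H, actMul k H A z (1 ⊗ₜ 1) = 1 ⊗ₜ TensorProduct.lid k H
        (TensorProduct.map Coalgebra.counit LinearMap.id z) := by
      intro z
      induction z with
      | zero => simp
      | add u v hu hv => simp only [map_add, LinearMap.add_apply, TensorProduct.tmul_add, hu, hv]
      | tmul p q =>
        simp [IsModuleAlgebra.smul_one (k := k), Algebra.algebraMap_eq_smul_one,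
          TensorProduct.smul_tmul]
    have h2 : TensorProduct.map Coalgebra.counit LinearMap.id (Coalgebra.comul (R := k) h) =
        1 ⊗ₜ[k] h := Coalgebra.rTensor_counit_comul h
    rw [smashMul_tmul, h1, h2]
    simp

variable (k A H)

/-- The smash product algebra `A ♯ H`. -/
instance : Ring (Smash k A H) :=
  { (inferInstance : AddCommGroup (Smash k A H)) with
    mul := fun x y => toSmash k A H
      (smashMul k A H ((toSmash k A H).symm x) ((toSmash k A H).symm y))
    one := toSmash k A H (1 ⊗ₜ 1)
    left_distrib := fun x y z => map_add (smashMul k A H x) y z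
    right_distrib := fun x y z => LinearMap.map_add₂ (smashMul k A H) x y z
    zero_mul := fun x => LinearMap.map_zero₂ (smashMul k A H) x
    mul_zero := fun x => map_zero (smashMul k A H x)
    mul_assoc := smashMul_assoc (k := k) (A := A) (H := H)
    one_mul := smashMul_one_left (k := k) (A := A) (H := H)
    mul_one := smashMul_one_right (k := k) (A := A) (H := H) }

instance : Algebra k (Smash k A H) :=
  Algebra.ofModule (fun c x y => LinearMap.map_smul₂ (smashMul k A H) c x y)
    (fun c x y => map_smul (smashMul k A H x) c y)

end Smash

/-! ## Braided commutative Yetter–Drinfeld module algebras -/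

section YetterDrinfeld

variable (k H A : Type*) [Field k] [Ring H] [Bialgebra k H] [Ring A] [Algebra k A]
  [Module H A] [IsScalarTower k H A]

/-- `(x ⊗ y) ↦ (y ▹ a)₍₀₎ ⊗ (y ▹ a)₍₁₎ x`, for a linear map `ρ : a ↦ a₍₀₎ ⊗ a₍₁₎`. -/
def coactFlip (ρ : A →ₗ[k] A ⊗[k] H) (a : A) : H ⊗[k] H →ₗ[k] A ⊗[k] H :=
  (LinearMap.mul' k H).lTensor A ∘ₗ (TensorProduct.assoc k A H H).toLinearMap ∘ₗ
    TensorProduct.map (ρ ∘ₗ (act k H A).flip a) LinearMap.id ∘ₗ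
    (TensorProduct.comm k H H).toLinearMap

/-- `ρ` is a right `H`-coaction making the left `H`-module `A` a left-right Yetter–Drinfeld
`H`-module. -/
structure IsYetterDrinfeld (ρ : A →ₗ[k] A ⊗[k] H) : Prop where
  coassoc : ∀ a : A, TensorProduct.assoc k A H H (ρ.rTensor H (ρ a)) =
    (Coalgebra.comul (R := k) (A := H)).lTensor A (ρ a)
  counit : ∀ a : A, (Coalgebra.counit (R := k) (A := H)).lTensor A (ρ a) = a ⊗ₜ 1
  /-- `(h₍₁₎ ▹ a₍₀₎) ⊗ h₍₂₎ a₍₁₎ = (h₍₂₎ ▹ a)₍₀₎ ⊗ (h₍₂₎ ▹ a)₍₁₎ h₍₁₎` -/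
  compat : ∀ (h : H) (a : A),
    actMul k H A (Coalgebra.comul (R := k) h) (ρ a) =
      coactFlip k H A ρ a (Coalgebra.comul (R := k) h)

variable [IsModuleAlgebra k H A]

/-- `ρ` makes the left `H`-module algebra `A` a braided commutative Yetter–Drinfeld
`H`-module algebra. -/
structure IsBraidedCommYDAlgebra (ρ : A →ₗ[k] A ⊗[k] H) : Prop extends
    IsYetterDrinfeld k H A ρ where
  /-- `A` is an `Hᵒᵖ`-comodule algebra: `ρ(ab) = a₍₀₎b₍₀₎ ⊗ b₍₁₎a₍₁₎` and `ρ(1) = 1 ⊗ 1`. -/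
  coact_mul : ∀ a b : A, ρ (a * b) =
    TensorProduct.map₂ (LinearMap.mul k A) (LinearMap.mul k H).flip (ρ a) (ρ b)
  coact_one : ρ 1 = 1 ⊗ₜ 1
  /-- `b₍₀₎ (b₍₁₎ ▹ a) = a b` -/
  braided_comm : ∀ a b : A,
    LinearMap.mul' k A (((act k H A).flip a).lTensor A (ρ b)) = a * b

end YetterDrinfeld

namespace DrinfeldTwist

variable {k H : Type*} [Field k] [Ring H] [Bialgebra k H] (F : DrinfeldTwist k H)
  {A : Type*} [Ring A] [Algebra k A] [Module H A] [IsScalarTower k H A] [IsModuleAlgebra k H A]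

/-- The twisted coaction
`ρ^F(a) = F¹ ▹ (F̄² ▹ a)₍₀₎ ⊗ F² (F̄² ▹ a)₍₁₎ F̄¹`, as a map `A_F → A_F ⊗ H^F`. -/
def twCoact (ρ : A →ₗ[k] A ⊗[k] H) : F.TwAlg A →ₗ[k] F.TwAlg A ⊗[k] F.TwBialg where
  toFun a := TensorProduct.map (F.toTwAlg A).toLinearMap F.toTwBialg.toLinearMap
    (actMul k H A F.elt (coactFlip k H A ρ ((F.toTwAlg A).symm a) F.inv))
  map_add' a b := by
    simp only [coactFlip, map_add, LinearMap.comp_add, TensorProduct.map_add_left,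
      LinearMap.comp_apply, LinearMap.add_apply]
  map_smul' c a := by
    simp only [coactFlip, map_smul, LinearMap.comp_smul, TensorProduct.map_smul_left,
      LinearMap.comp_apply, LinearMap.smul_apply, RingHom.id_apply]

variable (A)

/-- `ζ : A_F ♯ H^F → A ♯ H`, `a ♯ h ↦ (F̄¹ ▹ a) ♯ F̄² h`. -/
def zeta : Smash k (F.TwAlg A) F.TwBialg →ₗ[k] Smash k A H :=
  (toSmash k A H).toLinearMap ∘ₗ actMul k H A F.inv ∘ₗ
    TensorProduct.map (F.toTwAlg A).symm.toLinearMap F.toTwBialg.symm.toLinearMap ∘ₗ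
    (toSmash k (F.TwAlg A) F.TwBialg).symm.toLinearMap

end DrinfeldTwist

/-! ## Left bialgebroids -/

section Balanced

variable {k A E : Type*} [Field k] [AddCommGroup A] [Module k A] [Ring E] [Algebra k E]

/-- The subspace of `E ⊗ E` spanned by all `t(a)x ⊗ y - x ⊗ s(a)y`. -/
def balRel (s t : A →ₗ[k] E) : Submodule k (E ⊗[k] E) :=
  Submodule.span k {z | ∃ (a : A) (x y : E), z = (t a * x) ⊗ₜ[k] y - x ⊗ₜ[k] (s a * y)}

/-- `E ⊗_A E`, for the `A`-bimodule structure `a.x.a' = s(a)t(a')x` on `E`. -/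
abbrev BalTensor (s t : A →ₗ[k] E) : Type _ := (E ⊗[k] E) ⧸ balRel s t

/-- The subspace of `E ⊗ (E ⊗ E)` spanned by all `t(a)x ⊗ y ⊗ z - x ⊗ s(a)y ⊗ z` and
`x ⊗ t(a)y ⊗ z - x ⊗ y ⊗ s(a)z`. -/
def balRel₃ (s t : A →ₗ[k] E) : Submodule k (E ⊗[k] (E ⊗[k] E)) :=
  Submodule.span k
    ({w | ∃ (a : A) (x y z : E),
        w = (t a * x) ⊗ₜ[k] (y ⊗ₜ[k] z) - x ⊗ₜ[k] ((s a * y) ⊗ₜ[k] z)} ∪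
      {w | ∃ (a : A) (x y z : E),
        w = x ⊗ₜ[k] ((t a * y) ⊗ₜ[k] z) - x ⊗ₜ[k] (y ⊗ₜ[k] (s a * z))})

/-- `E ⊗_A E ⊗_A E`. -/
abbrev BalTensor₃ (s t : A →ₗ[k] E) : Type _ := (E ⊗[k] (E ⊗[k] E)) ⧸ balRel₃ s t

variable (s t : A →ₗ[k] E)

theorem balRel_mul_right {z : E ⊗[k] E} (hz : z ∈ balRel s t) (w : E ⊗[k] E) :
    z * w ∈ balRel s t := by
  induction w with
  | zero => simp
  | add u v hu hv => rw [mul_add]; exact add_mem hu hv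
  | tmul p q =>
    have : balRel s t ≤ (balRel s t).comap (LinearMap.mulRight k (p ⊗ₜ[k] q)) := by
      refine Submodule.span_le.2 ?_
      rintro _ ⟨a, x, y, rfl⟩
      exact Submodule.subset_span ⟨a, x * p, y * q, by simp [sub_mul, mul_assoc]⟩
    exact this hz

/-- `x ⊗_A y ↦ x ⊗_A y ⊗_A z`. -/
def appendRight : E →ₗ[k] BalTensor s t →ₗ[k] BalTensor₃ s t where
  toFun z := (balRel s t).mapQ (balRel₃ s t)
    ((TensorProduct.assoc k E E E).toLinearMap ∘ₗ (TensorProduct.mk k (E ⊗[k] E) E).flip z) (by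
      refine Submodule.span_le.2 ?_
      rintro _ ⟨a, x, y, rfl⟩
      exact Submodule.subset_span (Or.inl ⟨a, x, y, z, by simp⟩))
  map_add' z z' := by
    ext x y
    exact congrArg (balRel₃ s t).mkQ (by simp [TensorProduct.tmul_add] :
      TensorProduct.assoc k E E E ((x ⊗ₜ y) ⊗ₜ (z + z')) =
        TensorProduct.assoc k E E E ((x ⊗ₜ y) ⊗ₜ z) + TensorProduct.assoc k E E E ((x ⊗ₜ y) ⊗ₜ z'))
  map_smul' c z := by
    ext x y
    exact congrArg (balRel₃ s t).mkQ (by simp :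
      TensorProduct.assoc k E E E ((x ⊗ₜ y) ⊗ₜ (c • z)) =
        c • TensorProduct.assoc k E E E ((x ⊗ₜ y) ⊗ₜ z))

/-- `y ⊗_A z ↦ x ⊗_A y ⊗_A z`. -/
def appendLeft : E →ₗ[k] BalTensor s t →ₗ[k] BalTensor₃ s t where
  toFun x := (balRel s t).mapQ (balRel₃ s t) (TensorProduct.mk k E (E ⊗[k] E) x) (by
      refine Submodule.span_le.2 ?_
      rintro _ ⟨a, y, z, rfl⟩
      exact Submodule.subset_span (Or.inr ⟨a, x, y, z, by simp [TensorProduct.tmul_sub]⟩))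
  map_add' x x' := by
    ext y z
    exact congrArg (balRel₃ s t).mkQ (TensorProduct.add_tmul x x' (y ⊗ₜ[k] z))
  map_smul' c x := by
    ext y z
    exact congrArg (balRel₃ s t).mkQ (TensorProduct.smul_tmul' c x (y ⊗ₜ[k] z)).symm

end Balanced

/-- The structure maps of a left bialgebroid over a base algebra with underlying vector space `A`
(whose product and unit are part of the data) and with total algebra `E`: source, target,
comultiplication `E → E ⊗_A E` and counit `E → A`. The axioms are in
`LeftBialgebroidData.IsLeftBialgebroid`. -/
structure LeftBialgebroidData (k A E : Type*) [Field k] [AddCommGroup A] [Module k A]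
    [Ring E] [Algebra k E] where
  /-- product of the base algebra -/
  mul : A →ₗ[k] A →ₗ[k] A
  /-- unit of the base algebra -/
  one : A
  /-- source map -/
  source : A →ₗ[k] E
  /-- target map -/
  target : A →ₗ[k] E
  /-- comultiplication -/
  comul : E →ₗ[k] BalTensor source target
  /-- counit -/
  counit : E →ₗ[k] A

namespace LeftBialgebroidData

variable {k A E : Type*} [Field k] [AddCommGroup A] [Module k A] [Ring E] [Algebra k E]
  (B : LeftBialgebroidData k A E)

/-- The class in `E ⊗_A E` of an element of `E ⊗ E`. -/
abbrev cls : E ⊗[k] E →ₗ[k] BalTensor B.source B.target := (balRel B.source B.target).mkQ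

/-- The class in `E ⊗_A E ⊗_A E` of an element of `E ⊗ (E ⊗ E)`. -/
abbrev cls₃ : E ⊗[k] (E ⊗[k] E) →ₗ[k] BalTensor₃ B.source B.target :=
  (balRel₃ B.source B.target).mkQ

/-- `x ⊗ y ↦ Δ(x) ⊗_A y`, as a map from `E ⊗ E` to `E ⊗_A E ⊗_A E`. -/
def comulFst : E ⊗[k] E →ₗ[k] BalTensor₃ B.source B.target :=
  TensorProduct.lift ((appendRight B.source B.target).flip ∘ₗ B.comul)

/-- `x ⊗ y ↦ x ⊗_A Δ(y)`, as a map from `E ⊗ E` to `E ⊗_A E ⊗_A E`. -/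
def comulSnd : E ⊗[k] E →ₗ[k] BalTensor₃ B.source B.target :=
  TensorProduct.lift ((appendLeft B.source B.target).compl₂ B.comul)

/-- `x ⊗ y ↦ s(ε(x)) y`. -/
def counitFst : E ⊗[k] E →ₗ[k] E :=
  LinearMap.mul' k E ∘ₗ (B.source ∘ₗ B.counit).rTensor E

/-- `x ⊗ y ↦ t(ε(y)) x`. -/
def counitSnd : E ⊗[k] E →ₗ[k] E :=
  LinearMap.mul' k E ∘ₗ (B.target ∘ₗ B.counit).rTensor E ∘ₗ (TensorProduct.comm k E E).toLinearMap

/-- The axioms of a left bialgebroid. An element of `E ⊗_A E` is described by its representatives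
in `E ⊗ E`; every condition below holds for all representatives as soon as it holds for one. -/
structure IsLeftBialgebroid : Prop where
  /-- the base is an associative unital algebra -/
  mul_assoc : ∀ a b c : A, B.mul (B.mul a b) c = B.mul a (B.mul b c)
  one_mul : ∀ a : A, B.mul B.one a = a
  mul_one : ∀ a : A, B.mul a B.one = a
  /-- the source is an algebra map -/
  source_mul : ∀ a b : A, B.source (B.mul a b) = B.source a * B.source b
  source_one : B.source B.one = 1
  /-- the target is an algebra map from the opposite of the base -/
  target_mul : ∀ a b : A, B.target (B.mul a b) = B.target b * B.target a
  target_one : B.target B.one = 1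
  /-- source and target have commuting images -/
  source_target_comm : ∀ a b : A, B.source a * B.target b = B.target b * B.source a
  /-- `Δ` is a map of bimodules: `Δ(s(a)t(b)x) = s(a)x₍₁₎ ⊗ t(b)x₍₂₎` -/
  comul_bimodule : ∀ (a b : A) (x : E) (z : E ⊗[k] E), B.comul x = B.cls z →
    B.comul (B.source a * B.target b * x) = B.cls ((B.source a ⊗ₜ B.target b) * z)
  /-- `ε` is a map of bimodules: `ε(s(a)t(b)x) = a ε(x) b` -/
  counit_bimodule : ∀ (a b : A) (x : E),
    B.counit (B.source a * B.target b * x) = B.mul (B.mul a (B.counit x)) b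
  /-- `(Δ ⊗_A id)Δ = (id ⊗_A Δ)Δ` -/
  coassoc : ∀ (x : E) (z : E ⊗[k] E), B.comul x = B.cls z → B.comulFst z = B.comulSnd z
  /-- `s(ε(x₍₁₎))x₍₂₎ = x = t(ε(x₍₂₎))x₍₁₎` -/
  counit_comul_fst : ∀ (x : E) (z : E ⊗[k] E), B.comul x = B.cls z → B.counitFst z = x
  counit_comul_snd : ∀ (x : E) (z : E ⊗[k] E), B.comul x = B.cls z → B.counitSnd z = x
  /-- `x₍₁₎t(a) ⊗ x₍₂₎ = x₍₁₎ ⊗ x₍₂₎s(a)` -/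
  takeuchi : ∀ (a : A) (x : E) (z : E ⊗[k] E), B.comul x = B.cls z →
    B.cls (z * (B.target a ⊗ₜ 1)) = B.cls (z * (1 ⊗ₜ B.source a))
  comul_one : B.comul 1 = B.cls 1
  /-- `Δ(xy) = x₍₁₎y₍₁₎ ⊗ x₍₂₎y₍₂₎` -/
  comul_mul : ∀ (x y : E) (z w : E ⊗[k] E), B.comul x = B.cls z → B.comul y = B.cls w →
    B.comul (x * y) = B.cls (z * w)
  counit_one : B.counit 1 = B.one
  /-- `ε(xy) = ε(x s(ε(y))) = ε(x t(ε(y)))` -/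
  counit_mul_source : ∀ x y : E, B.counit (x * y) = B.counit (x * B.source (B.counit y))
  counit_mul_target : ∀ x y : E, B.counit (x * y) = B.counit (x * B.target (B.counit y))

/-- Isomorphisms of left bialgebroids: an isomorphism `φ₀` of the base algebras and an isomorphism
`φ` of the total algebras that commute with source, target, comultiplication and counit. -/
structure IsIso {A' E' : Type*} [AddCommGroup A'] [Module k A'] [Ring E'] [Algebra k E']
    (B : LeftBialgebroidData k A E) (B' : LeftBialgebroidData k A' E')
    (φ₀ : A ≃ₗ[k] A') (φ : E ≃ₐ[k] E') : Prop where
  map_base_mul : ∀ a b : A, φ₀ (B.mul a b) = B'.mul (φ₀ a) (φ₀ b)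
  map_base_one : φ₀ B.one = B'.one
  map_source : ∀ a : A, φ (B.source a) = B'.source (φ₀ a)
  map_target : ∀ a : A, φ (B.target a) = B'.target (φ₀ a)
  /-- `Δ'(φ(x)) = φ(x₍₁₎) ⊗_{A'} φ(x₍₂₎)` -/
  map_comul : ∀ (x : E) (z : E ⊗[k] E), B.comul x = B.cls z →
    B'.comul (φ x) = B'.cls (TensorProduct.map φ.toLinearMap φ.toLinearMap z)
  map_counit : ∀ x : E, B'.counit (φ x) = φ₀ (B.counit x)

/-! ### Twisting by a Drinfeld–Xu cocycle -/

/-- `x ▸ a = ε(x s(a))`. -/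
def bact : E →ₗ[k] A →ₗ[k] A :=
  ((LinearMap.mul k E).compl₂ B.source).compr₂ B.counit

/-- `a * b = (𝒢¹ ▸ a)(𝒢² ▸ b)`. -/
def xuMul (G : E ⊗[k] E) : A →ₗ[k] A →ₗ[k] A :=
  LinearMap.mk₂ k
    (fun a b => TensorProduct.lift B.mul (TensorProduct.map (B.bact.flip a) (B.bact.flip b) G))
    (fun a a' b => by simp [TensorProduct.map_add_left])
    (fun c a b => by simp [TensorProduct.map_smul_left])
    (fun a b b' => by simp [TensorProduct.map_add_right])
    (fun c a b => by simp [TensorProduct.map_smul_right])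

/-- `s^𝒢(a) = s(𝒢¹ ▸ a) 𝒢²`. -/
def xuSource (G : E ⊗[k] E) : A →ₗ[k] E where
  toFun a := LinearMap.mul' k E ((B.source ∘ₗ B.bact.flip a).rTensor E G)
  map_add' a b := by simp [LinearMap.comp_add, LinearMap.rTensor_add]
  map_smul' c a := by simp [LinearMap.comp_smul, LinearMap.rTensor_smul]

/-- `t^𝒢(a) = t(𝒢² ▸ a) 𝒢¹`. -/
def xuTarget (G : E ⊗[k] E) : A →ₗ[k] E where
  toFun a := LinearMap.mul' k E
    ((B.target ∘ₗ B.bact.flip a).rTensor E (TensorProduct.comm k E E G))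
  map_add' a b := by simp [LinearMap.comp_add, LinearMap.rTensor_add]
  map_smul' c a := by simp [LinearMap.comp_smul, LinearMap.rTensor_smul]

/-- The class `𝒢 ∈ E ⊗_A E` of `G` is an invertible (Drinfeld–Xu) bialgebroid 2-cocycle, with
inverse the class of `G'` in `E^𝒢 ⊗_{A^𝒢} E^𝒢`. -/
structure IsDrinfeldXuCocycle (G G' : E ⊗[k] E) : Prop where
  /-- `((Δ ⊗_A id)𝒢)(𝒢 ⊗ 1) = ((id ⊗_A Δ)𝒢)(1 ⊗ 𝒢)` in `E ⊗_A E ⊗_A E` -/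
  cocycle : ∀ u v : E ⊗[k] (E ⊗[k] E), B.comulFst G = B.cls₃ u → B.comulSnd G = B.cls₃ v →
    B.cls₃ (u * TensorProduct.assoc k E E E (G ⊗ₜ 1)) = B.cls₃ (v * (1 ⊗ₜ G))
  /-- `(ε ⊗_A id)𝒢 = 1` -/
  counit_fst : B.counitFst G = 1
  /-- `(id ⊗_A ε)𝒢 = 1` -/
  counit_snd : B.counitSnd G = 1
  /-- left multiplication by `𝒢⁻¹` is a well defined map `E ⊗_A E → E^𝒢 ⊗_{A^𝒢} E^𝒢` -/
  inv_mul_mem : ∀ z ∈ balRel B.source B.target,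
    G' * z ∈ balRel (B.xuSource G) (B.xuTarget G)
  /-- left multiplication by `𝒢` is a well defined map `E^𝒢 ⊗_{A^𝒢} E^𝒢 → E ⊗_A E` -/
  mul_mem : ∀ z ∈ balRel (B.xuSource G) (B.xuTarget G),
    G * z ∈ balRel B.source B.target
  /-- `𝒢⁻¹𝒢 = 1 ⊗_{A^𝒢} 1` -/
  inv_mul : (balRel (B.xuSource G) (B.xuTarget G)).mkQ (G' * G) =
    (balRel (B.xuSource G) (B.xuTarget G)).mkQ 1
  /-- `𝒢𝒢⁻¹ = 1 ⊗_A 1` -/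
  mul_inv : B.cls (G * G') = B.cls 1

/-- The twist of a left bialgebroid by a Drinfeld–Xu cocycle `𝒢`: the total algebra and the counit
are unchanged, the base algebra is `A^𝒢`, source and target are `s^𝒢` and `t^𝒢`, and
`Δ^𝒢(x) = 𝒢⁻¹ Δ(x) 𝒢`. -/
def xuTwist (G G' : E ⊗[k] E) (hG : B.IsDrinfeldXuCocycle G G') : LeftBialgebroidData k A E where
  mul := B.xuMul G
  one := B.one
  source := B.xuSource G
  target := B.xuTarget G
  comul := (balRel B.source B.target).mapQ (balRel (B.xuSource G) (B.xuTarget G))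
    (LinearMap.mulLeft k G' ∘ₗ LinearMap.mulRight k G)
    (fun _ hz => hG.inv_mul_mem _ (balRel_mul_right _ _ hz G)) ∘ₗ B.comul
  counit := B.counit

end LeftBialgebroidData

/-! ### The scalar extension bialgebroid -/

section ScalarExtension

variable (k A H : Type*) [Field k] [Ring H] [Bialgebra k H] [Ring A] [Algebra k A]

/-- `h ↦ 1 ♯ h`. -/
def inclSmash : H →ₗ[k] Smash k A H :=
  (toSmash k A H).toLinearMap ∘ₗ TensorProduct.mk k A H 1

variable [Module H A] [IsScalarTower k H A] [IsModuleAlgebra k H A]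

/-- The scalar extension `A`-bialgebroid `A ♯ H`: `s(a) = a ♯ 1`, `t(a) = a₍₀₎ ♯ a₍₁₎`,
`Δ(a ♯ h) = (a ♯ h₍₁₎) ⊗_A (1 ♯ h₍₂₎)`, `ε(a ♯ h) = a ε(h)`. -/
def scalarExtension (ρ : A →ₗ[k] A ⊗[k] H) : LeftBialgebroidData k A (Smash k A H) where
  mul := LinearMap.mul k A
  one := 1
  source := (toSmash k A H).toLinearMap ∘ₗ (TensorProduct.mk k A H).flip 1
  target := (toSmash k A H).toLinearMap ∘ₗ ρ
  comul := Submodule.mkQ _ ∘ₗ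
    TensorProduct.map (toSmash k A H).toLinearMap (inclSmash k A H) ∘ₗ
    (TensorProduct.assoc k A H H).symm.toLinearMap ∘ₗ
    (Coalgebra.comul (R := k) (A := H)).lTensor A ∘ₗ (toSmash k A H).symm.toLinearMap
  counit := (TensorProduct.rid k A).toLinearMap ∘ₗ
    (Coalgebra.counit (R := k) (A := H)).lTensor A ∘ₗ (toSmash k A H).symm.toLinearMap

variable {k H} in
/-- A representative of `𝒢 = (1 ♯ F̄¹) ⊗_A (1 ♯ F̄²)`. -/
def DrinfeldTwist.cocycleRep (F : DrinfeldTwist k H) : Smash k A H ⊗[k] Smash k A H :=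
  TensorProduct.map (inclSmash k A H) (inclSmash k A H) F.inv

variable {k H} in
/-- A representative of `𝒢⁻¹ = (1 ♯ F¹) ⊗_{A^𝒢} (1 ♯ F²)`. -/
def DrinfeldTwist.cocycleInvRep (F : DrinfeldTwist k H) : Smash k A H ⊗[k] Smash k A H :=
  TensorProduct.map (inclSmash k A H) (inclSmash k A H) F.elt

end ScalarExtension

end
end ScalarExt

open ScalarExt

namespace ScalarExt

noncomputable section

/-! ## The smash product: generators and relations -/

section SmashRelations

variable {k A H : Type*} [Field k] [Ring H] [Bialgebra k H] [Ring A] [Algebra k A]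
  [Module H A] [IsScalarTower k H A] [IsModuleAlgebra k H A]

/-! Everything is computed inside `A ♯ H`, which is spanned by the products s(a)h. The
Yetter–Drinfeld structure becomes four relations there: h s(a) = s(h₍₁₎ ▹ a) h₍₂₎ from the smash
product; h t(a) = t(h₍₂₎ ▹ a) h₍₁₎ from the compatibility condition (`compat_iff`); s(a)t(b) =
t(b)s(a) from coassociativity and braided commutativity (`targetMap_mul_baseHom`); t(ab) = t(b)t(a)
from the comodule algebra axiom (`coact_mul_iff`). The comultiplication lifts to a map into the
unbalanced tensor square (`comulRep`), and this lift is already multiplicative (`comulRep_mul`).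
Most identities can thus be proved before passing to the quotient, where t(a)x ⊗ y is identified
with x ⊗ s(a)y.

Put s^𝒢(a) = s(F̄¹ ▹ a)F̄² and t^𝒢(a) = t(F̄² ▹ a)F̄¹. Since Δ(h)F⁻¹ = F⁻¹ · FΔ(h)F⁻¹, these obey
with the twisted coproduct the relations that s and t obey with Δ. The cocycle identity for F⁻¹
makes s^𝒢 multiplicative and t^𝒢 antimultiplicative for the product of A_F. The map ζ fixes H and
sends the source of A_F ♯ H^F to s^𝒢, hence is multiplicative; it is bijective because F is
invertible. It sends the target to t^𝒢, because it cancels the outer factor F of ρ^F.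

The axioms of A_F are rephrased as identities in A_F ♯ H^F and verified after applying the injective
maps ζ or ζ ⊗ ζ. The comultiplications match through (ζ ⊗ ζ)Δ(x) = F Δ(ζ(x)) F⁻¹
(`zetaEquiv₂_comulRep`), which comes from the mixed cocycle identity
`comulFst_elt_mul_comulSnd_inv`. The axioms of the twist are not checked by hand: once ζ respects
all structure maps, they are inherited from the scalar extension A_F ♯ H^F
(`LeftBialgebroidData.IsIso.isLeftBialgebroid`). -/

theorem toSmash_mul (x y : A ⊗[k] H) :
    toSmash k A H x * toSmash k A H y = toSmash k A H (smashMul k A H x y) := rfl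

theorem toSmash_one : toSmash k A H (1 ⊗ₜ 1) = 1 := rfl

theorem toSmash_mul_tmul_one (a : A) (x : A ⊗[k] H) :
    toSmash k A H (a ⊗ₜ 1) * toSmash k A H x =
      toSmash k A H ((LinearMap.mulLeft k a).rTensor H x) := by
  rw [toSmash_mul, smashMul_tmul, Bialgebra.comul_one, actMul_one]

theorem toSmash_one_tmul_mul (h : H) (x : A ⊗[k] H) :
    toSmash k A H (1 ⊗ₜ h) * toSmash k A H x =
      toSmash k A H (actMul k H A (Coalgebra.comul h) x) := by
  rw [toSmash_mul, smashMul_tmul, LinearMap.mulLeft_one, LinearMap.rTensor_id,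
    LinearMap.id_apply]

theorem actMul_tmul_one_mul (z : H ⊗[k] H) (l : H) :
    actMul k H A z (1 ⊗ₜ l) = 1 ⊗ₜ (TensorProduct.lid k H
      (TensorProduct.map Coalgebra.counit LinearMap.id z) * l) := by
  induction z with
  | zero => simp
  | add u v hu hv =>
    simp only [map_add, LinearMap.add_apply, add_mul, TensorProduct.tmul_add, hu, hv]
  | tmul p q =>
    simp [IsModuleAlgebra.smul_one (k := k), Algebra.algebraMap_eq_smul_one,
      TensorProduct.smul_tmul]

variable (k A H) in
/-- `a ↦ a ♯ 1`, as an algebra map. -/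
def baseHom : A →ₐ[k] Smash k A H :=
  AlgHom.ofLinearMap ((toSmash k A H).toLinearMap ∘ₗ (TensorProduct.mk k A H).flip 1) rfl
    (fun a b => ((toSmash_mul_tmul_one a (b ⊗ₜ (1 : H))).trans (by simp)).symm)

variable (k A H) in
/-- `h ↦ 1 ♯ h`, as an algebra map. -/
def inclHom : H →ₐ[k] Smash k A H :=
  AlgHom.ofLinearMap (inclSmash k A H) rfl (fun h l => by
    refine Eq.trans ?_ (toSmash_one_tmul_mul h ((1 : A) ⊗ₜ l)).symm
    have h2 : TensorProduct.map Coalgebra.counit LinearMap.id (Coalgebra.comul (R := k) h) =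
        1 ⊗ₜ[k] h := Coalgebra.rTensor_counit_comul h
    rw [actMul_tmul_one_mul, h2]
    simp [inclSmash])

theorem baseHom_mul_inclHom (a : A) (h : H) :
    baseHom k A H a * inclHom k A H h = toSmash k A H (a ⊗ₜ h) :=
  (toSmash_mul_tmul_one a ((1 : A) ⊗ₜ h)).trans (by simp)

-- The products s(a)h span `A ♯ H`, so linear identities need only be checked on them; tensors then
-- give way to the commutation relations.
@[elab_as_elim]
theorem smash_induction {P : Smash k A H → Prop} (x : Smash k A H) (zero : P 0)
    (add : ∀ x y, P x → P y → P (x + y))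
    (mul : ∀ a h, P (baseHom k A H a * inclHom k A H h)) : P x := by
  obtain ⟨y, rfl⟩ := (toSmash k A H).surjective x
  induction y with
  | zero => simpa using zero
  | add u v hu hv => simpa using add _ _ hu hv
  | tmul a h => simpa only [baseHom_mul_inclHom] using mul a h

/-- `x ⊗ y ↦ f(x ▹ a)(1 ♯ y)`. -/
def actIncl (f : A →ₗ[k] Smash k A H) (a : A) : H ⊗[k] H →ₗ[k] Smash k A H :=
  LinearMap.mul' k (Smash k A H) ∘ₗ
    TensorProduct.map (f ∘ₗ (act k H A).flip a) (inclHom k A H).toLinearMap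

/-- `x ⊗ y ↦ f(y ▹ a)(1 ♯ x)`. -/
def coactIncl (f : A →ₗ[k] Smash k A H) (a : A) : H ⊗[k] H →ₗ[k] Smash k A H :=
  actIncl f a ∘ₗ (TensorProduct.comm k H H).toLinearMap

@[simp] theorem actIncl_tmul (f : A →ₗ[k] Smash k A H) (a : A) (x y : H) :
    actIncl f a (x ⊗ₜ y) = f (x • a) * inclHom k A H y := rfl

@[simp] theorem coactIncl_tmul (f : A →ₗ[k] Smash k A H) (a : A) (x y : H) :
    coactIncl f a (x ⊗ₜ y) = f (y • a) * inclHom k A H x := rfl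

/-- Here and in the next three lemmas, multiplying by h or acting on a by h is absorbed into a right
factor of w. Identities in `A ♯ H` thereby become identities in H ⊗ H. -/
theorem actIncl_mul_inclHom (f : A →ₗ[k] Smash k A H) (a : A) (w : H ⊗[k] H) (h : H) :
    actIncl f a w * inclHom k A H h = actIncl f a (w * (1 ⊗ₜ h)) := by
  induction w with
  | zero => simp
  | add u v hu hv => simp only [map_add, add_mul, hu, hv]
  | tmul x y => simp [mul_assoc]

theorem coactIncl_mul_inclHom (f : A →ₗ[k] Smash k A H) (a : A) (w : H ⊗[k] H) (h : H) :
    coactIncl f a w * inclHom k A H h = coactIncl f a (w * (h ⊗ₜ 1)) := by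
  induction w with
  | zero => simp
  | add u v hu hv => simp only [map_add, add_mul, hu, hv]
  | tmul x y => simp [mul_assoc]

theorem actIncl_smul (f : A →ₗ[k] Smash k A H) (a : A) (w : H ⊗[k] H) (h : H) :
    actIncl f (h • a) w = actIncl f a (w * (h ⊗ₜ 1)) := by
  induction w with
  | zero => simp
  | add u v hu hv => simp only [map_add, add_mul, hu, hv]
  | tmul x y => simp [mul_smul]

theorem coactIncl_smul (f : A →ₗ[k] Smash k A H) (a : A) (w : H ⊗[k] H) (h : H) :
    coactIncl f (h • a) w = coactIncl f a (w * (1 ⊗ₜ h)) := by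
  induction w with
  | zero => simp
  | add u v hu hv => simp only [map_add, add_mul, hu, hv]
  | tmul x y => simp [mul_smul]

theorem toSmash_actMul (w : H ⊗[k] H) (a : A) (h : H) :
    toSmash k A H (actMul k H A w (a ⊗ₜ h)) =
      actIncl (baseHom k A H).toLinearMap a w * inclHom k A H h := by
  induction w with
  | zero => simp
  | add u v hu hv => simp only [map_add, LinearMap.add_apply, add_mul, hu, hv]
  | tmul x y => simp [mul_assoc, ← baseHom_mul_inclHom]

/-- `h` commutes past `s` as `h s(a) = s(h₍₁₎ ▹ a) h₍₂₎`. -/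
theorem inclHom_mul_baseHom (h : H) (a : A) :
    inclHom k A H h * baseHom k A H a =
      actIncl (baseHom k A H).toLinearMap a (Coalgebra.comul h) := by
  refine (toSmash_one_tmul_mul h (a ⊗ₜ (1 : H))).trans ?_
  rw [toSmash_actMul, map_one, mul_one]

/-- If `h f(a) = f(h₍₁₎ ▹ a) h₍₂₎`, then multiplication by `h` on `f(x ▹ a)y` acts through
`Δ(h)`. -/
theorem inclHom_mul_actIncl {f : A →ₗ[k] Smash k A H}
    (hf : ∀ h a, inclHom k A H h * f a = actIncl f a (Coalgebra.comul h)) (h : H) (a : A)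
    (w : H ⊗[k] H) :
    inclHom k A H h * actIncl f a w = actIncl f a (Coalgebra.comul h * w) := by
  induction w with
  | zero => simp
  | add u v hu hv => simp only [map_add, mul_add, hu, hv]
  | tmul x y =>
    rw [actIncl_tmul, ← mul_assoc, hf, actIncl_smul, actIncl_mul_inclHom, mul_assoc]
    simp

theorem inclHom_mul_coactIncl {f : A →ₗ[k] Smash k A H}
    (hf : ∀ h a, inclHom k A H h * f a = coactIncl f a (Coalgebra.comul h)) (h : H) (a : A)
    (w : H ⊗[k] H) :
    inclHom k A H h * coactIncl f a w = coactIncl f a (Coalgebra.comul h * w) := by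
  induction w with
  | zero => simp
  | add u v hu hv => simp only [map_add, mul_add, hu, hv]
  | tmul x y =>
    rw [coactIncl_tmul, ← mul_assoc, hf, coactIncl_smul, coactIncl_mul_inclHom, mul_assoc]
    simp

/-- The target map `a ↦ a₍₀₎ ♯ a₍₁₎`. -/
def targetMap (ρ : A →ₗ[k] A ⊗[k] H) : A →ₗ[k] Smash k A H := (toSmash k A H).toLinearMap ∘ₗ ρ

theorem targetMap_apply (ρ : A →ₗ[k] A ⊗[k] H) (a : A) :
    targetMap ρ a = toSmash k A H (ρ a) := rfl

/-- Read in `A ♯ H`, the flipped coaction is t(y ▹ a)x, so the right-hand side of the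
Yetter–Drinfeld condition becomes a product. -/
theorem toSmash_coactFlip (ρ : A →ₗ[k] A ⊗[k] H) (a : A) (w : H ⊗[k] H) :
    toSmash k A H (coactFlip k H A ρ a w) = coactIncl (targetMap ρ) a w := by
  induction w with
  | zero => simp
  | add u v hu hv => simp only [map_add, hu, hv]
  | tmul x y =>
    rw [coactIncl_tmul, targetMap_apply]
    simp only [coactFlip, LinearMap.comp_apply, LinearEquiv.coe_coe, TensorProduct.comm_tmul,
      TensorProduct.map_tmul, LinearMap.flip_apply, act_apply, LinearMap.id_apply]
    generalize ρ (y • a) = u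
    induction u with
    | zero => simp
    | add u v hu hv => simp only [map_add, TensorProduct.add_tmul, add_mul, hu, hv]
    | tmul b h => simp [← baseHom_mul_inclHom, mul_assoc]

/-- The Yetter–Drinfeld condition in the smash product: `h t(a) = t(h₍₂₎ ▹ a) h₍₁₎`. -/
theorem compat_iff {ρ : A →ₗ[k] A ⊗[k] H} (h : H) (a : A) :
    actMul k H A (Coalgebra.comul (R := k) h) (ρ a) =
      coactFlip k H A ρ a (Coalgebra.comul (R := k) h) ↔
    inclHom k A H h * targetMap ρ a = coactIncl (targetMap ρ) a (Coalgebra.comul h) := by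
  rw [← toSmash_coactFlip, ← (toSmash k A H).injective.eq_iff, ← toSmash_one_tmul_mul]
  rfl

/-! ### Consequences of coassociativity and braided commutativity alone -/

section BraidedCommutative

variable {ρ : A →ₗ[k] A ⊗[k] H}
  (hco : ∀ a : A, TensorProduct.assoc k A H H (ρ.rTensor H (ρ a)) =
    (Coalgebra.comul (R := k) (A := H)).lTensor A (ρ a))
  (hbr : ∀ a b : A, LinearMap.mul' k A (((act k H A).flip a).lTensor A (ρ b)) = a * b)
include hco hbr

/-- Moving b₍₁₎ past s(a) applies Δ to it; by coassociativity the result is b₍₀₎₍₀₎(b₍₀₎₍₁₎ ▹ a) ♯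
b₍₁₎, and braided commutativity collapses this to a b₍₀₎ ♯ b₍₁₎. Only these two axioms enter, so the
lemma applies to A_F before its other axioms are known. -/
theorem targetMap_mul_baseHom (a b : A) :
    targetMap ρ b * baseHom k A H a = baseHom k A H a * targetMap ρ b := by
  -- X sends c ⊗ x ⊗ y to c(x ▹ a) ♯ y.
  let X : A ⊗[k] (H ⊗[k] H) →ₗ[k] Smash k A H :=
    LinearMap.mul' k _ ∘ₗ TensorProduct.map (baseHom k A H).toLinearMap
      (actIncl (baseHom k A H).toLinearMap a)
  have h1 : ∀ u : A ⊗[k] H, toSmash k A H u * baseHom k A H a =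
      X ((Coalgebra.comul (R := k) (A := H)).lTensor A u) := by
    intro u
    induction u with
    | zero => simp
    | add u v hu hv => simp only [map_add, add_mul, hu, hv]
    | tmul c h =>
      rw [← baseHom_mul_inclHom, mul_assoc, inclHom_mul_baseHom]
      rfl
  have h2 : ∀ u : A ⊗[k] H, X (TensorProduct.assoc k A H H (ρ.rTensor H u)) =
      baseHom k A H a * toSmash k A H u := by
    intro u
    induction u with
    | zero => simp
    | add u v hu hv => simp only [map_add, mul_add, hu, hv]
    | tmul c y =>
      rw [← baseHom_mul_inclHom, ← mul_assoc, ← map_mul, ← hbr a c, LinearMap.rTensor_tmul]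
      generalize ρ c = v
      induction v with
      | zero => simp
      | add u v hu hv => simp only [map_add, TensorProduct.add_tmul, add_mul, hu, hv]
      | tmul d x => simp [X, mul_assoc]
  rw [targetMap_apply, h1, ← hco, h2]

/-- Because t(b) slides past s(a), left multiplication by t(b) is right multiplication by ρ(b) in A
⊗ Hᵒᵖ. -/
theorem targetMap_mul_toSmash (b : A) (v : A ⊗[k] H) :
    targetMap ρ b * toSmash k A H v = toSmash k A H
      (TensorProduct.map₂ (LinearMap.mul k A) (LinearMap.mul k H).flip v (ρ b)) := by
  induction v with
  | zero => simp
  | add u v hu hv => simp only [map_add, LinearMap.add_apply, mul_add, hu, hv]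
  | tmul a h =>
    rw [← baseHom_mul_inclHom, ← mul_assoc, targetMap_mul_baseHom hco hbr, targetMap_apply]
    generalize ρ b = u
    induction u with
    | zero => simp
    | add u v hu hv => simp only [map_add, mul_add, add_mul, hu, hv]
    | tmul c l => simp [← baseHom_mul_inclHom, mul_assoc]

/-- This trades the comodule algebra axiom for antimultiplicativity of the target, a form that can
be transported through ζ. -/
theorem coact_mul_iff (a b : A) :
    ρ (a * b) = TensorProduct.map₂ (LinearMap.mul k A) (LinearMap.mul k H).flip (ρ a) (ρ b) ↔
      targetMap ρ (a * b) = targetMap ρ b * targetMap ρ a := by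
  rw [targetMap_apply ρ a, targetMap_mul_toSmash hco hbr, targetMap_apply,
    (toSmash k A H).injective.eq_iff]

end BraidedCommutative

end SmashRelations

/-! ## Balanced tensor products -/

section BalancedLemmas

variable {k A E : Type*} [Field k] [AddCommGroup A] [Module k A] [Ring E] [Algebra k E]
  {s t : A →ₗ[k] E}

theorem mkQ_balRel_tmul (a : A) (x y : E) :
    (balRel s t).mkQ ((t a * x) ⊗ₜ y) = (balRel s t).mkQ (x ⊗ₜ (s a * y)) :=
  (Submodule.Quotient.eq _).2 (Submodule.subset_span ⟨a, x, y, rfl⟩)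

theorem mkQ_balRel_mul_right {z z' : E ⊗[k] E} (h : (balRel s t).mkQ z = (balRel s t).mkQ z')
    (w : E ⊗[k] E) : (balRel s t).mkQ (z * w) = (balRel s t).mkQ (z' * w) := by
  refine (Submodule.Quotient.eq _).2 ?_
  rw [← sub_mul]
  exact balRel_mul_right s t ((Submodule.Quotient.eq _).1 h) w

theorem map_eq_of_mkQ_balRel_eq {M : Type*} [AddCommGroup M] [Module k M]
    {φ : E ⊗[k] E →ₗ[k] M} (h : ∀ a x y, φ ((t a * x) ⊗ₜ y) = φ (x ⊗ₜ (s a * y)))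
    {z z' : E ⊗[k] E} (hz : (balRel s t).mkQ z = (balRel s t).mkQ z') : φ z = φ z' := by
  have : balRel s t ≤ LinearMap.ker φ := by
    refine Submodule.span_le.2 ?_
    rintro _ ⟨a, x, y, rfl⟩
    rw [SetLike.mem_coe, LinearMap.mem_ker, map_sub, h, sub_self]
  exact LinearMap.sub_mem_ker_iff.1 (this ((Submodule.Quotient.eq _).1 hz))

/-- The relations have s and t on the left, so right multiplication always descends to E ⊗_A E,
while left multiplication needs the factors to commute with t and s respectively. It is applied to p
= s(c) and q = t(b), or with one of them equal to 1. -/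
theorem mkQ_balRel_mul_left {p q : E} (hp : ∀ a, p * t a = t a * p)
    (hq : ∀ a, q * s a = s a * q) {z z' : E ⊗[k] E}
    (h : (balRel s t).mkQ z = (balRel s t).mkQ z') :
    (balRel s t).mkQ ((p ⊗ₜ q) * z) = (balRel s t).mkQ ((p ⊗ₜ q) * z') := by
  refine map_eq_of_mkQ_balRel_eq
    (φ := (balRel s t).mkQ ∘ₗ LinearMap.mulLeft k (p ⊗ₜ q)) (fun a x y => ?_) h
  simp only [LinearMap.comp_apply, LinearMap.mulLeft_apply, Algebra.TensorProduct.tmul_mul_tmul]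
  rw [← mul_assoc, hp, mul_assoc, mkQ_balRel_tmul, ← mul_assoc, ← hq, mul_assoc]

theorem mkQ_balRel₃_fst (a : A) (x y z : E) :
    (balRel₃ s t).mkQ ((t a * x) ⊗ₜ (y ⊗ₜ z)) = (balRel₃ s t).mkQ (x ⊗ₜ ((s a * y) ⊗ₜ z)) :=
  (Submodule.Quotient.eq _).2 (Submodule.subset_span (Or.inl ⟨a, x, y, z, rfl⟩))

theorem mkQ_balRel₃_snd (a : A) (x y z : E) :
    (balRel₃ s t).mkQ (x ⊗ₜ ((t a * y) ⊗ₜ z)) = (balRel₃ s t).mkQ (x ⊗ₜ (y ⊗ₜ (s a * z))) :=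
  (Submodule.Quotient.eq _).2 (Submodule.subset_span (Or.inr ⟨a, x, y, z, rfl⟩))

theorem balRel₃_mul_right {z : E ⊗[k] (E ⊗[k] E)} (hz : z ∈ balRel₃ s t)
    (w : E ⊗[k] (E ⊗[k] E)) : z * w ∈ balRel₃ s t := by
  induction w with
  | zero => simp
  | add u v hu hv => rw [mul_add]; exact add_mem hu hv
  | tmul p w =>
    induction w with
    | zero => simp
    | add u v hu hv => rw [TensorProduct.tmul_add, mul_add]; exact add_mem hu hv
    | tmul q r =>
      have : balRel₃ s t ≤ (balRel₃ s t).comap (LinearMap.mulRight k (p ⊗ₜ[k] (q ⊗ₜ[k] r))) := by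
        refine Submodule.span_le.2 ?_
        rintro _ (⟨a, x, y, z, rfl⟩ | ⟨a, x, y, z, rfl⟩)
        · exact Submodule.subset_span
            (Or.inl ⟨a, x * p, y * q, z * r, by simp [sub_mul, mul_assoc]⟩)
        · exact Submodule.subset_span
            (Or.inr ⟨a, x * p, y * q, z * r, by simp [sub_mul, mul_assoc]⟩)
      exact this hz

theorem mkQ_balRel₃_mul_right {z z' : E ⊗[k] (E ⊗[k] E)}
    (h : (balRel₃ s t).mkQ z = (balRel₃ s t).mkQ z') (w : E ⊗[k] (E ⊗[k] E)) :
    (balRel₃ s t).mkQ (z * w) = (balRel₃ s t).mkQ (z' * w) := by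
  refine (Submodule.Quotient.eq _).2 ?_
  rw [← sub_mul]
  exact balRel₃_mul_right ((Submodule.Quotient.eq _).1 h) w

theorem appendRight_mkQ (z : E) (w : E ⊗[k] E) : appendRight s t z ((balRel s t).mkQ w) =
    (balRel₃ s t).mkQ (TensorProduct.assoc k E E E (w ⊗ₜ z)) := rfl

theorem appendLeft_mkQ (x : E) (w : E ⊗[k] E) : appendLeft s t x ((balRel s t).mkQ w) =
    (balRel₃ s t).mkQ (x ⊗ₜ w) := rfl

end BalancedLemmas

/-! ## The comultiplication and counit of the scalar extension -/

section ScalarExtensionMaps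

variable {k A H : Type*} [Field k] [Ring H] [Bialgebra k H] [Ring A] [Algebra k A]
  [Module H A] [IsScalarTower k H A] [IsModuleAlgebra k H A]

variable (k A H) in
/-- `x ⊗ y ↦ (1 ♯ x) ⊗ (1 ♯ y)`. -/
def inclHom₂ : H ⊗[k] H →ₐ[k] Smash k A H ⊗[k] Smash k A H :=
  Algebra.TensorProduct.map (inclHom k A H) (inclHom k A H)

@[simp] theorem inclHom₂_tmul (x y : H) :
    inclHom₂ k A H (x ⊗ₜ y) = inclHom k A H x ⊗ₜ inclHom k A H y := rfl

variable (k A H) in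
/-- `a ♯ h ↦ (a ♯ h₍₁₎) ⊗ (1 ♯ h₍₂₎)`, a lift of the comultiplication of `A ♯ H`. -/
def comulRep : Smash k A H →ₗ[k] Smash k A H ⊗[k] Smash k A H :=
  TensorProduct.map (toSmash k A H).toLinearMap (inclSmash k A H) ∘ₗ
    (TensorProduct.assoc k A H H).symm.toLinearMap ∘ₗ
    (Coalgebra.comul (R := k) (A := H)).lTensor A ∘ₗ (toSmash k A H).symm.toLinearMap

theorem comulRep_baseHom_mul_inclHom (a : A) (h : H) :
    comulRep k A H (baseHom k A H a * inclHom k A H h) =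
      (baseHom k A H a ⊗ₜ 1) * inclHom₂ k A H (Coalgebra.comul h) := by
  rw [baseHom_mul_inclHom]
  simp only [comulRep, LinearMap.comp_apply, LinearEquiv.coe_coe, LinearEquiv.symm_apply_apply,
    LinearMap.lTensor_tmul]
  generalize Coalgebra.comul (R := k) h = w
  induction w with
  | zero => simp
  | add u v hu hv => simp only [TensorProduct.tmul_add, map_add, mul_add, hu, hv]
  | tmul x y => simp [baseHom_mul_inclHom]; rfl

theorem comulRep_inclHom (h : H) :
    comulRep k A H (inclHom k A H h) = inclHom₂ k A H (Coalgebra.comul h) := by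
  simpa [← Algebra.TensorProduct.one_def] using
    comulRep_baseHom_mul_inclHom (k := k) (1 : A) h

theorem comulRep_one : comulRep k A H 1 = 1 := by
  simpa using comulRep_inclHom (k := k) (A := A) (1 : H)

theorem comulRep_baseHom_mul (a : A) (x : Smash k A H) :
    comulRep k A H (baseHom k A H a * x) = (baseHom k A H a ⊗ₜ 1) * comulRep k A H x := by
  induction x using smash_induction with
  | zero => simp
  | add x y hx hy => simp only [mul_add, map_add, hx, hy]
  | mul b h =>
    rw [← mul_assoc, ← map_mul, comulRep_baseHom_mul_inclHom, comulRep_baseHom_mul_inclHom,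
      ← mul_assoc]
    simp

theorem comulRep_mul_inclHom (x : Smash k A H) (h : H) :
    comulRep k A H (x * inclHom k A H h) =
      comulRep k A H x * inclHom₂ k A H (Coalgebra.comul h) := by
  induction x using smash_induction with
  | zero => simp
  | add x y hx hy => simp only [add_mul, map_add, hx, hy]
  | mul b l =>
    rw [mul_assoc, ← map_mul, comulRep_baseHom_mul_inclHom, comulRep_baseHom_mul_inclHom,
      Bialgebra.comul_mul, map_mul, mul_assoc]

theorem comulRep_toSmash (u : A ⊗[k] H) : comulRep k A H (toSmash k A H u) =
    TensorProduct.map (toSmash k A H).toLinearMap (inclHom k A H).toLinearMap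
      ((TensorProduct.assoc k A H H).symm ((Coalgebra.comul (R := k) (A := H)).lTensor A u)) := rfl

/-- This is coassociativity of ρ read in (A ♯ H) ⊗ (A ♯ H); no balancing is needed. -/
theorem comulRep_targetMap {ρ : A →ₗ[k] A ⊗[k] H}
    (hco : ∀ a : A, TensorProduct.assoc k A H H (ρ.rTensor H (ρ a)) =
      (Coalgebra.comul (R := k) (A := H)).lTensor A (ρ a)) (b : A) :
    comulRep k A H (targetMap ρ b) =
      TensorProduct.map (targetMap ρ) (inclHom k A H).toLinearMap (ρ b) := by
  rw [targetMap_apply, comulRep_toSmash, ← hco, LinearEquiv.symm_apply_apply]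
  generalize ρ b = u
  induction u with
  | zero => simp
  | add u v hu hv => simp only [map_add, hu, hv]
  | tmul c l => rfl

variable (k A H) in
/-- `a ♯ h ↦ a ε(h)`. -/
def smashCounit : Smash k A H →ₗ[k] A :=
  (TensorProduct.rid k A).toLinearMap ∘ₗ
    (Coalgebra.counit (R := k) (A := H)).lTensor A ∘ₗ (toSmash k A H).symm.toLinearMap

theorem smashCounit_toSmash (u : A ⊗[k] H) : smashCounit k A H (toSmash k A H u) =
    TensorProduct.rid k A ((Coalgebra.counit (R := k) (A := H)).lTensor A u) := rfl

theorem smashCounit_baseHom_mul_inclHom (a : A) (h : H) :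
    smashCounit k A H (baseHom k A H a * inclHom k A H h) = Coalgebra.counit (R := k) h • a := by
  rw [baseHom_mul_inclHom, smashCounit_toSmash]
  simp

theorem smashCounit_inclHom (h : H) :
    smashCounit k A H (inclHom k A H h) = Coalgebra.counit (R := k) h • 1 := by
  simpa using smashCounit_baseHom_mul_inclHom (k := k) (1 : A) h

theorem smashCounit_baseHom (a : A) : smashCounit k A H (baseHom k A H a) = a := by
  simpa using smashCounit_baseHom_mul_inclHom (k := k) a (1 : H)

theorem smashCounit_baseHom_mul (a : A) (x : Smash k A H) :
    smashCounit k A H (baseHom k A H a * x) = a * smashCounit k A H x := by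
  induction x using smash_induction with
  | zero => simp
  | add x y hx hy => simp only [mul_add, map_add, hx, hy]
  | mul b h =>
    rw [← mul_assoc, ← map_mul, smashCounit_baseHom_mul_inclHom, smashCounit_baseHom_mul_inclHom,
      mul_smul_comm]

theorem smashCounit_mul_inclHom (x : Smash k A H) (h : H) :
    smashCounit k A H (x * inclHom k A H h) =
      Coalgebra.counit (R := k) h • smashCounit k A H x := by
  induction x using smash_induction with
  | zero => simp
  | add x y hx hy => simp only [add_mul, map_add, smul_add, hx, hy]
  | mul b l =>
    rw [mul_assoc, ← map_mul, smashCounit_baseHom_mul_inclHom, smashCounit_baseHom_mul_inclHom,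
      Bialgebra.counit_mul, mul_smul, smul_comm]

theorem smashCounit_targetMap {ρ : A →ₗ[k] A ⊗[k] H}
    (hcu : ∀ a : A, (Coalgebra.counit (R := k) (A := H)).lTensor A (ρ a) = a ⊗ₜ 1) (b : A) :
    smashCounit k A H (targetMap ρ b) = b := by
  rw [targetMap_apply, smashCounit_toSmash, hcu]
  simp

theorem counit_iff {ρ : A →ₗ[k] A ⊗[k] H} (a : A) :
    (Coalgebra.counit (R := k) (A := H)).lTensor A (ρ a) = a ⊗ₜ 1 ↔
      smashCounit k A H (targetMap ρ a) = a := by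
  rw [targetMap_apply, smashCounit_toSmash, ← (TensorProduct.rid k A).injective.eq_iff]
  simp

theorem smashCounit_actIncl (f : A →ₗ[k] Smash k A H) (hf : ∀ a, smashCounit k A H (f a) = a)
    (a : A) (w : H ⊗[k] H) : smashCounit k A H (actIncl f a w) =
      (TensorProduct.rid k H (TensorProduct.map LinearMap.id Coalgebra.counit w)) • a := by
  induction w with
  | zero => simp
  | add u v hu hv => simp only [map_add, add_smul, hu, hv]
  | tmul x y => simp [smashCounit_mul_inclHom, hf]

theorem smashCounit_coactIncl (f : A →ₗ[k] Smash k A H) (hf : ∀ a, smashCounit k A H (f a) = a)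
    (a : A) (w : H ⊗[k] H) : smashCounit k A H (coactIncl f a w) =
      (TensorProduct.lid k H (TensorProduct.map Coalgebra.counit LinearMap.id w)) • a := by
  induction w with
  | zero => simp
  | add u v hu hv => simp only [map_add, add_smul, hu, hv]
  | tmul x y => simp [smashCounit_mul_inclHom, hf]

theorem smashCounit_inclHom_mul_baseHom (h : H) (a : A) :
    smashCounit k A H (inclHom k A H h * baseHom k A H a) = h • a := by
  have h2 : TensorProduct.map LinearMap.id Coalgebra.counit (Coalgebra.comul (R := k) h) =
      h ⊗ₜ[k] 1 := Coalgebra.lTensor_counit_comul h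
  rw [inclHom_mul_baseHom, smashCounit_actIncl _ smashCounit_baseHom, h2]
  simp

/-- The Yetter–Drinfeld relation turns h t(a) into t(h₍₂₎ ▹ a)h₍₁₎, and ε removes h₍₁₎. The value
agrees with that of h s(a), which is what the target half of the counit axiom needs. -/
theorem smashCounit_inclHom_mul_targetMap {ρ : A →ₗ[k] A ⊗[k] H} (hρ : IsYetterDrinfeld k H A ρ)
    (h : H) (a : A) : smashCounit k A H (inclHom k A H h * targetMap ρ a) = h • a := by
  have h2 : TensorProduct.map Coalgebra.counit LinearMap.id (Coalgebra.comul (R := k) h) =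
      1 ⊗ₜ[k] h := Coalgebra.rTensor_counit_comul h
  rw [(compat_iff h a).1 (hρ.compat h a),
    smashCounit_coactIncl _ (smashCounit_targetMap hρ.counit), h2]
  simp

end ScalarExtensionMaps

/-! ## The scalar extension is a left bialgebroid -/

section ScalarExtensionAxioms

variable {k A H : Type*} [Field k] [Ring H] [Bialgebra k H] [Ring A] [Algebra k A]
  [Module H A] [IsScalarTower k H A] [IsModuleAlgebra k H A] {ρ : A →ₗ[k] A ⊗[k] H}

/-- The balancing moves t(c) across as s(c). Together with `comulRep_targetMap` this gives Δ(t(b)) =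
1 ⊗ t(b) in E ⊗_A E. -/
theorem mkQ_map_targetMap (u : A ⊗[k] H) :
    (balRel (baseHom k A H).toLinearMap (targetMap ρ)).mkQ
      (TensorProduct.map (targetMap ρ) (inclHom k A H).toLinearMap u) =
    (balRel (baseHom k A H).toLinearMap (targetMap ρ)).mkQ (1 ⊗ₜ toSmash k A H u) := by
  induction u with
  | zero => simp
  | add u v hu hv => simp only [map_add, TensorProduct.tmul_add, hu, hv]
  | tmul c l =>
    rw [← baseHom_mul_inclHom]
    simpa using mkQ_balRel_tmul (s := (baseHom k A H).toLinearMap) (t := targetMap ρ) c 1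
      (inclHom k A H l)

/-- `x ⊗ y ⊗ z ↦ f(x ▹ a)(1 ♯ y) ⊗ (1 ♯ z)`. -/
def actIncl₂ (f : A →ₗ[k] Smash k A H) (a : A) :
    H ⊗[k] (H ⊗[k] H) →ₗ[k] Smash k A H ⊗[k] Smash k A H :=
  TensorProduct.map (actIncl f a) (inclHom k A H).toLinearMap ∘ₗ
    (TensorProduct.assoc k H H H).symm.toLinearMap

@[simp] theorem actIncl₂_assoc_tmul (f : A →ₗ[k] Smash k A H) (a : A) (w : H ⊗[k] H) (z : H) :
    actIncl₂ f a (TensorProduct.assoc k H H H (w ⊗ₜ z)) = actIncl f a w ⊗ₜ inclHom k A H z := by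
  simp [actIncl₂]

theorem comulFst_tmul (p q : H) : comulFst k H (p ⊗ₜ q) =
    TensorProduct.assoc k H H H (Coalgebra.comul p ⊗ₜ q) := rfl

theorem comulSnd_tmul (p q : H) : comulSnd k H (p ⊗ₜ q) = p ⊗ₜ Coalgebra.comul q := rfl

theorem inclHom₂_mul_baseHom (a : A) (w : H ⊗[k] H) :
    inclHom₂ k A H w * (baseHom k A H a ⊗ₜ 1) =
      actIncl₂ (baseHom k A H).toLinearMap a (comulFst k H w) := by
  induction w with
  | zero => simp
  | add u v hu hv => simp only [map_add, add_mul, hu, hv]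
  | tmul p q => simp [comulFst_tmul, inclHom_mul_baseHom]

theorem comulRep_actIncl (a : A) (w : H ⊗[k] H) :
    comulRep k A H (actIncl (baseHom k A H).toLinearMap a w) =
      actIncl₂ (baseHom k A H).toLinearMap a (comulSnd k H w) := by
  induction w with
  | zero => simp
  | add u v hu hv => simp only [map_add, hu, hv]
  | tmul p q =>
    rw [comulSnd_tmul, actIncl_tmul, AlgHom.toLinearMap_apply, comulRep_baseHom_mul_inclHom]
    generalize Coalgebra.comul (R := k) q = w
    induction w with
    | zero => simp
    | add u v hu hv => simp only [map_add, mul_add, TensorProduct.tmul_add, hu, hv]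
    | tmul x y => simp [actIncl₂]

/-- The lift keeps the A-component in the first leg, and h₍₁₎s(a) ⊗ h₍₂₎ = s(h₍₁₎ ▹ a)h₍₂₎ ⊗ h₍₃₎ is
also the lift of Δ(h s(a)). Hence multiplicativity is coassociativity of H, without any balancing.
-/
theorem comulRep_mul (x y : Smash k A H) :
    comulRep k A H (x * y) = comulRep k A H x * comulRep k A H y := by
  induction y using smash_induction with
  | zero => simp
  | add x y hx hy => simp only [mul_add, map_add, hx, hy]
  | mul c h =>
    rw [← mul_assoc, comulRep_mul_inclHom, comulRep_baseHom_mul_inclHom, ← mul_assoc]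
    congr 1
    induction x using smash_induction with
    | zero => simp
    | add x y hx hy => simp only [add_mul, map_add, hx, hy]
    | mul b l =>
      rw [mul_assoc, inclHom_mul_baseHom, comulRep_baseHom_mul, comulRep_actIncl,
        comulRep_baseHom_mul_inclHom, mul_assoc, inclHom₂_mul_baseHom,
        DrinfeldTwist.comulFst_comul]

variable (hρ : IsBraidedCommYDAlgebra k H A ρ)
include hρ

theorem IsBraidedCommYDAlgebra.commute (a b : A) :
    targetMap ρ b * baseHom k A H a = baseHom k A H a * targetMap ρ b :=
  targetMap_mul_baseHom hρ.coassoc hρ.braided_comm a b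

theorem IsBraidedCommYDAlgebra.inclHom_mul_targetMap (h : H) (a : A) :
    inclHom k A H h * targetMap ρ a = coactIncl (targetMap ρ) a (Coalgebra.comul h) :=
  (compat_iff h a).1 (hρ.compat h a)

theorem IsBraidedCommYDAlgebra.targetMap_mul (a b : A) :
    targetMap ρ (a * b) = targetMap ρ b * targetMap ρ a :=
  (coact_mul_iff hρ.coassoc hρ.braided_comm a b).1 (hρ.coact_mul a b)

/-- After t(b) is moved past s(c), the claim reduces to Δ(t(b)) = 1 ⊗ t(b); multiplication by s(c) ⊗
1 is compatible with the balancing since s and t commute. -/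
theorem mkQ_comulRep_targetMap_mul (b : A) (x : Smash k A H) :
    (balRel (baseHom k A H).toLinearMap (targetMap ρ)).mkQ
      (comulRep k A H (targetMap ρ b * x)) =
    (balRel (baseHom k A H).toLinearMap (targetMap ρ)).mkQ
      ((1 ⊗ₜ targetMap ρ b) * comulRep k A H x) := by
  induction x using smash_induction with
  | zero => simp
  | add x y hx hy => simp only [mul_add, map_add, hx, hy]
  | mul c h =>
    rw [← mul_assoc, hρ.commute, mul_assoc, comulRep_baseHom_mul, comulRep_mul_inclHom,
      comulRep_baseHom_mul_inclHom, comulRep_targetMap hρ.coassoc]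
    have h1 := mkQ_balRel_mul_right (mkQ_map_targetMap (ρ := ρ) (ρ b))
      (inclHom₂ k A H (Coalgebra.comul h))
    have h2 := mkQ_balRel_mul_left (p := baseHom k A H c) (q := 1)
      (fun a => (hρ.commute c a).symm) (by simp) h1
    rw [h2, ← targetMap_apply, ← mul_assoc, ← mul_assoc]
    simp

/-- The Takeuchi condition for the standard lift: h₍₁₎t(a) ⊗ h₍₂₎ = t(h₍₂₎ ▹ a)h₍₁₎ ⊗ h₍₃₎, which
the balancing turns into h₍₁₎ ⊗ s(h₍₂₎ ▹ a)h₍₃₎ = h₍₁₎ ⊗ h₍₂₎s(a). -/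
theorem mkQ_comulRep_mul_targetMap (x : Smash k A H) (a : A) :
    (balRel (baseHom k A H).toLinearMap (targetMap ρ)).mkQ
      (comulRep k A H x * (targetMap ρ a ⊗ₜ 1)) =
    (balRel (baseHom k A H).toLinearMap (targetMap ρ)).mkQ
      (comulRep k A H x * (1 ⊗ₜ baseHom k A H a)) := by
  induction x using smash_induction with
  | zero => simp
  | add x y hx hy => simp only [add_mul, map_add, hx, hy]
  | mul c h =>
    -- X sends x ⊗ y ⊗ z to x ⊗ s(y ▹ a)z.
    let X : H ⊗[k] (H ⊗[k] H) →ₗ[k] Smash k A H ⊗[k] Smash k A H :=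
      TensorProduct.map (inclHom k A H).toLinearMap (actIncl (baseHom k A H).toLinearMap a)
    have h1 : ∀ w : H ⊗[k] H, inclHom₂ k A H w * (1 ⊗ₜ baseHom k A H a) =
        X (comulSnd k H w) := by
      intro w
      induction w with
      | zero => simp
      | add u v hu hv => simp only [map_add, add_mul, hu, hv]
      | tmul p q =>
        simp only [inclHom₂_tmul, Algebra.TensorProduct.tmul_mul_tmul, mul_one,
          inclHom_mul_baseHom]
        rfl
    have h2 : ∀ w : H ⊗[k] H, (balRel (baseHom k A H).toLinearMap (targetMap ρ)).mkQ
        (inclHom₂ k A H w * (targetMap ρ a ⊗ₜ 1)) =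
        (balRel (baseHom k A H).toLinearMap (targetMap ρ)).mkQ
          (X (comulFst k H w)) := by
      intro w
      induction w with
      | zero => simp
      | add u v hu hv => simp only [map_add, add_mul, hu, hv]
      | tmul p q =>
        simp only [comulFst_tmul, inclHom₂_tmul, Algebra.TensorProduct.tmul_mul_tmul, mul_one,
          hρ.inclHom_mul_targetMap]
        generalize Coalgebra.comul (R := k) p = w
        induction w with
        | zero => simp
        | add u v hu hv => simp only [map_add, TensorProduct.add_tmul, hu, hv]
        | tmul x y => exact mkQ_balRel_tmul (y • a) (inclHom k A H x) (inclHom k A H q)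
    rw [comulRep_baseHom_mul_inclHom, mul_assoc, mul_assoc]
    refine mkQ_balRel_mul_left (fun a => (hρ.commute c a).symm) (by simp) ?_
    rw [h1, h2, DrinfeldTwist.comulFst_comul]

/-- Both sides depend only on the class of z: Δ(t(a)x) = (1 ⊗ t(a))Δ(x) handles Δ ⊗ id and Δ(s(a)y)
= (s(a) ⊗ 1)Δ(y) handles id ⊗ Δ. For the standard lift the claim is coassociativity of H. -/
theorem scalarExtension_coassoc {x : Smash k A H} {z : Smash k A H ⊗[k] Smash k A H}
    (hz : (scalarExtension k A H ρ).comul x = (scalarExtension k A H ρ).cls z) :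
    (scalarExtension k A H ρ).comulFst z = (scalarExtension k A H ρ).comulSnd z := by
  have key1 : (scalarExtension k A H ρ).comulFst z =
      (scalarExtension k A H ρ).comulFst (comulRep k A H x) := by
    refine map_eq_of_mkQ_balRel_eq (fun a x y => ?_) hz.symm
    change appendRight (baseHom k A H).toLinearMap (targetMap ρ) y
        ((balRel (baseHom k A H).toLinearMap (targetMap ρ)).mkQ
          (comulRep k A H (targetMap ρ a * x))) =
      appendRight (baseHom k A H).toLinearMap (targetMap ρ) (baseHom k A H a * y)
        ((balRel (baseHom k A H).toLinearMap (targetMap ρ)).mkQ (comulRep k A H x))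
    rw [mkQ_comulRep_targetMap_mul hρ, appendRight_mkQ, appendRight_mkQ]
    generalize comulRep k A H x = w
    induction w with
    | zero => simp
    | add u v hu hv => simp only [map_add, mul_add, TensorProduct.add_tmul, hu, hv]
    | tmul p q =>
      simpa using mkQ_balRel₃_snd (s := (baseHom k A H).toLinearMap) (t := targetMap ρ) a p q y
  have key2 : (scalarExtension k A H ρ).comulSnd z =
      (scalarExtension k A H ρ).comulSnd (comulRep k A H x) := by
    refine map_eq_of_mkQ_balRel_eq (fun a x y => ?_) hz.symm
    change appendLeft (baseHom k A H).toLinearMap (targetMap ρ) (targetMap ρ a * x)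
        ((balRel (baseHom k A H).toLinearMap (targetMap ρ)).mkQ (comulRep k A H y)) =
      appendLeft (baseHom k A H).toLinearMap (targetMap ρ) x
        ((balRel (baseHom k A H).toLinearMap (targetMap ρ)).mkQ
          (comulRep k A H (baseHom k A H a * y)))
    rw [comulRep_baseHom_mul, appendLeft_mkQ, appendLeft_mkQ]
    generalize comulRep k A H y = w
    induction w with
    | zero => simp
    | add u v hu hv => simp only [map_add, mul_add, TensorProduct.tmul_add, hu, hv]
    | tmul p q =>
      simpa using mkQ_balRel₃_fst (s := (baseHom k A H).toLinearMap) (t := targetMap ρ) a x p q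
  rw [key1, key2]
  clear key1 key2 hz
  induction x using smash_induction with
  | zero => simp
  | add x y hx hy => simp only [map_add, hx, hy]
  | mul c h =>
    let X : H ⊗[k] (H ⊗[k] H) →ₗ[k] Smash k A H ⊗[k] (Smash k A H ⊗[k] Smash k A H) :=
      TensorProduct.map (LinearMap.mulLeft k (baseHom k A H c) ∘ₗ (inclHom k A H).toLinearMap)
        (inclHom₂ k A H).toLinearMap
    have h1 : ∀ w : H ⊗[k] H, (scalarExtension k A H ρ).comulFst
        ((baseHom k A H c ⊗ₜ 1) * inclHom₂ k A H w) =
        (scalarExtension k A H ρ).cls₃ (X (comulFst k H w)) := by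
      intro w
      induction w with
      | zero => simp
      | add u v hu hv => simp only [map_add, mul_add, hu, hv]
      | tmul p q =>
        rw [comulFst_tmul, inclHom₂_tmul, Algebra.TensorProduct.tmul_mul_tmul, one_mul]
        change appendRight _ _ (inclHom k A H q) (Submodule.mkQ _ (comulRep k A H _)) = _
        rw [comulRep_baseHom_mul_inclHom, appendRight_mkQ]
        congr 1
        generalize Coalgebra.comul (R := k) p = w
        induction w with
        | zero => simp
        | add u v hu hv => simp only [map_add, mul_add, TensorProduct.add_tmul, hu, hv]
        | tmul x y => simp [X]
    have h2 : ∀ w : H ⊗[k] H, (scalarExtension k A H ρ).comulSnd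
        ((baseHom k A H c ⊗ₜ 1) * inclHom₂ k A H w) =
        (scalarExtension k A H ρ).cls₃ (X (comulSnd k H w)) := by
      intro w
      induction w with
      | zero => simp
      | add u v hu hv => simp only [map_add, mul_add, hu, hv]
      | tmul p q =>
        rw [comulSnd_tmul, inclHom₂_tmul, Algebra.TensorProduct.tmul_mul_tmul, one_mul]
        change appendLeft _ _ _ (Submodule.mkQ _ (comulRep k A H (inclHom k A H q))) = _
        rw [comulRep_inclHom, appendLeft_mkQ]
        rfl
    rw [comulRep_baseHom_mul_inclHom, h1, h2, DrinfeldTwist.comulFst_comul]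

/-- On s(c)h, the factor t(b) slides past s(c), ε scales by ε(h), and ε(t(b)) = b. -/
theorem smashCounit_targetMap_mul (b : A) (x : Smash k A H) :
    smashCounit k A H (targetMap ρ b * x) = smashCounit k A H x * b := by
  induction x using smash_induction with
  | zero => simp
  | add x y hx hy => simp only [mul_add, add_mul, map_add, hx, hy]
  | mul c h =>
    rw [← mul_assoc, hρ.commute, mul_assoc, smashCounit_baseHom_mul, smashCounit_mul_inclHom,
      smashCounit_targetMap hρ.counit, smashCounit_baseHom_mul_inclHom]
    simp

omit hρ in
variable (ρ) in
theorem counitFst_baseHom_mul_inclHom₂ (c : A) (w : H ⊗[k] H) :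
    (scalarExtension k A H ρ).counitFst ((baseHom k A H c ⊗ₜ 1) * inclHom₂ k A H w) =
      baseHom k A H c * inclHom k A H
        (TensorProduct.lid k H (TensorProduct.map Coalgebra.counit LinearMap.id w)) := by
  induction w with
  | zero => simp
  | add u v hu hv => simp only [map_add, mul_add, hu, hv]
  | tmul p q =>
    rw [inclHom₂_tmul, Algebra.TensorProduct.tmul_mul_tmul, one_mul]
    change baseHom k A H (smashCounit k A H _) * inclHom k A H q = _
    rw [smashCounit_baseHom_mul_inclHom]
    simp

omit hρ in
variable (ρ) in
theorem counitFst_comulRep (x : Smash k A H) :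
    (scalarExtension k A H ρ).counitFst (comulRep k A H x) = x := by
  induction x using smash_induction with
  | zero => simp
  | add x y hx hy => simp only [map_add, hx, hy]
  | mul c h =>
    have h2 : TensorProduct.map Coalgebra.counit LinearMap.id (Coalgebra.comul (R := k) h) =
        1 ⊗ₜ[k] h := Coalgebra.rTensor_counit_comul h
    rw [comulRep_baseHom_mul_inclHom, counitFst_baseHom_mul_inclHom₂, h2]
    simp

theorem counitSnd_baseHom_mul_inclHom₂ (c : A) (w : H ⊗[k] H) :
    (scalarExtension k A H ρ).counitSnd ((baseHom k A H c ⊗ₜ 1) * inclHom₂ k A H w) =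
      baseHom k A H c * inclHom k A H
        (TensorProduct.rid k H (TensorProduct.map LinearMap.id Coalgebra.counit w)) := by
  induction w with
  | zero => simp
  | add u v hu hv => simp only [map_add, mul_add, hu, hv]
  | tmul p q =>
    rw [inclHom₂_tmul, Algebra.TensorProduct.tmul_mul_tmul, one_mul]
    change targetMap ρ (smashCounit k A H (inclHom k A H q)) *
      (baseHom k A H c * inclHom k A H p) = _
    rw [smashCounit_inclHom, map_smul, targetMap_apply, hρ.coact_one, toSmash_one]
    simp

theorem counitSnd_comulRep (x : Smash k A H) :
    (scalarExtension k A H ρ).counitSnd (comulRep k A H x) = x := by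
  induction x using smash_induction with
  | zero => simp
  | add x y hx hy => simp only [map_add, hx, hy]
  | mul c h =>
    have h2 : TensorProduct.map LinearMap.id Coalgebra.counit (Coalgebra.comul (R := k) h) =
        h ⊗ₜ[k] 1 := Coalgebra.lTensor_counit_comul h
    rw [comulRep_baseHom_mul_inclHom, counitSnd_baseHom_mul_inclHom₂ hρ, h2]
    simp

theorem counitFst_balanced (a : A) (x y : Smash k A H) :
    (scalarExtension k A H ρ).counitFst ((targetMap ρ a * x) ⊗ₜ y) =
      (scalarExtension k A H ρ).counitFst (x ⊗ₜ (baseHom k A H a * y)) := by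
  change baseHom k A H (smashCounit k A H (targetMap ρ a * x)) * y =
    baseHom k A H (smashCounit k A H x) * (baseHom k A H a * y)
  rw [← mul_assoc, ← map_mul, smashCounit_targetMap_mul hρ]

theorem counitSnd_balanced (a : A) (x y : Smash k A H) :
    (scalarExtension k A H ρ).counitSnd ((targetMap ρ a * x) ⊗ₜ y) =
      (scalarExtension k A H ρ).counitSnd (x ⊗ₜ (baseHom k A H a * y)) := by
  change targetMap ρ (smashCounit k A H y) * (targetMap ρ a * x) =
    targetMap ρ (smashCounit k A H (baseHom k A H a * y)) * x
  rw [← mul_assoc, smashCounit_baseHom_mul, IsBraidedCommYDAlgebra.targetMap_mul hρ]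

theorem scalarExtension_counit_comul_fst {x : Smash k A H} {z : Smash k A H ⊗[k] Smash k A H}
    (hz : (scalarExtension k A H ρ).comul x = (scalarExtension k A H ρ).cls z) :
    (scalarExtension k A H ρ).counitFst z = x := by
  have key : (scalarExtension k A H ρ).counitFst z =
      (scalarExtension k A H ρ).counitFst (comulRep k A H x) :=
    map_eq_of_mkQ_balRel_eq (s := (baseHom k A H).toLinearMap) (t := targetMap ρ)
      (φ := (scalarExtension k A H ρ).counitFst) (counitFst_balanced hρ) hz.symm
  rw [key, counitFst_comulRep]

theorem scalarExtension_counit_comul_snd {x : Smash k A H} {z : Smash k A H ⊗[k] Smash k A H}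
    (hz : (scalarExtension k A H ρ).comul x = (scalarExtension k A H ρ).cls z) :
    (scalarExtension k A H ρ).counitSnd z = x := by
  have key : (scalarExtension k A H ρ).counitSnd z =
      (scalarExtension k A H ρ).counitSnd (comulRep k A H x) :=
    map_eq_of_mkQ_balRel_eq (s := (baseHom k A H).toLinearMap) (t := targetMap ρ)
      (φ := (scalarExtension k A H ρ).counitSnd) (counitSnd_balanced hρ) hz.symm
  rw [key, counitSnd_comulRep]
  exact hρ

/-- The scalar extension of a braided commutative Yetter–Drinfeld module algebra is a left
bialgebroid. -/
theorem scalarExtension_isLeftBialgebroid : (scalarExtension k A H ρ).IsLeftBialgebroid where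
  mul_assoc a b c := mul_assoc a b c
  one_mul a := one_mul a
  mul_one a := mul_one a
  source_mul a b := map_mul (baseHom k A H) a b
  source_one := map_one (baseHom k A H)
  target_mul a b := hρ.targetMap_mul a b
  target_one := congrArg (toSmash k A H) hρ.coact_one
  source_target_comm a b := (hρ.commute a b).symm
  comul_bimodule a b x z hz := by
    change (balRel (baseHom k A H).toLinearMap (targetMap ρ)).mkQ
      (comulRep k A H (baseHom k A H a * targetMap ρ b * x)) =
      (balRel (baseHom k A H).toLinearMap (targetMap ρ)).mkQ
        ((baseHom k A H a ⊗ₜ targetMap ρ b) * z)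
    have h1 : (baseHom k A H a ⊗ₜ[k] targetMap ρ b) =
      (baseHom k A H a ⊗ₜ[k] 1) * (1 ⊗ₜ[k] targetMap ρ b) := by simp
    rw [mul_assoc, comulRep_baseHom_mul, h1, mul_assoc]
    refine mkQ_balRel_mul_left (fun c => (hρ.commute a c).symm) (by simp) ?_
    rw [mkQ_comulRep_targetMap_mul hρ]
    exact mkQ_balRel_mul_left (by simp) (fun c => hρ.commute c b) hz
  counit_bimodule a b x := by
    change smashCounit k A H (baseHom k A H a * targetMap ρ b * x) = a * smashCounit k A H x * b
    rw [mul_assoc, smashCounit_baseHom_mul, smashCounit_targetMap_mul hρ, mul_assoc]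
  coassoc x z hz := scalarExtension_coassoc hρ hz
  counit_comul_fst x z hz := scalarExtension_counit_comul_fst hρ hz
  counit_comul_snd x z hz := scalarExtension_counit_comul_snd hρ hz
  takeuchi a x z hz :=
    (mkQ_balRel_mul_right hz.symm _).trans
      ((mkQ_comulRep_mul_targetMap hρ x a).trans (mkQ_balRel_mul_right hz _))
  comul_one := congrArg _ comulRep_one
  comul_mul x y z w hz hw := by
    refine Eq.trans ?_ (mkQ_balRel_mul_right hz w)
    refine (congrArg _ (comulRep_mul x y)).trans ?_
    -- By the Takeuchi condition, left multiplication by the lift of Δ(x) respects the balancing, so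
    -- the standard lift of Δ(y) may be exchanged for w.
    refine map_eq_of_mkQ_balRel_eq (φ := (scalarExtension k A H ρ).cls ∘ₗ
      LinearMap.mulLeft k (comulRep k A H x)) (fun a p q => ?_) hw
    have h := mkQ_balRel_mul_right (mkQ_comulRep_mul_targetMap hρ x a) (p ⊗ₜ q)
    simp only [mul_assoc, Algebra.TensorProduct.tmul_mul_tmul, one_mul] at h
    exact h
  counit_one := by
    have h := smashCounit_inclHom (k := k) (A := A) (1 : H)
    rw [map_one, Bialgebra.counit_one, one_smul] at h
    exact h
  counit_mul_source x y := by
    change smashCounit k A H (x * y) =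
      smashCounit k A H (x * baseHom k A H (smashCounit k A H y))
    induction y using smash_induction with
    | zero => simp
    | add y z hy hz => simp only [mul_add, map_add, hy, hz]
    | mul b h =>
      rw [← mul_assoc, smashCounit_mul_inclHom, smashCounit_baseHom_mul_inclHom]
      simp
  counit_mul_target x y := by
    change smashCounit k A H (x * y) =
      smashCounit k A H (x * targetMap ρ (smashCounit k A H y))
    -- On the right of any x, ε does not distinguish s(b) from t(b): for x = h both values are h ▹
    -- b.
    have key : ∀ b, smashCounit k A H (x * baseHom k A H b) =
        smashCounit k A H (x * targetMap ρ b) := by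
      intro b
      induction x using smash_induction with
      | zero => simp
      | add x z hx hz => simp only [add_mul, map_add, hx, hz]
      | mul a l =>
        rw [mul_assoc, mul_assoc, smashCounit_baseHom_mul, smashCounit_baseHom_mul,
          smashCounit_inclHom_mul_baseHom,
          smashCounit_inclHom_mul_targetMap hρ.toIsYetterDrinfeld]
    induction y using smash_induction with
    | zero => simp
    | add y z hy hz => simp only [mul_add, map_add, hy, hz]
    | mul b h =>
      rw [← mul_assoc, smashCounit_mul_inclHom, smashCounit_baseHom_mul_inclHom, key]
      simp

end ScalarExtensionAxioms

/-! ## The twisted source and target, and the map `ζ` -/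

namespace DrinfeldTwist

variable {k A H : Type*} [Field k] [Ring H] [Bialgebra k H] (F : DrinfeldTwist k H)

theorem inv_mul_elt : F.inv * F.elt = 1 := Units.inv_mul _

theorem elt_mul_inv : F.elt * F.inv = 1 := Units.mul_inv _

theorem inv_mul_comulTw (h : H) : F.inv * F.comulTw h = Coalgebra.comul h * F.inv := by
  rw [comulTw_apply, ← mul_assoc, inv_mul_elt, one_mul]

theorem comulFst_tmul_mul_assoc (p q r : H) (w : H ⊗[k] H) :
    comulFst k H (p ⊗ₜ q) * TensorProduct.assoc k H H H (w ⊗ₜ r) =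
      TensorProduct.assoc k H H H ((Coalgebra.comul p * w) ⊗ₜ (q * r)) := by
  change Algebra.TensorProduct.assoc k k k H H H (Coalgebra.comul p ⊗ₜ q) *
    Algebra.TensorProduct.assoc k k k H H H (w ⊗ₜ r) = _
  rw [← map_mul, Algebra.TensorProduct.tmul_mul_tmul]
  rfl

theorem leg12_apply (w : H ⊗[k] H) :
    leg12 k H w = TensorProduct.assoc k H H H (w ⊗ₜ 1) := rfl

theorem comulFst_tmul_mul_leg12 (p q : H) (w : H ⊗[k] H) :
    comulFst k H (p ⊗ₜ q) * leg12 k H w =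
      TensorProduct.assoc k H H H ((Coalgebra.comul p * w) ⊗ₜ q) := by
  rw [leg12_apply, comulFst_tmul_mul_assoc, mul_one]

theorem comulSnd_tmul_mul_leg23 (p q : H) (w : H ⊗[k] H) :
    comulSnd k H (p ⊗ₜ q) * leg23 k H w = p ⊗ₜ (Coalgebra.comul q * w) := by
  simp [comulSnd, leg23]

/-- The cocycle identity with F ⊗ 1 and (id ⊗ Δ)F moved to the opposite sides. This mixed form
appears whenever F is multiplied onto Δ(s^𝒢(a)) or Δ(t^𝒢(a)). -/
theorem comulFst_elt_mul_comulSnd_inv :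
    comulFst k H F.elt * comulSnd k H F.inv = leg12 k H F.inv * leg23 k H F.elt := by
  have h1 : leg12 k H F.inv * leg12 k H F.elt = 1 := by rw [← map_mul, inv_mul_elt, map_one]
  have h2 : comulSnd k H F.elt * comulSnd k H F.inv = 1 := by
    rw [← map_mul, elt_mul_inv, map_one]
  calc comulFst k H F.elt * comulSnd k H F.inv
      = leg12 k H F.inv * (leg12 k H F.elt * comulFst k H F.elt) * comulSnd k H F.inv := by
        rw [← mul_assoc, h1, one_mul]
    _ = leg12 k H F.inv * leg23 k H F.elt * (comulSnd k H F.elt * comulSnd k H F.inv) := by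
        rw [← F.cocycle]; simp only [mul_assoc]
    _ = _ := by rw [h2, mul_one]

variable [Ring A] [Algebra k A] [Module H A] [IsScalarTower k H A] [IsModuleAlgebra k H A]

variable (A) in
/-- `a ↦ (F̄¹ ▹ a) ♯ F̄²`. -/
def twSource : A →ₗ[k] Smash k A H where
  toFun a := actIncl (baseHom k A H).toLinearMap a F.inv
  map_add' a b := by simp [actIncl, LinearMap.comp_add, TensorProduct.map_add_left]
  map_smul' c a := by simp [actIncl, LinearMap.comp_smul, TensorProduct.map_smul_left]

/-- `a ↦ t(F̄² ▹ a)(1 ♯ F̄¹)`. -/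
def twTarget (ρ : A →ₗ[k] A ⊗[k] H) : A →ₗ[k] Smash k A H where
  toFun a := coactIncl (targetMap ρ) a F.inv
  map_add' a b := by simp [coactIncl, actIncl, LinearMap.comp_add, TensorProduct.map_add_left]
  map_smul' c a := by
    simp [coactIncl, actIncl, LinearMap.comp_smul, TensorProduct.map_smul_left]

theorem twSource_apply (a : A) :
    F.twSource A a = actIncl (baseHom k A H).toLinearMap a F.inv := rfl

theorem twTarget_apply (ρ : A →ₗ[k] A ⊗[k] H) (a : A) :
    F.twTarget ρ a = coactIncl (targetMap ρ) a F.inv := rfl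

/-- Replacing s by s^𝒢 amounts to inserting F⁻¹ on the left of the H ⊗ H argument; the next lemma is
the same for t. -/
theorem actIncl_twSource (a : A) (z : H ⊗[k] H) :
    actIncl (F.twSource A) a z = actIncl (baseHom k A H).toLinearMap a (F.inv * z) := by
  induction z with
  | zero => simp
  | add u v hu hv => simp only [map_add, mul_add, hu, hv]
  | tmul p q =>
    rw [actIncl_tmul, twSource_apply, actIncl_smul, actIncl_mul_inclHom, mul_assoc]
    simp

theorem coactIncl_twTarget (ρ : A →ₗ[k] A ⊗[k] H) (a : A) (z : H ⊗[k] H) :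
    coactIncl (F.twTarget ρ) a z = coactIncl (targetMap ρ) a (F.inv * z) := by
  induction z with
  | zero => simp
  | add u v hu hv => simp only [map_add, mul_add, hu, hv]
  | tmul p q =>
    rw [coactIncl_tmul, twTarget_apply, coactIncl_smul, coactIncl_mul_inclHom, mul_assoc]
    simp

/-- Moving h to the right produces Δ(h)F⁻¹ = F⁻¹ · FΔ(h)F⁻¹, and the leading F⁻¹ rebuilds s^𝒢. -/
theorem inclHom_mul_twSource (h : H) (a : A) : inclHom k A H h * F.twSource A a =
    actIncl (F.twSource A) a (F.comulTw h) := by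
  rw [actIncl_twSource, twSource_apply, inclHom_mul_actIncl (f := (baseHom k A H).toLinearMap)
    inclHom_mul_baseHom, inv_mul_comulTw]

/-- With X(x ⊗ y ⊗ z) = (x ▹ a)(y ▹ b) ♯ z, the left side is X of (id ⊗ Δ)F⁻¹ · (1 ⊗ F⁻¹) and the
right side is X of (Δ ⊗ id)F⁻¹ · (F⁻¹ ⊗ 1). These agree by the cocycle identity for F⁻¹. -/
theorem twSource_mul_twSource (a b : A) :
    F.twSource A a * F.twSource A b = F.twSource A (mulAct k H A F.inv a b) := by
  let X : H ⊗[k] (H ⊗[k] H) →ₗ[k] Smash k A H := (toSmash k A H).toLinearMap ∘ₗ actMul₃ a b 1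
  have h1 : ∀ z w : H ⊗[k] H, actIncl (baseHom k A H).toLinearMap a z *
      actIncl (baseHom k A H).toLinearMap b w = X (comulSnd k H z * leg23 k H w) := by
    intro z w
    induction z with
    | zero => simp
    | add u v hu hv => simp only [map_add, add_mul, hu, hv]
    | tmul p q =>
      rw [comulSnd_tmul_mul_leg23, actIncl_tmul, mul_assoc,
        inclHom_mul_actIncl (f := (baseHom k A H).toLinearMap) inclHom_mul_baseHom]
      simp only [X, LinearMap.comp_apply, actMul₃_tmul, LinearEquiv.coe_coe,
        ← toSmash_mul_tmul_one, toSmash_actMul, map_one, mul_one]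
      rfl
  have h2 : ∀ z w : H ⊗[k] H, actIncl (baseHom k A H).toLinearMap (mulAct k H A w a b) z =
      X (comulFst k H z * leg12 k H w) := by
    intro z w
    induction z with
    | zero => simp
    | add u v hu hv => simp only [map_add, add_mul, hu, hv]
    | tmul p q =>
      have h : comulFst k H (p ⊗ₜ q) * leg12 k H w =
          TensorProduct.assoc k H H H ((Coalgebra.comul p * w) ⊗ₜ q) := by
        change Algebra.TensorProduct.assoc k k k H H H (Coalgebra.comul p ⊗ₜ q) *
          Algebra.TensorProduct.assoc k k k H H H (w ⊗ₜ 1) = _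
        rw [← map_mul, Algebra.TensorProduct.tmul_mul_tmul, mul_one]
        rfl
      simp only [comulFst_tmul_mul_leg12, X, LinearMap.comp_apply, actMul₃_assoc_tmul, mulAct_mul,
        LinearEquiv.coe_coe, ← baseHom_mul_inclHom, mul_one, actIncl_tmul]
      rfl
  rw [twSource_apply, twSource_apply, twSource_apply, h1, h2, cocycle_inv]

/-- Only the first leg has to cross s, so z enters through Δ ⊗ id. -/
theorem inclHom₂_mul_actIncl₂ (z : H ⊗[k] H) (a : A) (u : H ⊗[k] (H ⊗[k] H)) :
    inclHom₂ k A H z * actIncl₂ (baseHom k A H).toLinearMap a u =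
      actIncl₂ (baseHom k A H).toLinearMap a (comulFst k H z * u) := by
  obtain ⟨u, rfl⟩ := (TensorProduct.assoc k H H H).surjective u
  induction u with
  | zero => simp
  | add u v hu hv => simp only [map_add, mul_add, hu, hv]
  | tmul w r =>
    induction z with
    | zero => simp
    | add u v hu hv => simp only [map_add, add_mul, hu, hv]
    | tmul p q =>
      rw [comulFst_tmul_mul_assoc, actIncl₂_assoc_tmul, actIncl₂_assoc_tmul, inclHom₂_tmul,
        Algebra.TensorProduct.tmul_mul_tmul,
        inclHom_mul_actIncl (f := (baseHom k A H).toLinearMap) inclHom_mul_baseHom,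
        map_mul (inclHom k A H)]

theorem leg12_mul_leg23_tmul (w : H ⊗[k] H) (p q : H) : leg12 k H w * leg23 k H (p ⊗ₜ q) =
    TensorProduct.assoc k H H H ((w * (1 ⊗ₜ p)) ⊗ₜ q) := by
  change Algebra.TensorProduct.assoc k k k H H H (w ⊗ₜ 1) *
    Algebra.TensorProduct.assoc k k k H H H ((1 ⊗ₜ p) ⊗ₜ q) = _
  rw [← map_mul, Algebra.TensorProduct.tmul_mul_tmul, one_mul]
  rfl

/-- `F Δ(s^𝒢(a)) = (s^𝒢(a) ⊗ 1) F` in `(A ♯ H) ⊗ (A ♯ H)`. -/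
theorem inclHom₂_elt_mul_comulRep_twSource (a : A) :
    inclHom₂ k A H F.elt * comulRep k A H (F.twSource A a) =
      (F.twSource A a ⊗ₜ 1) * inclHom₂ k A H F.elt := by
  -- The lift of Δ(s^𝒢(a)) contributes (id ⊗ Δ)F⁻¹ and the factor F contributes (Δ ⊗ id)F. Their
  -- product (F⁻¹ ⊗ 1)(1 ⊗ F) reads s^𝒢(a)F¹ ⊗ F².
  rw [twSource_apply, comulRep_actIncl, inclHom₂_mul_actIncl₂, comulFst_elt_mul_comulSnd_inv]
  generalize F.elt = z
  induction z with
  | zero => simp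
  | add u v hu hv => simp only [map_add, mul_add, hu, hv]
  | tmul p q =>
    rw [leg12_mul_leg23_tmul, actIncl₂_assoc_tmul, inclHom₂_tmul,
      Algebra.TensorProduct.tmul_mul_tmul, actIncl_mul_inclHom, one_mul]

/-- On generators ζ fixes H and replaces the source by s^𝒢, which is how ζ is used from here on. -/
theorem zeta_baseHom_mul_inclHom (a : A) (h : H) :
    F.zeta A (baseHom k (F.TwAlg A) F.TwBialg (F.toTwAlg A a) *
      inclHom k (F.TwAlg A) F.TwBialg (F.toTwBialg h)) =
      F.twSource A a * inclHom k A H h := by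
  rw [baseHom_mul_inclHom, twSource_apply, ← toSmash_actMul]
  rfl

theorem twSource_one : F.twSource A 1 = 1 := by
  have h : F.twSource A 1 = toSmash k A H (actMul k H A F.inv (1 ⊗ₜ 1)) := by
    rw [toSmash_actMul, map_one (inclHom k A H), mul_one, twSource_apply]
  rw [h, actMul_tmul_one_mul, counit_fst_inv, mul_one, toSmash_one]

theorem zeta_one : F.zeta A 1 = 1 := by
  have h := F.zeta_baseHom_mul_inclHom (1 : A) 1
  simpa only [toTwAlg_one, twSource_one, map_one, mul_one] using h

@[elab_as_elim]
theorem twSmash_induction {P : Smash k (F.TwAlg A) F.TwBialg → Prop}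
    (x : Smash k (F.TwAlg A) F.TwBialg) (zero : P 0)
    (add : ∀ x y, P x → P y → P (x + y))
    (mul : ∀ (a : A) (h : H), P (baseHom k (F.TwAlg A) F.TwBialg (F.toTwAlg A a) *
      inclHom k (F.TwAlg A) F.TwBialg (F.toTwBialg h))) : P x := by
  induction x using smash_induction with
  | zero => exact zero
  | add x y hx hy => exact add x y hx hy
  | mul a h =>
    obtain ⟨a, rfl⟩ := (F.toTwAlg A).surjective a
    obtain ⟨h, rfl⟩ := F.toTwBialg.surjective h
    exact mul a h

/-- In both algebras h moves past the source by the same rule with the coproduct FΔ(h)F⁻¹, and s^𝒢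
is multiplicative for the product of A_F. -/
theorem zeta_mul (x y : Smash k (F.TwAlg A) F.TwBialg) :
    F.zeta A (x * y) = F.zeta A x * F.zeta A y := by
  induction x using twSmash_induction with
  | zero => simp
  | add x x' hx hx' => simp only [add_mul, map_add, hx, hx']
  | mul a h =>
    induction y using twSmash_induction with
    | zero => simp
    | add y y' hy hy' => simp only [mul_add, map_add, hy, hy']
    | mul b l =>
      -- Once h has been moved, only products s(a)s(x ▹ b)yl remain; w stands for the twisted
      -- coproduct of h.
      have key : ∀ w : H ⊗[k] H, F.zeta A (baseHom k (F.TwAlg A) F.TwBialg (F.toTwAlg A a) *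
          (actIncl (baseHom k (F.TwAlg A) F.TwBialg).toLinearMap (F.toTwAlg A b)
            (TensorProduct.map F.toTwBialg.toLinearMap F.toTwBialg.toLinearMap w) *
            inclHom k (F.TwAlg A) F.TwBialg (F.toTwBialg l))) =
          F.twSource A a * (actIncl (F.twSource A) b w * inclHom k A H l) := by
        intro w
        induction w with
        | zero => simp
        | add u v hu hv => simp only [map_add, mul_add, add_mul, hu, hv]
        | tmul p q =>
          simp only [TensorProduct.map_tmul, actIncl_tmul, AlgEquiv.toLinearMap_apply,
            AlgHom.toLinearMap_apply, toTwAlg_smul]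
          rw [mul_assoc, ← map_mul, ← map_mul, ← mul_assoc, ← map_mul, toTwAlg_mul,
            zeta_baseHom_mul_inclHom, ← twSource_mul_twSource, map_mul]
          simp only [mul_assoc]
      rw [zeta_baseHom_mul_inclHom, zeta_baseHom_mul_inclHom]
      have h1 := inclHom_mul_baseHom (k := k) (F.toTwBialg h) (F.toTwAlg A b)
      have h2 := F.inclHom_mul_twSource h b
      rw [comul_toTwBialg] at h1
      calc _ = F.zeta A (baseHom k (F.TwAlg A) F.TwBialg (F.toTwAlg A a) *
          (actIncl (baseHom k (F.TwAlg A) F.TwBialg).toLinearMap (F.toTwAlg A b)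
            (TensorProduct.map F.toTwBialg.toLinearMap F.toTwBialg.toLinearMap (F.comulTw h)) *
            inclHom k (F.TwAlg A) F.TwBialg (F.toTwBialg l))) := by
            rw [← h1]; simp only [mul_assoc]
        _ = _ := by rw [key, ← h2]; simp only [mul_assoc]

theorem zeta_bijective : Function.Bijective (F.zeta A) := by
  have h1 : Function.Bijective (actMul k H A F.inv) := by
    refine Function.bijective_iff_has_inverse.2 ⟨actMul k H A F.elt, fun x => ?_, fun x => ?_⟩
    · rw [← actMul_mul, elt_mul_inv, actMul_one]
    · rw [← actMul_mul, inv_mul_elt, actMul_one]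
  have h2 : Function.Bijective (TensorProduct.map (F.toTwAlg A).symm.toLinearMap
      F.toTwBialg.symm.toLinearMap) :=
    (TensorProduct.congr (F.toTwAlg A).symm F.toTwBialg.symm.toLinearEquiv).bijective
  exact (toSmash k A H).bijective.comp
    (h1.comp (h2.comp (toSmash k (F.TwAlg A) F.TwBialg).symm.bijective))

variable (A) in
/-- `ζ` as an isomorphism of algebras. -/
def zetaEquiv : Smash k (F.TwAlg A) F.TwBialg ≃ₐ[k] Smash k A H :=
  AlgEquiv.ofBijective (AlgHom.ofLinearMap (F.zeta A) F.zeta_one F.zeta_mul) F.zeta_bijective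

theorem zetaEquiv_baseHom (a : A) :
    F.zetaEquiv A (baseHom k (F.TwAlg A) F.TwBialg (F.toTwAlg A a)) = F.twSource A a := by
  have h := F.zeta_baseHom_mul_inclHom a 1
  rw [map_one, map_one, map_one, mul_one, mul_one] at h
  exact h

theorem zetaEquiv_inclHom (h : H) :
    F.zetaEquiv A (inclHom k (F.TwAlg A) F.TwBialg (F.toTwBialg h)) = inclHom k A H h := by
  have key := F.zeta_baseHom_mul_inclHom (1 : A) h
  rw [toTwAlg_one, map_one, twSource_one, one_mul, one_mul] at key
  exact key

/-- The F⁻¹ in ζ cancels the outer F in ρ^F, leaving t(F̄² ▹ a)F̄¹. -/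
theorem zetaEquiv_targetMap (ρ : A →ₗ[k] A ⊗[k] H) (a : A) :
    F.zetaEquiv A (targetMap (F.twCoact ρ) (F.toTwAlg A a)) = F.twTarget ρ a := by
  have h : F.zetaEquiv A (targetMap (F.twCoact ρ) (F.toTwAlg A a)) = toSmash k A H
      (actMul k H A F.inv ((TensorProduct.map (F.toTwAlg A).symm.toLinearMap
        F.toTwBialg.symm.toLinearMap)
        (TensorProduct.map (F.toTwAlg A).toLinearMap F.toTwBialg.toLinearMap
      (actMul k H A F.elt (coactFlip k H A ρ a F.inv))))) := rfl
  have h2 : ∀ u : A ⊗[k] H, (TensorProduct.map (F.toTwAlg A).symm.toLinearMap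
        F.toTwBialg.symm.toLinearMap)
        (TensorProduct.map (F.toTwAlg A).toLinearMap F.toTwBialg.toLinearMap u) = u :=
    (TensorProduct.congr (F.toTwAlg A) F.toTwBialg.toLinearEquiv).symm_apply_apply
  rw [h, h2, ← actMul_mul, inv_mul_elt, actMul_one, toSmash_coactFlip, twTarget_apply]

variable (A) in
/-- `ζ ⊗ ζ`. -/
def zetaEquiv₂ : Smash k (F.TwAlg A) F.TwBialg ⊗[k] Smash k (F.TwAlg A) F.TwBialg ≃ₐ[k]
    Smash k A H ⊗[k] Smash k A H :=
  Algebra.TensorProduct.congr (F.zetaEquiv A) (F.zetaEquiv A)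

@[simp] theorem zetaEquiv₂_tmul (x y : Smash k (F.TwAlg A) F.TwBialg) :
    F.zetaEquiv₂ A (x ⊗ₜ y) = F.zetaEquiv A x ⊗ₜ F.zetaEquiv A y := rfl

theorem zetaEquiv₂_inclHom₂ (w : H ⊗[k] H) :
    F.zetaEquiv₂ A (inclHom₂ k (F.TwAlg A) F.TwBialg
      (TensorProduct.map F.toTwBialg.toLinearMap F.toTwBialg.toLinearMap w)) =
      inclHom₂ k A H w := by
  induction w with
  | zero => simp
  | add u v hu hv => simp only [map_add, hu, hv]
  | tmul p q => simp [zetaEquiv_inclHom]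

/-- `(ζ ⊗ ζ)Δ(x) = F Δ(ζ(x)) F⁻¹`. -/
theorem zetaEquiv₂_comulRep (x : Smash k (F.TwAlg A) F.TwBialg) :
    F.zetaEquiv₂ A (comulRep k (F.TwAlg A) F.TwBialg x) =
      inclHom₂ k A H F.elt * comulRep k A H (F.zetaEquiv A x) * inclHom₂ k A H F.inv := by
  induction x using twSmash_induction with
  | zero => simp
  | add x y hx hy => simp only [map_add, mul_add, add_mul, hx, hy]
  | mul a h =>
    rw [comulRep_baseHom_mul_inclHom, map_mul, comul_toTwBialg, zetaEquiv₂_inclHom₂, map_mul,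
      zetaEquiv_baseHom, zetaEquiv_inclHom, comulRep_mul_inclHom, ← mul_assoc,
      inclHom₂_elt_mul_comulRep_twSource, zetaEquiv₂_tmul, zetaEquiv_baseHom, map_one,
      comulTw_apply, map_mul, map_mul]
    simp only [mul_assoc]

theorem smashCounit_twSource (a : A) : smashCounit k A H (F.twSource A a) = a := by
  rw [twSource_apply, smashCounit_actIncl _ smashCounit_baseHom, counit_snd_inv, one_smul]

theorem smashCounit_zetaEquiv (x : Smash k (F.TwAlg A) F.TwBialg) :
    smashCounit k A H (F.zetaEquiv A x) =
      (F.toTwAlg A).symm (smashCounit k (F.TwAlg A) F.TwBialg x) := by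
  induction x using twSmash_induction with
  | zero => simp
  | add x y hx hy => simp only [map_add, hx, hy]
  | mul a h =>
    rw [map_mul, zetaEquiv_baseHom, zetaEquiv_inclHom, smashCounit_mul_inclHom,
      smashCounit_twSource, smashCounit_baseHom_mul_inclHom, counit_toTwBialg, map_smul,
      LinearEquiv.symm_apply_apply]

end DrinfeldTwist

/-! ## `A_F` is a braided commutative Yetter–Drinfeld module algebra -/

section Criteria

variable {k A H : Type*} [Field k] [Ring H] [Bialgebra k H] [Ring A] [Algebra k A]
  [Module H A] [IsScalarTower k H A] [IsModuleAlgebra k H A]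

variable (k A H) in
theorem inclHom_injective [Nontrivial A] : Function.Injective (inclHom k A H) :=
  (toSmash k A H).injective.comp
    (Algebra.TensorProduct.includeRight_injective (R := k) (A := A) (B := H)
      (algebraMap k A).injective)

/-- The coaction is coassociative if `Δ(t(a)) = t(a₍₀₎) ⊗ a₍₁₎` in `(A ♯ H) ⊗ (A ♯ H)`. -/
theorem coassoc_of_comulRep {ρ : A →ₗ[k] A ⊗[k] H} (a : A)
    (h : comulRep k A H (targetMap ρ a) =
      TensorProduct.map (targetMap ρ) (inclHom k A H).toLinearMap (ρ a)) :
    TensorProduct.assoc k A H H (ρ.rTensor H (ρ a)) =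
      (Coalgebra.comul (R := k) (A := H)).lTensor A (ρ a) := by
  -- Injectivity of h ↦ 1 ♯ h needs A ≠ 0; for A = 0 both sides lie in a zero space.
  cases subsingleton_or_nontrivial A with
  | inl _ =>
    have : ∀ v : A ⊗[k] (H ⊗[k] H), v = 0 := fun v => by
      induction v with
      | zero => rfl
      | add u v hu hv => rw [hu, hv, add_zero]
      | tmul c l => rw [Subsingleton.elim c 0, TensorProduct.zero_tmul]
    rw [this (TensorProduct.assoc _ _ _ _ _), this (LinearMap.lTensor _ _ _)]
  | inr _ =>
    have h1 : Function.Injective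
        (TensorProduct.map (toSmash k A H).toLinearMap (inclHom k A H).toLinearMap) :=
      TensorProduct.map_injective_of_flat_flat _ _ (toSmash k A H).injective
        (inclHom_injective k A H)
    refine (TensorProduct.assoc k A H H).symm.injective (h1 ?_)
    rw [LinearEquiv.symm_apply_apply, ← comulRep_toSmash, ← targetMap_apply, h]
    generalize ρ a = u
    induction u with
    | zero => simp
    | add u v hu hv => simp only [map_add, hu, hv]
    | tmul c l => rfl

/-- For u = ρ(b) this makes braided commutativity the equation ε(t(b)s(a)) = ab, which can be
checked through ζ. -/
theorem smashCounit_toSmash_mul_baseHom (u : A ⊗[k] H) (a : A) :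
    smashCounit k A H (toSmash k A H u * baseHom k A H a) =
      LinearMap.mul' k A (((act k H A).flip a).lTensor A u) := by
  induction u with
  | zero => simp
  | add u v hu hv => simp only [map_add, add_mul, hu, hv]
  | tmul c l =>
    rw [← baseHom_mul_inclHom, mul_assoc, smashCounit_baseHom_mul,
      smashCounit_inclHom_mul_baseHom]
    rfl

end Criteria

/-! ### The Yetter–Drinfeld condition with an extra factor in H ⊗ H -/

section CoactFlip

variable {k A H : Type*} [Field k] [Ring H] [Bialgebra k H] [Ring A] [Algebra k A]
  [Module H A] [IsScalarTower k H A] {ρ : A →ₗ[k] A ⊗[k] H}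

theorem coactFlip_tmul (a : A) (x y : H) : coactFlip k H A ρ a (x ⊗ₜ y) =
    (LinearMap.mulRight k x).lTensor A (ρ (y • a)) := by
  simp only [coactFlip, LinearMap.comp_apply, LinearEquiv.coe_coe, TensorProduct.comm_tmul,
    TensorProduct.map_tmul, LinearMap.flip_apply, act_apply, LinearMap.id_apply]
  generalize ρ (y • a) = u
  induction u with
  | zero => simp
  | add u v hu hv => simp only [map_add, TensorProduct.add_tmul, hu, hv]
  | tmul b h => simp

theorem coactFlip_mul_tmul (a : A) (w : H ⊗[k] H) (r s : H) :
    coactFlip k H A ρ a (w * (r ⊗ₜ s)) =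
      (LinearMap.mulRight k r).lTensor A (coactFlip k H A ρ (s • a) w) := by
  induction w with
  | zero => simp
  | add u v hu hv => simp only [map_add, add_mul, hu, hv]
  | tmul x y =>
    rw [Algebra.TensorProduct.tmul_mul_tmul, coactFlip_tmul, coactFlip_tmul, mul_smul,
      ← LinearMap.lTensor_comp_apply, LinearMap.mulRight_mul]

theorem actMul_mulRight (z : H ⊗[k] H) (r : H) (u : A ⊗[k] H) :
    actMul k H A z ((LinearMap.mulRight k r).lTensor A u) =
      (LinearMap.mulRight k r).lTensor A (actMul k H A z u) := by
  induction z with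
  | zero => simp
  | add u v hu hv => simp only [map_add, LinearMap.add_apply, hu, hv]
  | tmul p q =>
    induction u with
    | zero => simp
    | add u v hu hv => simp only [map_add, hu, hv]
    | tmul c l => simp [mul_assoc]

/-- A right factor r ⊗ s replaces a by s ▹ a and multiplies by r on the right. The latter commutes
with the left action, so the defining condition extends from Δ(h) to Δ(h)w. -/
theorem IsYetterDrinfeld.coactFlip_comul_mul (hρ : IsYetterDrinfeld k H A ρ) (h : H) (a : A)
    (w : H ⊗[k] H) : coactFlip k H A ρ a (Coalgebra.comul h * w) =
      actMul k H A (Coalgebra.comul h) (coactFlip k H A ρ a w) := by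
  induction w with
  | zero => simp
  | add u v hu hv => simp only [map_add, mul_add, hu, hv]
  | tmul r s => rw [coactFlip_mul_tmul, ← hρ.compat, coactFlip_tmul, actMul_mulRight]

end CoactFlip

/-! ### The twisted target map and the axioms of A_F -/

namespace DrinfeldTwist

variable {k A H : Type*} [Field k] [Ring H] [Bialgebra k H] (F : DrinfeldTwist k H)
  [Ring A] [Algebra k A] [Module H A] [IsScalarTower k H A] [IsModuleAlgebra k H A]

/-- `x ⊗ w ↦ t(b)(1 ♯ x) ⊗ (1 ♯ l)`, summed over the components `b ⊗ l` of `w ▹ u`. -/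
def targetIncl (ρ : A →ₗ[k] A ⊗[k] H) (u : A ⊗[k] H) :
    H ⊗[k] (H ⊗[k] H) →ₗ[k] Smash k A H ⊗[k] Smash k A H :=
  LinearMap.mul' k _ ∘ₗ (TensorProduct.comm k _ _).toLinearMap ∘ₗ
    TensorProduct.map
      ((Algebra.TensorProduct.includeLeft (R := k) (S := k) (A := Smash k A H)
        (B := Smash k A H)).toLinearMap ∘ₗ (inclHom k A H).toLinearMap)
      (TensorProduct.map (targetMap ρ) (inclHom k A H).toLinearMap ∘ₗ (actMul k H A).flip u)

theorem targetIncl_tmul (ρ : A →ₗ[k] A ⊗[k] H) (u : A ⊗[k] H) (x : H) (w : H ⊗[k] H) :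
    targetIncl ρ u (x ⊗ₜ w) =
      TensorProduct.map (targetMap ρ) (inclHom k A H).toLinearMap (actMul k H A w u) *
        (inclHom k A H x ⊗ₜ 1) := rfl

theorem targetIncl_actMul (ρ : A →ₗ[k] A ⊗[k] H) (u : A ⊗[k] H) (z : H ⊗[k] H)
    (v : H ⊗[k] (H ⊗[k] H)) :
    targetIncl ρ (actMul k H A z u) v = targetIncl ρ u (v * leg23 k H z) := by
  induction v with
  | zero => simp
  | add u v hu hv => simp only [map_add, add_mul, hu, hv]
  | tmul x w =>
    have h : (x ⊗ₜ[k] w) * leg23 k H z = x ⊗ₜ (w * z) := by simp [leg23]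
    rw [h, targetIncl_tmul, targetIncl_tmul, actMul_mul]

theorem targetIncl_assoc (ρ : A →ₗ[k] A ⊗[k] H) (b : A) (l r : H) (w : H ⊗[k] H) :
    targetIncl ρ (b ⊗ₜ l) (TensorProduct.assoc k H H H (w ⊗ₜ r)) =
      coactIncl (targetMap ρ) b w ⊗ₜ inclHom k A H (r * l) := by
  induction w with
  | zero => simp
  | add u v hu hv => simp only [map_add, TensorProduct.add_tmul, hu, hv]
  | tmul x y => simp [targetIncl_tmul]

variable {ρ : A →ₗ[k] A ⊗[k] H}

theorem map_twTarget (u : A ⊗[k] H) :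
    TensorProduct.map (F.twTarget ρ) (inclHom k A H).toLinearMap u =
      targetIncl ρ u (leg12 k H F.inv) := by
  induction u with
  | zero => simp [targetIncl]
  | add u v hu hv => simp only [map_add, hu, hv, targetIncl, LinearMap.comp_add,
      TensorProduct.map_add_right, LinearMap.add_apply]
  | tmul b l =>
    rw [leg12_apply, targetIncl_assoc, one_mul]
    rfl

theorem smashCounit_twTarget (hρ : IsYetterDrinfeld k H A ρ) (a : A) :
    smashCounit k A H (F.twTarget ρ a) = a := by
  rw [twTarget_apply, smashCounit_coactIncl _ (smashCounit_targetMap hρ.counit),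
    counit_fst_inv, one_smul]

theorem zetaEquiv_coactIncl (a : A) (w : H ⊗[k] H) :
    F.zetaEquiv A (coactIncl (targetMap (F.twCoact ρ)) (F.toTwAlg A a)
      (TensorProduct.map F.toTwBialg.toLinearMap F.toTwBialg.toLinearMap w)) =
      coactIncl (F.twTarget ρ) a w := by
  induction w with
  | zero => simp
  | add u v hu hv => simp only [map_add, hu, hv]
  | tmul x y => simp [toTwAlg_smul, zetaEquiv_targetMap, zetaEquiv_inclHom]

variable (hρ : IsBraidedCommYDAlgebra k H A ρ)
include hρ

/-- The counterpart of `inclHom₂_mul_actIncl₂` for the target: the first leg crosses t by the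
Yetter–Drinfeld relation. -/
theorem inclHom₂_mul_targetIncl (z : H ⊗[k] H) (u : A ⊗[k] H) (v : H ⊗[k] (H ⊗[k] H)) :
    inclHom₂ k A H z * targetIncl ρ u v = targetIncl ρ u (comulFst k H z * v) := by
  obtain ⟨v, rfl⟩ := (TensorProduct.assoc k H H H).surjective v
  induction v with
  | zero => simp
  | add u v hu hv => simp only [map_add, mul_add, hu, hv]
  | tmul w r =>
    induction z with
    | zero => simp
    | add u v hu hv => simp only [map_add, add_mul, hu, hv]
    | tmul p q =>
      rw [comulFst_tmul_mul_assoc]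
      induction u with
      | zero => simp [targetIncl]
      | add u v hu hv =>
        simp only [targetIncl, map_add, LinearMap.comp_add, TensorProduct.map_add_right,
          LinearMap.add_apply, mul_add] at hu hv ⊢
        rw [hu, hv]
      | tmul b l =>
        rw [targetIncl_assoc, targetIncl_assoc, inclHom₂_tmul,
          Algebra.TensorProduct.tmul_mul_tmul,
          inclHom_mul_coactIncl (f := targetMap ρ) hρ.inclHom_mul_targetMap, ← map_mul,
          mul_assoc]

/-- Coassociativity of ρ writes the left side as R of (Δ ⊗ id)F⁻¹ · (F⁻¹ ⊗ 1). The cocycle identity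
changes this to (id ⊗ Δ)F⁻¹ · (1 ⊗ F⁻¹), and the Yetter–Drinfeld condition turns the inner Δ into an
action on the flipped coaction. -/
theorem comulRep_twTarget_mul (a : A) :
    comulRep k A H (F.twTarget ρ a) * inclHom₂ k A H F.inv =
      targetIncl ρ (coactFlip k H A ρ a F.inv) (comulSnd k H F.inv) := by
  -- R sends x ⊗ y ⊗ z to t((z ▹ a)₍₀₎)x ⊗ (z ▹ a)₍₁₎y.
  let R : H ⊗[k] (H ⊗[k] H) →ₗ[k] Smash k A H ⊗[k] Smash k A H :=
    LinearMap.mul' k _ ∘ₗ (TensorProduct.comm k _ _).toLinearMap ∘ₗ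
    TensorProduct.map
      ((Algebra.TensorProduct.includeLeft (R := k) (S := k) (A := Smash k A H)
        (B := Smash k A H)).toLinearMap ∘ₗ (inclHom k A H).toLinearMap)
      (TensorProduct.map (targetMap ρ) (inclHom k A H).toLinearMap ∘ₗ coactFlip k H A ρ a)
  have hR : ∀ x w, R (x ⊗ₜ w) =
      TensorProduct.map (targetMap ρ) (inclHom k A H).toLinearMap (coactFlip k H A ρ a w) *
        (inclHom k A H x ⊗ₜ 1) := fun _ _ => rfl
  have hR' : ∀ (w : H ⊗[k] H) (y : H), R (TensorProduct.assoc k H H H (w ⊗ₜ y)) =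
      TensorProduct.map (targetMap ρ) (inclHom k A H).toLinearMap (ρ (y • a)) *
        inclHom₂ k A H w := by
    intro w y
    induction w with
    | zero => simp
    | add u v hu hv => simp only [map_add, TensorProduct.add_tmul, mul_add, hu, hv]
    | tmul p q =>
      rw [TensorProduct.assoc_tmul, hR, coactFlip_tmul]
      generalize ρ (y • a) = u
      induction u with
      | zero => simp
      | add u v hu hv => simp only [map_add, add_mul, hu, hv]
      | tmul c l => simp
  have h1 : ∀ w w' : H ⊗[k] H, comulRep k A H (coactIncl (targetMap ρ) a w) *
      inclHom₂ k A H w' = R (comulFst k H w * leg12 k H w') := by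
    intro w w'
    induction w with
    | zero => simp
    | add u v hu hv => simp only [map_add, add_mul, hu, hv]
    | tmul x y =>
      have h : comulFst k H (x ⊗ₜ y) * leg12 k H w' =
          TensorProduct.assoc k H H H ((Coalgebra.comul x * w') ⊗ₜ y) := by
        change Algebra.TensorProduct.assoc k k k H H H (Coalgebra.comul x ⊗ₜ y) *
          Algebra.TensorProduct.assoc k k k H H H (w' ⊗ₜ 1) = _
        rw [← map_mul, Algebra.TensorProduct.tmul_mul_tmul, mul_one]
        rfl
      rw [comulFst_tmul_mul_leg12, hR', coactIncl_tmul, comulRep_mul_inclHom,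
        comulRep_targetMap hρ.coassoc, map_mul, mul_assoc]
  have h2 : ∀ z w : H ⊗[k] H, R (comulSnd k H z * leg23 k H w) =
      targetIncl ρ (coactFlip k H A ρ a w) (comulSnd k H z) := by
    intro z w
    induction z with
    | zero => simp
    | add u v hu hv => simp only [map_add, add_mul, hu, hv]
    | tmul p q =>
      rw [comulSnd_tmul_mul_leg23, hR, hρ.coactFlip_comul_mul, comulSnd_tmul, targetIncl_tmul]
  rw [twTarget_apply, h1, ← cocycle_inv, h2]

/-- As for s^𝒢, now with X(x ⊗ y ⊗ z) = t((y ▹ a)(z ▹ b))x: crossing t flips the legs of Δ, and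
antimultiplicativity of t restores the order of a and b. -/
theorem twTarget_mul_twTarget (a b : A) :
    F.twTarget ρ b * F.twTarget ρ a = F.twTarget ρ (mulAct k H A F.inv a b) := by
  let X : H ⊗[k] (H ⊗[k] H) →ₗ[k] Smash k A H :=
    LinearMap.mul' k _ ∘ₗ (TensorProduct.comm k _ _).toLinearMap ∘ₗ
      TensorProduct.map (inclHom k A H).toLinearMap
        (targetMap ρ ∘ₗ LinearMap.mul' k A ∘ₗ
          TensorProduct.map ((act k H A).flip a) ((act k H A).flip b))
  have hX : ∀ x w, X (x ⊗ₜ w) = targetMap ρ (mulAct k H A w a b) * inclHom k A H x := by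
    intro x w
    have : mulAct k H A w a b = LinearMap.mul' k A
        (TensorProduct.map ((act k H A).flip a) ((act k H A).flip b) w) := by
      induction w with
      | zero => simp
      | add u v hu hv => simp only [map_add, LinearMap.add_apply, hu, hv]
      | tmul p q => rfl
    rw [this]
    rfl
  have h1 : ∀ z w : H ⊗[k] H, coactIncl (targetMap ρ) b z * coactIncl (targetMap ρ) a w =
      X (comulFst k H z * leg12 k H w) := by
    intro z w
    induction z with
    | zero => simp
    | add u v hu hv => simp only [map_add, add_mul, hu, hv]
    | tmul p q =>
      have h : comulFst k H (p ⊗ₜ q) * leg12 k H w =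
          TensorProduct.assoc k H H H ((Coalgebra.comul p * w) ⊗ₜ q) := by
        change Algebra.TensorProduct.assoc k k k H H H (Coalgebra.comul p ⊗ₜ q) *
          Algebra.TensorProduct.assoc k k k H H H (w ⊗ₜ 1) = _
        rw [← map_mul, Algebra.TensorProduct.tmul_mul_tmul, mul_one]
        rfl
      rw [comulFst_tmul_mul_leg12, coactIncl_tmul, mul_assoc,
        inclHom_mul_coactIncl (f := targetMap ρ) hρ.inclHom_mul_targetMap]
      generalize Coalgebra.comul (R := k) p * w = v
      induction v with
      | zero => simp
      | add u v hu hv => simp only [map_add, TensorProduct.add_tmul, mul_add, hu, hv]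
      | tmul x y =>
        rw [TensorProduct.assoc_tmul, hX, coactIncl_tmul, mulAct_tmul, hρ.targetMap_mul,
          mul_assoc]
  have h2 : ∀ z w : H ⊗[k] H, coactIncl (targetMap ρ) (mulAct k H A w a b) z =
      X (comulSnd k H z * leg23 k H w) := by
    intro z w
    induction z with
    | zero => simp
    | add u v hu hv => simp only [map_add, add_mul, hu, hv]
    | tmul p q =>
      rw [comulSnd_tmul_mul_leg23, hX, mulAct_mul, coactIncl_tmul]
  rw [twTarget_apply, twTarget_apply, twTarget_apply, h1, h2, cocycle_inv]

theorem inclHom_mul_twTarget (h : H) (a : A) : inclHom k A H h * F.twTarget ρ a =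
    coactIncl (F.twTarget ρ) a (F.comulTw h) := by
  rw [coactIncl_twTarget, twTarget_apply, inclHom_mul_coactIncl (f := targetMap ρ)
    hρ.inclHom_mul_targetMap, inv_mul_comulTw]

theorem twTarget_one : F.twTarget ρ 1 = 1 := by
  have h1 : ∀ w : H ⊗[k] H, coactIncl (targetMap ρ) 1 w = inclHom k A H
      (TensorProduct.rid k H (TensorProduct.map LinearMap.id Coalgebra.counit w)) := by
    intro w
    induction w with
    | zero => simp
    | add u v hu hv => simp only [map_add, hu, hv]
    | tmul x y =>
      rw [coactIncl_tmul, IsModuleAlgebra.smul_one (k := k), Algebra.algebraMap_eq_smul_one,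
        map_smul, targetMap_apply, hρ.coact_one, toSmash_one]
      simp
  rw [twTarget_apply, h1, counit_snd_inv, map_one]

/-- `ε(t^𝒢(b) s^𝒢(a)) = (F̄¹ ▹ a)(F̄² ▹ b)`. -/
theorem smashCounit_twTarget_mul_twSource (a b : A) :
    smashCounit k A H (F.twTarget ρ b * F.twSource A a) = mulAct k H A F.inv a b := by
  have h1 : smashCounit k A H (F.twTarget ρ b * F.twSource A a) =
      smashCounit k A H (F.twTarget ρ b * baseHom k A H a) := by
    -- Under ε the right factor s^𝒢(a) may be replaced by s(ε(s^𝒢(a))) = s(a).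
    refine ((scalarExtension_isLeftBialgebroid hρ).counit_mul_source _ _).trans ?_
    change smashCounit k A H (F.twTarget ρ b * baseHom k A H (smashCounit k A H _)) = _
    rw [smashCounit_twSource]
  rw [h1, twTarget_apply]
  generalize F.inv = w
  induction w with
  | zero => simp
  | add u v hu hv => simp only [map_add, add_mul, LinearMap.add_apply, hu, hv]
  | tmul x y =>
    rw [coactIncl_tmul, mul_assoc, smashCounit_targetMap_mul hρ,
      smashCounit_inclHom_mul_baseHom, mulAct_tmul]

/-- After ζ ⊗ ζ the left side is F Δ(t^𝒢(a)) F⁻¹, governed by (Δ ⊗ id)F · (id ⊗ Δ)F⁻¹ = (F⁻¹ ⊗ 1)(1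
⊗ F). On the right side F⁻¹ ⊗ 1 comes from t^𝒢 and 1 ⊗ F from the outer factor of ρ^F. -/
theorem comulRep_targetMap_twCoact (a : A) :
    comulRep k (F.TwAlg A) F.TwBialg (targetMap (F.twCoact ρ) (F.toTwAlg A a)) =
      TensorProduct.map (targetMap (F.twCoact ρ))
        (inclHom k (F.TwAlg A) F.TwBialg).toLinearMap (F.twCoact ρ (F.toTwAlg A a)) := by
  have h1 : F.twCoact ρ (F.toTwAlg A a) = TensorProduct.map (F.toTwAlg A).toLinearMap
      F.toTwBialg.toLinearMap (actMul k H A F.elt (coactFlip k H A ρ a F.inv)) := rfl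
  have h2 : ∀ u : A ⊗[k] H, F.zetaEquiv₂ A (TensorProduct.map (targetMap (F.twCoact ρ))
        (inclHom k (F.TwAlg A) F.TwBialg).toLinearMap (TensorProduct.map
          (F.toTwAlg A).toLinearMap F.toTwBialg.toLinearMap u)) =
      TensorProduct.map (F.twTarget ρ) (inclHom k A H).toLinearMap u := by
    intro u
    induction u with
    | zero => simp
    | add u v hu hv => simp only [map_add, hu, hv]
    | tmul b l => simp [zetaEquiv_targetMap, zetaEquiv_inclHom]
  apply (F.zetaEquiv₂ A).injective
  rw [zetaEquiv₂_comulRep, zetaEquiv_targetMap, mul_assoc, F.comulRep_twTarget_mul hρ,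
    inclHom₂_mul_targetIncl hρ, comulFst_elt_mul_comulSnd_inv, h1, h2, map_twTarget,
    targetIncl_actMul]

/-- `A_F` is a braided commutative Yetter–Drinfeld `H^F`-module algebra. -/
theorem isBraidedCommYDAlgebra_twCoact :
    IsBraidedCommYDAlgebra k F.TwBialg (F.TwAlg A) (F.twCoact ρ) := by
  -- Coassociativity and braided commutativity are settled beforehand, because `coact_mul_iff` for
  -- A_F depends on them.
  have hco : ∀ a : F.TwAlg A, TensorProduct.assoc k (F.TwAlg A) F.TwBialg F.TwBialg
      ((F.twCoact ρ).rTensor F.TwBialg (F.twCoact ρ a)) =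
      (Coalgebra.comul (R := k) (A := F.TwBialg)).lTensor (F.TwAlg A) (F.twCoact ρ a) := by
    intro a
    obtain ⟨a, rfl⟩ := (F.toTwAlg A).surjective a
    exact coassoc_of_comulRep _ (F.comulRep_targetMap_twCoact hρ a)
  have hbr : ∀ a b : F.TwAlg A, LinearMap.mul' k (F.TwAlg A)
      (((act k F.TwBialg (F.TwAlg A)).flip a).lTensor (F.TwAlg A) (F.twCoact ρ b)) = a * b := by
    intro a b
    obtain ⟨a, rfl⟩ := (F.toTwAlg A).surjective a
    obtain ⟨b, rfl⟩ := (F.toTwAlg A).surjective b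
    rw [← smashCounit_toSmash_mul_baseHom, ← targetMap_apply]
    apply (F.toTwAlg A).symm.injective
    rw [← smashCounit_zetaEquiv, map_mul, zetaEquiv_targetMap, zetaEquiv_baseHom,
      F.smashCounit_twTarget_mul_twSource hρ, toTwAlg_mul, LinearEquiv.symm_apply_apply]
  refine ⟨⟨hco, fun a => ?_, fun h a => ?_⟩, fun a b => ?_, ?_, hbr⟩
  · obtain ⟨a, rfl⟩ := (F.toTwAlg A).surjective a
    rw [counit_iff]
    apply (F.toTwAlg A).symm.injective
    rw [← smashCounit_zetaEquiv, zetaEquiv_targetMap, F.smashCounit_twTarget hρ.toIsYetterDrinfeld,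
      LinearEquiv.symm_apply_apply]
  · obtain ⟨a, rfl⟩ := (F.toTwAlg A).surjective a
    obtain ⟨h, rfl⟩ := F.toTwBialg.surjective h
    rw [compat_iff]
    apply (F.zetaEquiv A).injective
    rw [comul_toTwBialg, zetaEquiv_coactIncl, map_mul, zetaEquiv_inclHom,
      zetaEquiv_targetMap, F.inclHom_mul_twTarget hρ]
  · obtain ⟨a, rfl⟩ := (F.toTwAlg A).surjective a
    obtain ⟨b, rfl⟩ := (F.toTwAlg A).surjective b
    rw [coact_mul_iff hco hbr]
    apply (F.zetaEquiv A).injective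
    rw [toTwAlg_mul, map_mul, zetaEquiv_targetMap, zetaEquiv_targetMap, zetaEquiv_targetMap,
      F.twTarget_mul_twTarget hρ]
  · apply (toSmash k (F.TwAlg A) F.TwBialg).injective
    rw [← targetMap_apply, toSmash_one]
    apply (F.zetaEquiv A).injective
    rw [← toTwAlg_one, zetaEquiv_targetMap, F.twTarget_one hρ, map_one]

end DrinfeldTwist

/-! ## Transport of left bialgebroid structures along isomorphisms -/

section BalancedMaps

variable {k A E : Type*} [Field k] [AddCommGroup A] [Module k A] [Ring E] [Algebra k E]
  {s t : A →ₗ[k] E}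

/-- The balancing subspace is the right ideal generated by the t'(a) ⊗ 1 - 1 ⊗ s'(a), so left
multiplication by g has to be tested on these only. -/
theorem mul_mem_balRel {s' t' : A →ₗ[k] E} {g : E ⊗[k] E}
    (h : ∀ a, (balRel s t).mkQ (g * (t' a ⊗ₜ 1)) = (balRel s t).mkQ (g * (1 ⊗ₜ s' a)))
    {z : E ⊗[k] E} (hz : z ∈ balRel s' t') : g * z ∈ balRel s t := by
  have : balRel s' t' ≤ (balRel s t).comap (LinearMap.mulLeft k g) := by
    refine Submodule.span_le.2 ?_
    rintro _ ⟨a, x, y, rfl⟩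
    have h1 := (Submodule.Quotient.eq _).1 (mkQ_balRel_mul_right (h a) (x ⊗ₜ y))
    simp only [mul_assoc, Algebra.TensorProduct.tmul_mul_tmul, one_mul, ← mul_sub] at h1
    exact h1
  exact this hz

variable {A' E' : Type*} [AddCommGroup A'] [Module k A'] [Ring E'] [Algebra k E']
  {s' t' : A' →ₗ[k] E'}

theorem balRel_le_comap {φ₀ : A →ₗ[k] A'} {φ : E →ₐ[k] E'} (hs : ∀ a, φ (s a) = s' (φ₀ a))
    (ht : ∀ a, φ (t a) = t' (φ₀ a)) :
    balRel s t ≤ (balRel s' t').comap (TensorProduct.map φ.toLinearMap φ.toLinearMap) := by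
  refine Submodule.span_le.2 ?_
  rintro _ ⟨a, x, y, rfl⟩
  exact Submodule.subset_span ⟨φ₀ a, φ x, φ y, by simp [hs, ht]⟩

theorem balRel₃_le_comap {φ₀ : A →ₗ[k] A'} {φ : E →ₐ[k] E'} (hs : ∀ a, φ (s a) = s' (φ₀ a))
    (ht : ∀ a, φ (t a) = t' (φ₀ a)) :
    balRel₃ s t ≤ (balRel₃ s' t').comap (TensorProduct.map φ.toLinearMap
      (TensorProduct.map φ.toLinearMap φ.toLinearMap)) := by
  refine Submodule.span_le.2 ?_
  rintro _ (⟨a, x, y, z, rfl⟩ | ⟨a, x, y, z, rfl⟩)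
  · exact Submodule.subset_span (Or.inl ⟨φ₀ a, φ x, φ y, φ z, by simp [hs, ht]⟩)
  · exact Submodule.subset_span (Or.inr ⟨φ₀ a, φ x, φ y, φ z, by simp [hs, ht]⟩)

end BalancedMaps

namespace LeftBialgebroidData.IsIso

variable {k A E A' E' : Type*} [Field k] [AddCommGroup A] [Module k A] [Ring E] [Algebra k E]
  [AddCommGroup A'] [Module k A'] [Ring E'] [Algebra k E']
  {B : LeftBialgebroidData k A E} {B' : LeftBialgebroidData k A' E'}
  {φ₀ : A ≃ₗ[k] A'} {φ : E ≃ₐ[k] E'}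

/-- Both φ and its inverse carry balancing relations to balancing relations. -/
theorem cls_congr_iff (h : B.IsIso B' φ₀ φ) (z w : E ⊗[k] E) :
    B'.cls (Algebra.TensorProduct.congr φ φ z) = B'.cls (Algebra.TensorProduct.congr φ φ w) ↔
      B.cls z = B.cls w := by
  have h1 : balRel B.source B.target ≤ _ :=
    balRel_le_comap (φ₀ := φ₀.toLinearMap) (φ := (φ : E →ₐ[k] E')) h.map_source h.map_target
  have h2 : balRel B'.source B'.target ≤ (balRel B.source B.target).comap _ :=
    balRel_le_comap (φ₀ := φ₀.symm.toLinearMap) (φ := (φ.symm : E' →ₐ[k] E))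
      (fun a => by
        apply φ.injective
        simp [h.map_source])
      (fun a => by
        apply φ.injective
        simp [h.map_target])
  constructor
  · intro hz
    have h3 := h2 ((Submodule.Quotient.eq _).1 hz)
    rw [← map_sub] at h3
    have h4 : (Algebra.TensorProduct.congr φ φ).symm (Algebra.TensorProduct.congr φ φ (z - w)) ∈
      balRel B.source B.target := h3
    rw [AlgEquiv.symm_apply_apply] at h4
    exact (Submodule.Quotient.eq _).2 h4
  · intro hz
    have h3 := h1 ((Submodule.Quotient.eq _).1 hz)
    refine (Submodule.Quotient.eq _).2 ?_
    rw [← map_sub]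
    exact h3

theorem comul_congr_iff (h : B.IsIso B' φ₀ φ) (x : E) (z : E ⊗[k] E) :
    B'.comul (φ x) = B'.cls (Algebra.TensorProduct.congr φ φ z) ↔ B.comul x = B.cls z := by
  obtain ⟨w, hw⟩ := Submodule.mkQ_surjective _ (B.comul x)
  have h1 : B'.comul (φ x) = B'.cls (Algebra.TensorProduct.congr φ φ w) :=
    h.map_comul x w hw.symm
  rw [h1, h.cls_congr_iff, ← hw]

theorem comulFst_eq_comulSnd (h : B.IsIso B' φ₀ φ) {z : E ⊗[k] E}
    (hz : B.comulFst z = B.comulSnd z) :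
    B'.comulFst (Algebra.TensorProduct.congr φ φ z) =
      B'.comulSnd (Algebra.TensorProduct.congr φ φ z) := by
  let Φ := (balRel₃ B.source B.target).mapQ (balRel₃ B'.source B'.target) _
    (balRel₃_le_comap (φ₀ := φ₀.toLinearMap) (φ := (φ : E →ₐ[k] E')) h.map_source h.map_target)
  have h1 : ∀ z, B'.comulFst (Algebra.TensorProduct.congr φ φ z) = Φ (B.comulFst z) := by
    intro z
    induction z with
    | zero => simp
    | add u v hu hv => simp only [map_add, hu, hv]
    | tmul x y =>
      obtain ⟨w, hw⟩ := Submodule.mkQ_surjective _ (B.comul x)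
      change appendRight _ _ (φ y) (B'.comul (φ x)) = Φ (appendRight _ _ y (B.comul x))
      rw [(h.comul_congr_iff x w).2 hw.symm, ← hw, appendRight_mkQ, appendRight_mkQ]
      refine congrArg (balRel₃ B'.source B'.target).mkQ ?_
      clear hw
      induction w with
      | zero => simp
      | add u v hu hv => simp only [map_add, TensorProduct.add_tmul, hu, hv]
      | tmul p q => rfl
  have h2 : ∀ z, B'.comulSnd (Algebra.TensorProduct.congr φ φ z) = Φ (B.comulSnd z) := by
    intro z
    induction z with
    | zero => simp
    | add u v hu hv => simp only [map_add, hu, hv]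
    | tmul x y =>
      obtain ⟨w, hw⟩ := Submodule.mkQ_surjective _ (B.comul y)
      change appendLeft _ _ (φ x) (B'.comul (φ y)) = Φ (appendLeft _ _ x (B.comul y))
      rw [(h.comul_congr_iff y w).2 hw.symm, ← hw, appendLeft_mkQ, appendLeft_mkQ]
      rfl
  rw [h1, h2, hz]

theorem counitFst_congr (h : B.IsIso B' φ₀ φ) (z : E ⊗[k] E) :
    B'.counitFst (Algebra.TensorProduct.congr φ φ z) = φ (B.counitFst z) := by
  induction z with
  | zero => simp
  | add u v hu hv => simp only [map_add, hu, hv]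
  | tmul x y => simp [LeftBialgebroidData.counitFst, h.map_counit, h.map_source]

theorem counitSnd_congr (h : B.IsIso B' φ₀ φ) (z : E ⊗[k] E) :
    B'.counitSnd (Algebra.TensorProduct.congr φ φ z) = φ (B.counitSnd z) := by
  induction z with
  | zero => simp
  | add u v hu hv => simp only [map_add, hu, hv]
  | tmul x y => simp [LeftBialgebroidData.counitSnd, h.map_counit, h.map_target]

/-- By surjectivity of φ₀, φ and φ ⊗ φ, every quantifier in the axioms can be pulled back to B.
Nothing is assumed of B' beyond its structure maps being matched. -/
theorem isLeftBialgebroid (h : B.IsIso B' φ₀ φ) (hB : B.IsLeftBialgebroid) :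
    B'.IsLeftBialgebroid := by
  have hs : ∀ a, B'.source (φ₀ a) = φ (B.source a) := fun a => (h.map_source a).symm
  have ht : ∀ a, B'.target (φ₀ a) = φ (B.target a) := fun a => (h.map_target a).symm
  have hm : ∀ a b, B'.mul (φ₀ a) (φ₀ b) = φ₀ (B.mul a b) := fun a b => (h.map_base_mul a b).symm
  let φ₂ := Algebra.TensorProduct.congr φ φ
  have h2 : ∀ x y, φ x ⊗ₜ[k] φ y = φ₂ (x ⊗ₜ y) := fun _ _ => rfl
  have h21 : ∀ x, φ x ⊗ₜ[k] (1 : E') = φ₂ (x ⊗ₜ 1) := fun x => by rw [← h2, map_one]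
  have h22 : ∀ x, (1 : E') ⊗ₜ[k] φ x = φ₂ (1 ⊗ₜ x) := fun x => by rw [← h2, map_one]
  constructor
  · refine φ₀.surjective.forall₃.2 fun a b c => ?_
    simp only [hm, hB.mul_assoc]
  · refine φ₀.surjective.forall.2 fun a => ?_
    rw [← h.map_base_one, hm, hB.one_mul]
  · refine φ₀.surjective.forall.2 fun a => ?_
    rw [← h.map_base_one, hm, hB.mul_one]
  · refine φ₀.surjective.forall₂.2 fun a b => ?_
    rw [hm, hs, hs, hs, hB.source_mul, map_mul]
  · rw [← h.map_base_one, hs, hB.source_one, map_one]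
  · refine φ₀.surjective.forall₂.2 fun a b => ?_
    rw [hm, ht, ht, ht, hB.target_mul, map_mul]
  · rw [← h.map_base_one, ht, hB.target_one, map_one]
  · refine φ₀.surjective.forall₂.2 fun a b => ?_
    rw [hs, ht, ← map_mul, hB.source_target_comm, map_mul]
  · refine φ₀.surjective.forall₂.2 fun a b => φ.surjective.forall.2 fun x =>
      φ₂.surjective.forall.2 fun z hz => ?_
    rw [hs, ht, ← map_mul, ← map_mul, h2, ← map_mul]
    exact (h.comul_congr_iff _ _).2 (hB.comul_bimodule a b x z ((h.comul_congr_iff x z).1 hz))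
  · refine φ₀.surjective.forall₂.2 fun a b => φ.surjective.forall.2 fun x => ?_
    rw [hs, ht, ← map_mul, ← map_mul, h.map_counit, h.map_counit, hm, hm, hB.counit_bimodule]
  · refine φ.surjective.forall.2 fun x => φ₂.surjective.forall.2 fun z hz => ?_
    exact h.comulFst_eq_comulSnd (hB.coassoc x z ((h.comul_congr_iff x z).1 hz))
  · refine φ.surjective.forall.2 fun x => φ₂.surjective.forall.2 fun z hz => ?_
    rw [h.counitFst_congr, hB.counit_comul_fst x z ((h.comul_congr_iff x z).1 hz)]
  · refine φ.surjective.forall.2 fun x => φ₂.surjective.forall.2 fun z hz => ?_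
    rw [h.counitSnd_congr, hB.counit_comul_snd x z ((h.comul_congr_iff x z).1 hz)]
  · refine φ₀.surjective.forall.2 fun a => φ.surjective.forall.2 fun x =>
      φ₂.surjective.forall.2 fun z hz => ?_
    rw [hs, ht, h21, h22, ← map_mul, ← map_mul]
    exact (h.cls_congr_iff _ _).2 (hB.takeuchi a x z ((h.comul_congr_iff x z).1 hz))
  · rw [← map_one φ, ← map_one φ₂]
    exact (h.comul_congr_iff _ _).2 hB.comul_one
  · refine φ.surjective.forall₂.2 fun x y => φ₂.surjective.forall₂.2 fun z w hz hw => ?_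
    rw [← map_mul, ← map_mul]
    exact (h.comul_congr_iff _ _).2 (hB.comul_mul x y z w ((h.comul_congr_iff x z).1 hz)
      ((h.comul_congr_iff y w).1 hw))
  · rw [← map_one φ, h.map_counit, hB.counit_one, h.map_base_one]
  · refine φ.surjective.forall₂.2 fun x y => ?_
    rw [h.map_counit y, hs, ← map_mul, ← map_mul, h.map_counit, h.map_counit,
      hB.counit_mul_source]
  · refine φ.surjective.forall₂.2 fun x y => ?_
    rw [h.map_counit y, ht, ← map_mul, ← map_mul, h.map_counit, h.map_counit,
      hB.counit_mul_target]

end LeftBialgebroidData.IsIso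

/-! ## The Drinfeld–Xu cocycle -/

namespace DrinfeldTwist

variable {k A H : Type*} [Field k] [Ring H] [Bialgebra k H] (F : DrinfeldTwist k H)
  [Ring A] [Algebra k A] [Module H A] [IsScalarTower k H A] [IsModuleAlgebra k H A]

variable (A) in
theorem cocycleRep_eq : F.cocycleRep A = inclHom₂ k A H F.inv := rfl

variable (A) in
theorem cocycleInvRep_eq : F.cocycleInvRep A = inclHom₂ k A H F.elt := rfl

variable (ρ : A →ₗ[k] A ⊗[k] H)

theorem bact_inclHom (h : H) (a : A) :
    (scalarExtension k A H ρ).bact (inclHom k A H h) a = h • a :=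
  smashCounit_inclHom_mul_baseHom h a

theorem xuMul_cocycleRep (a b : A) :
    (scalarExtension k A H ρ).xuMul (F.cocycleRep A) a b = mulAct k H A F.inv a b := by
  rw [cocycleRep_eq]
  change TensorProduct.lift (LinearMap.mul k A) (TensorProduct.map
    ((scalarExtension k A H ρ).bact.flip a) ((scalarExtension k A H ρ).bact.flip b)
    (inclHom₂ k A H F.inv)) = _
  generalize F.inv = w
  induction w with
  | zero => simp
  | add u v hu hv => simp only [map_add, LinearMap.add_apply, hu, hv]
  | tmul x y => simp [bact_inclHom]

theorem xuSource_cocycleRep :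
    (scalarExtension k A H ρ).xuSource (F.cocycleRep A) = F.twSource A := by
  ext a
  rw [cocycleRep_eq, twSource_apply]
  change LinearMap.mul' k _ (((baseHom k A H).toLinearMap ∘ₗ
    (scalarExtension k A H ρ).bact.flip a).rTensor _ (inclHom₂ k A H F.inv)) = _
  generalize F.inv = w
  induction w with
  | zero => simp
  | add u v hu hv => simp only [map_add, hu, hv]
  | tmul x y => simp [bact_inclHom]

theorem xuTarget_cocycleRep :
    (scalarExtension k A H ρ).xuTarget (F.cocycleRep A) = F.twTarget ρ := by
  ext a
  rw [cocycleRep_eq, twTarget_apply]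
  change LinearMap.mul' k _ ((targetMap ρ ∘ₗ
    (scalarExtension k A H ρ).bact.flip a).rTensor _
      (TensorProduct.comm k _ _ (inclHom₂ k A H F.inv))) = _
  generalize F.inv = w
  induction w with
  | zero => simp
  | add u v hu hv => simp only [map_add, hu, hv]
  | tmul x y => simp [bact_inclHom]

variable (k A H) in
/-- `x ⊗ y ⊗ z ↦ (1 ♯ x) ⊗ (1 ♯ y) ⊗ (1 ♯ z)`. -/
def inclHom₃ : H ⊗[k] (H ⊗[k] H) →ₐ[k] Smash k A H ⊗[k] (Smash k A H ⊗[k] Smash k A H) :=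
  Algebra.TensorProduct.map (inclHom k A H) (inclHom₂ k A H)

theorem inclHom₃_assoc_tmul (w : H ⊗[k] H) (z : H) :
    inclHom₃ k A H (TensorProduct.assoc k H H H (w ⊗ₜ z)) =
      TensorProduct.assoc k _ _ _ (inclHom₂ k A H w ⊗ₜ inclHom k A H z) := by
  induction w with
  | zero => simp
  | add u v hu hv => simp only [map_add, TensorProduct.add_tmul, hu, hv]
  | tmul x y => rfl

theorem comulFst_inclHom₂ (w : H ⊗[k] H) :
    (scalarExtension k A H ρ).comulFst (inclHom₂ k A H w) =
      (scalarExtension k A H ρ).cls₃ (inclHom₃ k A H (ScalarExt.comulFst k H w)) := by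
  induction w with
  | zero => simp
  | add u v hu hv => simp only [map_add, hu, hv]
  | tmul p q =>
    change appendRight (baseHom k A H).toLinearMap (targetMap ρ) (inclHom k A H q)
      ((balRel (baseHom k A H).toLinearMap (targetMap ρ)).mkQ
        (comulRep k A H (inclHom k A H p))) = _
    rw [comulRep_inclHom, appendRight_mkQ, comulFst_tmul, inclHom₃_assoc_tmul]
    rfl

theorem comulSnd_inclHom₂ (w : H ⊗[k] H) :
    (scalarExtension k A H ρ).comulSnd (inclHom₂ k A H w) =
      (scalarExtension k A H ρ).cls₃ (inclHom₃ k A H (ScalarExt.comulSnd k H w)) := by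
  induction w with
  | zero => simp
  | add u v hu hv => simp only [map_add, hu, hv]
  | tmul p q =>
    change appendLeft (baseHom k A H).toLinearMap (targetMap ρ) (inclHom k A H p)
      ((balRel (baseHom k A H).toLinearMap (targetMap ρ)).mkQ
        (comulRep k A H (inclHom k A H q))) = _
    rw [comulRep_inclHom, appendLeft_mkQ, comulSnd_tmul]
    rfl

/-- `x ⊗ y ⊗ z ↦ (1 ♯ x) ⊗ f(y ▹ a)(1 ♯ z)`. -/
def inclAct (f : A →ₗ[k] Smash k A H) (a : A) :
    H ⊗[k] (H ⊗[k] H) →ₗ[k] Smash k A H ⊗[k] Smash k A H :=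
  TensorProduct.map (inclHom k A H).toLinearMap (actIncl f a)

theorem inclAct_tmul (f : A →ₗ[k] Smash k A H) (a : A) (x : H) (w : H ⊗[k] H) :
    inclAct f a (x ⊗ₜ w) = inclHom k A H x ⊗ₜ actIncl f a w := rfl

/-- One balancing move, for arbitrary s and t, since it is needed for both the original and the
twisted balancing. -/
theorem mkQ_coactIncl_tmul (s t : A →ₗ[k] Smash k A H) (a : A) (w : H ⊗[k] H) (q : H) :
    (balRel s t).mkQ (coactIncl t a w ⊗ₜ inclHom k A H q) =
      (balRel s t).mkQ (inclAct s a (TensorProduct.assoc k H H H (w ⊗ₜ q))) := by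
  induction w with
  | zero => simp
  | add u v hu hv => simp only [map_add, TensorProduct.add_tmul, hu, hv]
  | tmul x y => exact mkQ_balRel_tmul (y • a) (inclHom k A H x) (inclHom k A H q)

variable {ρ} (hρ : IsBraidedCommYDAlgebra k H A ρ)
include hρ

/-- Pushing everything into the second leg yields (Δ ⊗ id)F⁻¹ · (F⁻¹ ⊗ 1) on one side and (id ⊗
Δ)F⁻¹ · (1 ⊗ F⁻¹) on the other. Hence multiplication by 𝒢 maps the twisted balancing into the
original one. -/
theorem mkQ_inclHom₂_inv_mul (a : A) :
    (balRel (baseHom k A H).toLinearMap (targetMap ρ)).mkQ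
      (inclHom₂ k A H F.inv * (F.twTarget ρ a ⊗ₜ 1)) =
    (balRel (baseHom k A H).toLinearMap (targetMap ρ)).mkQ
      (inclHom₂ k A H F.inv * (1 ⊗ₜ F.twSource A a)) := by
  have h1 : ∀ z w : H ⊗[k] H, (balRel (baseHom k A H).toLinearMap (targetMap ρ)).mkQ
      (inclHom₂ k A H z * (coactIncl (targetMap ρ) a w ⊗ₜ 1)) =
      (balRel (baseHom k A H).toLinearMap (targetMap ρ)).mkQ
        (inclAct (baseHom k A H).toLinearMap a (comulFst k H z * leg12 k H w)) := by
    intro z w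
    induction z with
    | zero => simp
    | add u v hu hv => simp only [map_add, add_mul, hu, hv]
    | tmul p q =>
      rw [comulFst_tmul_mul_leg12, inclHom₂_tmul, Algebra.TensorProduct.tmul_mul_tmul, mul_one,
        inclHom_mul_coactIncl (f := targetMap ρ) hρ.inclHom_mul_targetMap, mkQ_coactIncl_tmul]
  have h2 : ∀ z w : H ⊗[k] H,
      inclHom₂ k A H z * (1 ⊗ₜ actIncl (baseHom k A H).toLinearMap a w) =
        inclAct (baseHom k A H).toLinearMap a (comulSnd k H z * leg23 k H w) := by
    intro z w
    induction z with
    | zero => simp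
    | add u v hu hv => simp only [map_add, add_mul, hu, hv]
    | tmul p q =>
      rw [comulSnd_tmul_mul_leg23, inclHom₂_tmul, Algebra.TensorProduct.tmul_mul_tmul, mul_one,
        inclHom_mul_actIncl (f := (baseHom k A H).toLinearMap) inclHom_mul_baseHom,
        inclAct_tmul]
  rw [twTarget_apply, twSource_apply, h1, h2, cocycle_inv]

/-- The reverse direction: rewriting s and t through s^𝒢 and t^𝒢 inserts a factor F, and the two
sides become those of the cocycle identity for F itself. -/
theorem mkQ_inclHom₂_elt_mul (a : A) :
    (balRel (F.twSource A) (F.twTarget ρ)).mkQ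
      (inclHom₂ k A H F.elt * (targetMap ρ a ⊗ₜ 1)) =
    (balRel (F.twSource A) (F.twTarget ρ)).mkQ
      (inclHom₂ k A H F.elt * (1 ⊗ₜ baseHom k A H a)) := by
  have h1 : ∀ z : H ⊗[k] H, (balRel (F.twSource A) (F.twTarget ρ)).mkQ
      (inclHom₂ k A H z * (targetMap ρ a ⊗ₜ 1)) =
      (balRel (F.twSource A) (F.twTarget ρ)).mkQ
        (inclAct (F.twSource A) a (leg12 k H F.elt * comulFst k H z)) := by
    intro z
    induction z with
    | zero => simp
    | add u v hu hv => simp only [map_add, add_mul, mul_add, hu, hv]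
    | tmul p q =>
      have h : leg12 k H F.elt * comulFst k H (p ⊗ₜ q) =
          TensorProduct.assoc k H H H ((F.elt * Coalgebra.comul p) ⊗ₜ q) := by
        change Algebra.TensorProduct.assoc k k k H H H (F.elt ⊗ₜ 1) *
          Algebra.TensorProduct.assoc k k k H H H (Coalgebra.comul p ⊗ₜ q) = _
        rw [← map_mul, Algebra.TensorProduct.tmul_mul_tmul, one_mul]
        rfl
      rw [h, inclHom₂_tmul, Algebra.TensorProduct.tmul_mul_tmul, mul_one,
        hρ.inclHom_mul_targetMap, ← mkQ_coactIncl_tmul (F.twSource A) (F.twTarget ρ),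
        coactIncl_twTarget, ← mul_assoc, inv_mul_elt, one_mul]
  have h2 : ∀ z : H ⊗[k] H, inclHom₂ k A H z * (1 ⊗ₜ baseHom k A H a) =
      inclAct (F.twSource A) a (leg23 k H F.elt * comulSnd k H z) := by
    intro z
    induction z with
    | zero => simp
    | add u v hu hv => simp only [map_add, add_mul, mul_add, hu, hv]
    | tmul p q =>
      have h : leg23 k H F.elt * comulSnd k H (p ⊗ₜ q) =
          p ⊗ₜ (F.elt * Coalgebra.comul q) := by
        simp [comulSnd, leg23]
      rw [h, inclHom₂_tmul, Algebra.TensorProduct.tmul_mul_tmul, mul_one, inclHom_mul_baseHom,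
        inclAct_tmul, actIncl_twSource, ← mul_assoc, inv_mul_elt, one_mul]
  rw [h1, h2, F.cocycle]

/-- `𝒢 = (1 ♯ F̄¹) ⊗_A (1 ♯ F̄²)` is an invertible bialgebroid 2-cocycle. -/
theorem isDrinfeldXuCocycle : (scalarExtension k A H ρ).IsDrinfeldXuCocycle (F.cocycleRep A)
    (F.cocycleInvRep A) where
  cocycle u v hu hv := by
    rw [cocycleRep_eq] at hu hv ⊢
    rw [comulFst_inclHom₂] at hu
    rw [comulSnd_inclHom₂] at hv
    have h1 : TensorProduct.assoc k _ _ _ (inclHom₂ k A H F.inv ⊗ₜ 1) =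
        inclHom₃ k A H (leg12 k H F.inv) := by
      rw [leg12_apply, inclHom₃_assoc_tmul, map_one]
    have h2 : 1 ⊗ₜ inclHom₂ k A H F.inv = inclHom₃ k A H (leg23 k H F.inv) := by
      simp [inclHom₃, leg23]
    rw [h1, h2]
    -- Right multiplication descends to the triple balanced product, so u and v may be replaced by
    -- the images of (Δ ⊗ id)F⁻¹ and (id ⊗ Δ)F⁻¹.
    refine (mkQ_balRel₃_mul_right hu.symm _).trans
      (Eq.trans ?_ (mkQ_balRel₃_mul_right hv _))
    rw [← map_mul, ← map_mul, cocycle_inv]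
  counit_fst := by
    have h := counitFst_baseHom_mul_inclHom₂ ρ 1 F.inv
    rw [counit_fst_inv, map_one, map_one, mul_one, ← Algebra.TensorProduct.one_def, one_mul] at h
    exact h
  counit_snd := by
    have h := counitSnd_baseHom_mul_inclHom₂ hρ 1 F.inv
    rw [counit_snd_inv, map_one, map_one, mul_one, ← Algebra.TensorProduct.one_def, one_mul] at h
    exact h
  inv_mul_mem z hz := by
    rw [xuSource_cocycleRep, xuTarget_cocycleRep]
    exact mul_mem_balRel (F.mkQ_inclHom₂_elt_mul hρ) hz
  mul_mem z hz := by
    rw [xuSource_cocycleRep, xuTarget_cocycleRep] at hz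
    exact mul_mem_balRel (F.mkQ_inclHom₂_inv_mul hρ) hz
  inv_mul := by
    rw [cocycleRep_eq, cocycleInvRep_eq, ← map_mul, elt_mul_inv, map_one]
  mul_inv := by
    rw [cocycleRep_eq, cocycleInvRep_eq, ← map_mul, inv_mul_elt, map_one]

/-- `ζ` is an isomorphism of left bialgebroids from `A_F ♯ H^F` to `(A ♯ H)^𝒢`. -/
theorem isIso_zetaEquiv :
    (scalarExtension k (F.TwAlg A) F.TwBialg (F.twCoact ρ)).IsIso
      ((scalarExtension k A H ρ).xuTwist _ _ (F.isDrinfeldXuCocycle hρ))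
      (F.toTwAlg A).symm (F.zetaEquiv A) := by
  have hs : ∀ a : F.TwAlg A, F.zetaEquiv A (baseHom k (F.TwAlg A) F.TwBialg a) =
      (scalarExtension k A H ρ).xuSource (F.cocycleRep A) ((F.toTwAlg A).symm a) := by
    intro a
    obtain ⟨a, rfl⟩ := (F.toTwAlg A).surjective a
    rw [zetaEquiv_baseHom, xuSource_cocycleRep, LinearEquiv.symm_apply_apply]
  have ht : ∀ a : F.TwAlg A, F.zetaEquiv A (targetMap (F.twCoact ρ) a) =
      (scalarExtension k A H ρ).xuTarget (F.cocycleRep A) ((F.toTwAlg A).symm a) := by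
    intro a
    obtain ⟨a, rfl⟩ := (F.toTwAlg A).surjective a
    rw [zetaEquiv_targetMap, xuTarget_cocycleRep, LinearEquiv.symm_apply_apply]
  refine ⟨fun a b => ?_, rfl, hs, ht, fun x z hz => ?_, fun x => F.smashCounit_zetaEquiv x⟩
  · obtain ⟨a, rfl⟩ := (F.toTwAlg A).surjective a
    obtain ⟨b, rfl⟩ := (F.toTwAlg A).surjective b
    exact (F.xuMul_cocycleRep ρ a b).symm
  · have h1 : ((scalarExtension k A H ρ).xuTwist _ _ (F.isDrinfeldXuCocycle hρ)).comul
        (F.zetaEquiv A x) = ((scalarExtension k A H ρ).xuTwist _ _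
          (F.isDrinfeldXuCocycle hρ)).cls (F.zetaEquiv₂ A (comulRep k _ _ x)) := by
      rw [zetaEquiv₂_comulRep, mul_assoc]
      rfl
    rw [h1]
    -- The standard lift and z differ by balancing relations of A_F ♯ H^F, which ζ ⊗ ζ sends to
    -- those of the twist.
    refine (Submodule.Quotient.eq _).2 ?_
    have h2 := balRel_le_comap (s := (baseHom k (F.TwAlg A) F.TwBialg).toLinearMap)
      (t := targetMap (F.twCoact ρ)) (s' := (scalarExtension k A H ρ).xuSource (F.cocycleRep A))
      (t' := (scalarExtension k A H ρ).xuTarget (F.cocycleRep A))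
      (φ₀ := (F.toTwAlg A).symm.toLinearMap)
      (φ := (F.zetaEquiv A : Smash k (F.TwAlg A) F.TwBialg →ₐ[k] Smash k A H)) hs ht
      ((Submodule.Quotient.eq _).1 hz)
    rw [Submodule.mem_comap, map_sub] at h2
    exact h2

end DrinfeldTwist

end

end ScalarExt

/-- `H` is a bialgebra over a field `k`, `F` a Drinfeld twist for `H`, and `A`, with the coaction
`ρ`, a braided commutative Yetter–Drinfeld `H`-module algebra. -/
theorem theorem2 {k H A : Type*} [Field k] [Ring H] [Bialgebra k H] (F : DrinfeldTwist k H)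
    [Ring A] [Algebra k A] [Module H A] [IsScalarTower k H A] [IsModuleAlgebra k H A]
    (ρ : A →ₗ[k] A ⊗[k] H) (hρ : IsBraidedCommYDAlgebra k H A ρ) :
    -- `A_F` is a braided commutative Yetter–Drinfeld `H^F`-module algebra
    IsBraidedCommYDAlgebra k F.TwBialg (F.TwAlg A) (F.twCoact ρ) ∧
    -- `A ♯ H` and `A_F ♯ H^F` are left bialgebroids over `A` and `A_F`
    (scalarExtension k A H ρ).IsLeftBialgebroid ∧
    (scalarExtension k (F.TwAlg A) F.TwBialg (F.twCoact ρ)).IsLeftBialgebroid ∧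
    -- `𝒢` is a Drinfeld–Xu cocycle, and the twist of `A ♯ H` by it is a left bialgebroid
    ∃ h𝒢 : (scalarExtension k A H ρ).IsDrinfeldXuCocycle (F.cocycleRep A) (F.cocycleInvRep A),
      ((scalarExtension k A H ρ).xuTwist _ _ h𝒢).IsLeftBialgebroid ∧
      -- `ζ` is an algebra isomorphism, and an isomorphism of bialgebroids over `A_F = A^𝒢`
      ∃ Z : Smash k (F.TwAlg A) F.TwBialg ≃ₐ[k] Smash k A H,
        (∀ x, Z x = F.zeta A x) ∧
        (scalarExtension k (F.TwAlg A) F.TwBialg (F.twCoact ρ)).IsIso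
          ((scalarExtension k A H ρ).xuTwist _ _ h𝒢) (F.toTwAlg A).symm Z := by
  refine ⟨F.isBraidedCommYDAlgebra_twCoact hρ, scalarExtension_isLeftBialgebroid hρ,
    scalarExtension_isLeftBialgebroid (F.isBraidedCommYDAlgebra_twCoact hρ),
    F.isDrinfeldXuCocycle hρ, ?_, F.zetaEquiv A, fun _ => rfl, F.isIso_zetaEquiv hρ⟩
  -- The twist inherits its axioms along ζ from the scalar extension of A_F.
  exact (F.isIso_zetaEquiv hρ).isLeftBialgebroid
    (scalarExtension_isLeftBialgebroid (F.isBraidedCommYDAlgebra_twCoact hρ))
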